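/- Let $v_\sigma$ be a bounded real random variable on a probability space $(\Sigma,\mathbf p)$ with expectation $\mathbf E$, let $\epsilon\in\mathbb R$, and for $\lambda\in\mathbb R$ consider the Anderson transfer matrices at the energy $E=\epsilon\lambda^2$, $$T_{\lambda,\sigma}=\begin{pmatrix}\lambda v_\sigma-\epsilon\lambda^2&-1\\1&0\end{pmatrix}.$$ Let $\sigma_1,\sigma_2,\dots$ be independent with law $\mathbf p$ and $e_\theta=(\cos\theta,\sin\theta)$. For all $\lambda$ in some neighbourhood of $0$ the Lyapunov exponent $$\gamma(\lambda)=\lim_{N\to\infty}\frac1N\,\mathbf E\log\|T_{\lambda,\sigma_N}\cdots T_{\lambda,\sigma_1}e_\theta\|$$ exists for every $\theta$ and does not depend on $\theta$. As $\lambda\to0$ the following hold. 1. If $\mathbf E(v_\sigma)\neq0$, then $$\gamma(\lambda)=\tfrac18\,\lambda^2\bigl(\mathbf E(v_\sigma^2)-\mathbf E(v_\sigma)^2\bigr)+\mathcal O(\lambda^3).$$ 2. If $\mathbf E(v_\sigma)=0$, then $$\gamma(\lambda)=\tfrac18\,\lambda^2\,\mathbf E(v_\sigma^2)\int_0^{2\pi}\frac{d\theta}{2\pi}\,\rho_0(\theta)\,(1+\cos4\theta)+\mathcal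 O(\lambda^3),$$ and the coefficient of $\lambda^2$ is strictly positive unless $v_\sigma=0$ almost surely (in which case it is read as $0$). Here $\rho_0$ is defined as follows. For two independent letters $\hat\sigma=(\sigma_2,\sigma_1)$ set $$P_{\hat\sigma}=\begin{pmatrix}0&v_{\sigma_2}\\-v_{\sigma_1}&0\end{pmatrix},\qquad Q_{\hat\sigma}=\begin{pmatrix}-\frac12v_{\sigma_1}v_{\sigma_2}&-\epsilon\\\epsilon&\frac12v_{\sigma_1}v_{\sigma_2}\end{pmatrix},$$ so that $T_{\lambda,\sigma_2}T_{\lambda,\sigma_1}=-\exp(\lambda P_{\hat\sigma}+\lambda^2Q_{\hat\sigma}+\mathcal O(\lambda^3))$; with $w=\frac1{\sqrt2}(1,-\imath)^T$ (and $\langle\cdot|$ antilinear) set $$p_{\hat\sigma}(\theta)=\Im\frac{\langle w|P_{\hat\sigma}|e_\theta\rangle}{\langle w|e_\theta\rangle},\qquad q_{\hat\sigma}(\theta)=\Im\frac{\langle w|Q_{\hat\sigma}|e_\theta\rangle}{\langle w|e_\theta\rangle},$$ $$\kappa(\theta)=\int_0^\theta\frac{2\,\mathbf E(q_{\hat\sigma}(t))}{\mathbf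 E(p_{\hat\sigma}^2(t))}\,dt,\quad K(\theta)=\int_0^\theta 2\,\mathbf E(p_{\hat\sigma}^2(t))^{-1/2}e^{-\kappa(t)}\,dt,\quad C=\frac{e^{-\kappa(2\pi)}-1}{K(2\pi)},$$ $$\rho_0(\theta)=\frac{c\,e^{\kappa(\theta)}}{\mathbf E(p_{\hat\sigma}^2(\theta))^{1/2}}\,\bigl(C\,K(\theta)+1\bigr),$$ with the constant $c$ fixed by $\int_0^{2\pi}\rho_0(\theta)\,\frac{d\theta}{2\pi}=1$. 3. If $\mathbf E(v_\sigma)=0$ and $\epsilon=0$, then, unless $v_\sigma=0$ almost surely, $\rho_0(\theta)=c\,(1+\cos^2(2\theta))^{-1/2}$ with $c^{-1}=\int_0^{2\pi}(1+\cos^2(2\theta))^{-1/2}\frac{d\theta}{2\pi}$; and the Derrida–Gardner formula holds: $$\gamma(\lambda)=\lambda^2\,\mathbf E(v_\sigma^2)\left(\frac{\Gamma(3/4)}{\Gamma(1/4)}\right)^2+\mathcal O(\lambda^3).$$ -/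

import Mathlib

open MeasureTheory Filter Topology Asymptotics

namespace AndersonBandCenter

noncomputable section

/-- The Anderson transfer matrix `[[lam * x - E, -1], [1, 0]]` for the value `x` of the potential,
at the energy `E = ε * lam ^ 2` near the band center. -/
def transfer (ε lam x : ℝ) : Matrix (Fin 2) (Fin 2) ℝ :=
  !![lam * x - ε * lam ^ 2, -1; 1, 0]

/-- The product `T_N ⋯ T_1` of transfer matrices along the code `ω`; the `n`-th letter
(`n = 1, 2, …`) of the code is `ω (n - 1)`. -/
def transferProd {S : Type*} (v : S → ℝ) (ε lam : ℝ) (ω : ℕ → S) : ℕ → Matrix (Fin 2) (Fin 2) ℝ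
  | 0 => 1
  | N + 1 => transfer ε lam (v (ω N)) * transferProd v ε lam ω N

/-- The unit vector `e_θ = (cos θ, sin θ)`. -/
def unitVec (θ : ℝ) : Fin 2 → ℝ := ![Real.cos θ, Real.sin θ]

/-- `𝔼 log ‖T_N ⋯ T_1 e_θ‖` with the Euclidean norm, the letters of the code being independent
with law `μ`. -/
def meanLogGrowth {S : Type*} [MeasurableSpace S] (μ : Measure S) [IsProbabilityMeasure μ]
    (v : S → ℝ) (ε lam θ : ℝ) (N : ℕ) : ℝ :=
  ∫ ω, Real.log ‖WithLp.toLp 2 ((transferProd v ε lam ω N).mulVec (unitVec θ))‖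
    ∂(Measure.infinitePi fun _ : ℕ => μ)

/-- `g` is the Lyapunov exponent at coupling `lam`: the limit of `N⁻¹ 𝔼 log ‖T_N ⋯ T_1 e_θ‖`
exists and equals `g` for every initial condition `θ`. -/
def IsLyapunovExponent {S : Type*} [MeasurableSpace S] (μ : Measure S) [IsProbabilityMeasure μ]
    (v : S → ℝ) (ε lam g : ℝ) : Prop :=
  ∀ θ : ℝ, Tendsto (fun N : ℕ => (1 / (N : ℝ)) * meanLogGrowth μ v ε lam θ N) atTop (𝓝 g)

/-- First order coefficient `P` of `T T' = -exp (lam P + lam ^ 2 Q + O(lam ^ 3))` for the two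
transfer matrices `T`, `T'` with potential values `y`, `x` (`x` comes first in time). -/
def pairP (y x : ℝ) : Matrix (Fin 2) (Fin 2) ℝ :=
  !![0, y; -x, 0]

/-- Second order coefficient `Q` of `T T' = -exp (lam P + lam ^ 2 Q + O(lam ^ 3))`. -/
def pairQ (ε y x : ℝ) : Matrix (Fin 2) (Fin 2) ℝ :=
  !![-(1 / 2) * x * y, -ε; ε, (1 / 2) * x * y]

/-- `T T' = -(1 + lam P + lam ^ 2 (Q + P ^ 2 / 2)) + O(lam ^ 3)`, with the exact remainder. -/
theorem transfer_mul_transfer (ε lam y x : ℝ) :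
    transfer ε lam y * transfer ε lam x =
      -(1 + lam • pairP y x + lam ^ 2 • (pairQ ε y x + (1 / 2 : ℝ) • (pairP y x * pairP y x))
        + lam ^ 3 • !![ε * (x + y) - lam * ε ^ 2, 0; 0, 0]) := by
  ext i j
  fin_cases i <;> fin_cases j <;>
    simp [transfer, pairP, pairQ, Matrix.mul_apply, Fin.sum_univ_two] <;> ring_nf <;> simp

/-- The complex unit vector `(1, -i) / √2`. -/
def circVec : Fin 2 → ℂ := ![1 / (Real.sqrt 2 : ℂ), -Complex.I / (Real.sqrt 2 : ℂ)]

/-- For a real matrix `X`, the trigonometric polynomial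
`θ ↦ Im (⟨w|X|e_θ⟩ / ⟨w|e_θ⟩)` with `w = (1, -i) / √2`. -/
def phasePoly (X : Matrix (Fin 2) (Fin 2) ℝ) (θ : ℝ) : ℝ :=
  (dotProduct (star circVec) ((X.map Complex.ofReal).mulVec fun i => (unitVec θ i : ℂ)) /
    dotProduct (star circVec) fun i => (unitVec θ i : ℂ)).im

section Density

variable {S : Type*} [MeasurableSpace S] (μ : Measure S) (v : S → ℝ) (ε : ℝ)

/-- `𝔼 (p ^ 2)` at `θ`, where `p` is the phase polynomial of `P` for two independent letters. -/
def meanPSq (θ : ℝ) : ℝ :=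
  ∫ s : S × S, phasePoly (pairP (v s.1) (v s.2)) θ ^ 2 ∂(μ.prod μ)

/-- `𝔼 q` at `θ`, where `q` is the phase polynomial of `Q` for two independent letters. -/
def meanQ (θ : ℝ) : ℝ :=
  ∫ s : S × S, phasePoly (pairQ ε (v s.1) (v s.2)) θ ∂(μ.prod μ)

/-- `κ(θ) = ∫₀^θ 2 𝔼(q) / 𝔼(p ^ 2)`. -/
def kappa (θ : ℝ) : ℝ :=
  ∫ t in (0 : ℝ)..θ, 2 * meanQ μ v ε t / meanPSq μ v t

/-- `K(θ) = ∫₀^θ 2 𝔼(p ^ 2)^(-1/2) e^(-κ)`. -/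
def bigK (θ : ℝ) : ℝ :=
  ∫ t in (0 : ℝ)..θ, 2 * meanPSq μ v t ^ (-(1 / 2) : ℝ) * Real.exp (-kappa μ v ε t)

/-- `C = (e^(-κ(2π)) - 1) / K(2π)`. -/
def constC : ℝ :=
  (Real.exp (-kappa μ v ε (2 * Real.pi)) - 1) / bigK μ v ε (2 * Real.pi)

/-- The density before normalization,
`e^(κ(θ)) 𝔼(p ^ 2)^(-1/2) (C K(θ) + 1)`. -/
def preDensity (θ : ℝ) : ℝ :=
  Real.exp (kappa μ v ε θ) / Real.sqrt (meanPSq μ v θ) * (constC μ v ε * bigK μ v ε θ + 1)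

/-- The lowest order `ρ₀` of the density of the invariant measure with respect to `dθ / 2π`,
normalized by `∫₀^{2π} ρ₀ dθ / 2π = 1`. -/
def rhoZero (θ : ℝ) : ℝ :=
  ((∫ t in (0 : ℝ)..(2 * Real.pi), preDensity μ v ε t) / (2 * Real.pi))⁻¹ * preDensity μ v ε θ

end Density

end

end AndersonBandCenter

open AndersonBandCenter

/-! Two consecutive transfer matrices multiply to minus a matrix 1 + O(λ), so the plane is read as ℂ
and letters are taken in pairs. A nonzero vector z is multiplied in one pair step by 1 + λz₁ + λ²z₂
+ λ³z₃, with coefficients depending on arg z and the two letters (`act_pairStep`); the complex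
logarithm of this factor gives the change of log ‖z‖ and of the angle.

The invariant measure on directions is never constructed. Instead log ‖z‖ is corrected to U(z) = log
‖z‖ + G(arg z), with G bounded and 2π-periodic, so that the mean increment of U is 2aλ² + O(λ³)
uniformly in z. Telescoping then pins the growth rate per letter to aλ² + O(λ³).

The same U yields existence of the limit. When a > 0 and λ ≠ 0 is small the drift of U is uniformly
positive, so E exp(-τ(U(x) + U(y))) contracts along a step for some τ > 0
(`IsSLStep.exists_contraction`). Since the matrices have determinant one, x ∧ y is conserved, and |x
∧ y|/(‖x‖‖y‖), the distance of the two directions, has a geometrically decaying τ-moment. Hence the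
increments of N ↦ E log ‖T_N⋯T_1 z‖ forget z geometrically fast and converge
(`IsSLStep.exists_tendsto`).

It remains to find G. Let m be the mean and V the variance of the potential. If m ≠ 0, the angle
drifts at order λ, and G = λΓ, with Γ an explicit trigonometric polynomial, cancels the oscillating
part of the λ² term, leaving 2a = V/4 (`lyapunovAsymptotic_of_integral_ne_zero`). If m = 0, angular
drift and diffusion both appear at order λ², and G must solve a second order linear equation on the
circle. Its right side has to be orthogonal to the kernel of the adjoint operator, which
`preDensity` spans; this is how ρ₀ enters the coefficient (`IsCenteredPair.exists_phaseFunction`).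
If V = 0, the matrix is almost surely a fixed elliptic one, which preserves a definite quadratic
form, and the exponent is 0.

For m = ε = 0 the substitution x = cos⁴u turns the integrals against ρ₀ into Beta integrals, which
gives the Gamma quotient (`integral_ratio_eq_Gamma`). -/

namespace AndersonBandCenter

noncomputable section

/-! ### Random products of determinant-one matrices and their mean logarithm -/

/-- The action of a real `2 × 2` matrix on the plane, identified with `ℂ`. -/
def act (A : Matrix (Fin 2) (Fin 2) ℝ) (z : ℂ) : ℂ :=
  ⟨A 0 0 * z.re + A 0 1 * z.im, A 1 0 * z.re + A 1 1 * z.im⟩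

theorem act_mul (A B : Matrix (Fin 2) (Fin 2) ℝ) (z : ℂ) : act (A * B) z = act A (act B z) := by
  apply Complex.ext <;> simp [act, Matrix.mul_apply, Fin.sum_univ_two] <;> ring

theorem act_one (z : ℂ) : act 1 z = z := by
  apply Complex.ext <;> simp [act]

theorem act_neg_left (A : Matrix (Fin 2) (Fin 2) ℝ) (z : ℂ) : act (-A) z = -act A z := by
  apply Complex.ext <;> simp [act] <;> ring

theorem act_neg_right (A : Matrix (Fin 2) (Fin 2) ℝ) (z : ℂ) : act A (-z) = -act A z := by
  apply Complex.ext <;> simp [act] <;> ring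

/-- Joint measurability in vector and letter is what keeps the iterated integrals in `meanLog`
measurable in the vector. -/
theorem measurable_act {X : Type*} [MeasurableSpace X] {D : X → Matrix (Fin 2) (Fin 2) ℝ}
    (hD : ∀ i j, Measurable fun s => D s i j) :
    Measurable fun q : ℂ × X => act (D q.2) q.1 := by
  have h (i j) : Measurable fun q : ℂ × X => D q.2 i j := (hD i j).comp measurable_snd
  have hr : Measurable fun q : ℂ × X => q.1.re := Complex.measurable_re.comp measurable_fst
  have hi : Measurable fun q : ℂ × X => q.1.im := Complex.measurable_im.comp measurable_fst
  have key : (fun q : ℂ × X => act (D q.2) q.1) = fun q =>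
      ((D q.2 0 0 * q.1.re + D q.2 0 1 * q.1.im : ℝ) : ℂ)
        + ((D q.2 1 0 * q.1.re + D q.2 1 1 * q.1.im : ℝ) : ℂ) * Complex.I := by
    funext q
    apply Complex.ext <;> simp [act]
  rw [key]
  have h1 := (((h 0 0).mul hr).add ((h 0 1).mul hi))
  have h2 := (((h 1 0).mul hr).add ((h 1 1).mul hi))
  exact (Complex.measurable_ofReal.comp h1).add
    ((Complex.measurable_ofReal.comp h2).mul measurable_const)

theorem measurable_act_left {X : Type*} [MeasurableSpace X] {D : X → Matrix (Fin 2) (Fin 2) ℝ}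
    (hD : ∀ i j, Measurable fun s => D s i j) (z : ℂ) : Measurable fun s => act (D s) z :=
  (measurable_act hD).comp (measurable_const.prodMk measurable_id)

theorem norm_act_le {A : Matrix (Fin 2) (Fin 2) ℝ} {κ : ℝ} (hA : ∀ i j, |A i j| ≤ κ) (z : ℂ) :
    ‖act A z‖ ≤ 2 * κ * ‖z‖ := by
  have hκ : 0 ≤ κ := (abs_nonneg _).trans (hA 0 0)
  apply le_of_sq_le_sq _ (by positivity)
  have sq (i j) : A i j ^ 2 ≤ κ ^ 2 := sq_le_sq' (abs_le.1 (hA i j)).1 (abs_le.1 (hA i j)).2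
  have row (a b : ℝ) (ha : a ^ 2 ≤ κ ^ 2) (hb : b ^ 2 ≤ κ ^ 2) :
      (a * z.re + b * z.im) ^ 2 ≤ 2 * κ ^ 2 * (z.re ^ 2 + z.im ^ 2) := by
    nlinarith [sq_nonneg (a * z.im - b * z.re), sq_nonneg z.re, sq_nonneg z.im,
      mul_le_mul_of_nonneg_right (add_le_add ha hb) (add_nonneg (sq_nonneg z.re) (sq_nonneg z.im))]
  have h1 := row _ _ (sq 0 0) (sq 0 1)
  have h2 := row _ _ (sq 1 0) (sq 1 1)
  have e1 : ‖act A z‖ ^ 2 = (A 0 0 * z.re + A 0 1 * z.im) ^ 2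
      + (A 1 0 * z.re + A 1 1 * z.im) ^ 2 := by
    rw [Complex.sq_norm, Complex.normSq_apply]; simp [act]; ring
  have e2 : ‖z‖ ^ 2 = z.re ^ 2 + z.im ^ 2 := by
    rw [Complex.sq_norm, Complex.normSq_apply]; ring
  rw [e1, mul_pow, e2]
  linarith

/-- Measurable families of matrices of determinant one with entries bounded by `κ`. -/
structure IsSLStep {X : Type*} [MeasurableSpace X] (D : X → Matrix (Fin 2) (Fin 2) ℝ)
    (κ : ℝ) : Prop where
  measurable : ∀ i j, Measurable fun s => D s i j
  det_eq : ∀ s, (D s).det = 1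
  bound : ∀ s i j, |D s i j| ≤ κ
  one_le : 1 ≤ κ

/-- For determinant one the inverse is the adjugate, whose entries obey the same bound. -/
theorem norm_le_norm_act {A : Matrix (Fin 2) (Fin 2) ℝ} {κ : ℝ} (hA : ∀ i j, |A i j| ≤ κ)
    (hdet : A.det = 1) (z : ℂ) : ‖z‖ ≤ 2 * κ * ‖act A z‖ := by
  have h : act (!![A 1 1, -A 0 1; -A 1 0, A 0 0]) (act A z) = z := by
    rw [Matrix.det_fin_two] at hdet
    apply Complex.ext
    · simp only [act, Matrix.of_apply, Matrix.cons_val', Matrix.cons_val_zero, Matrix.cons_val_one,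
        Matrix.cons_val_fin_one]
      linear_combination z.re * hdet
    · simp only [act, Matrix.of_apply, Matrix.cons_val', Matrix.cons_val_zero, Matrix.cons_val_one,
        Matrix.cons_val_fin_one]
      linear_combination z.im * hdet
  conv_lhs => rw [← h]
  apply norm_act_le
  intro i j
  fin_cases i <;> fin_cases j <;> simp [hA]

section Step

variable {X : Type*} [MeasurableSpace X] {D : X → Matrix (Fin 2) (Fin 2) ℝ} {κ : ℝ}

theorem IsSLStep.act_ne_zero (h : IsSLStep D κ) (s : X) {z : ℂ} (hz : z ≠ 0) :
    act (D s) z ≠ 0 := by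
  intro h0
  have := norm_le_norm_act (h.bound s) (h.det_eq s) z
  rw [h0, norm_zero, mul_zero] at this
  exact hz (norm_le_zero_iff.1 this)

theorem IsSLStep.log_nonneg (h : IsSLStep D κ) : 0 ≤ Real.log (2 * κ) :=
  Real.log_nonneg (by linarith [h.one_le])

theorem IsSLStep.abs_log_sub_le (h : IsSLStep D κ) (s : X) {z : ℂ} (hz : z ≠ 0) :
    |Real.log ‖act (D s) z‖ - Real.log ‖z‖| ≤ Real.log (2 * κ) := by
  have hκ := h.one_le
  have hz' : 0 < ‖z‖ := norm_pos_iff.2 hz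
  have ha : 0 < ‖act (D s) z‖ := norm_pos_iff.2 (h.act_ne_zero s hz)
  have h1 := Real.log_le_log ha (norm_act_le (h.bound s) z)
  have h2 := Real.log_le_log hz' (norm_le_norm_act (h.bound s) (h.det_eq s) z)
  rw [Real.log_mul (by positivity) (by positivity)] at h1 h2
  rw [abs_le]
  constructor <;> linarith

/-- The mean logarithm of the norm of `z` after `N` independent random steps `D`. -/
def meanLog (m : Measure X) (D : X → Matrix (Fin 2) (Fin 2) ℝ) : ℕ → ℂ → ℝ
  | 0, z => Real.log ‖z‖
  | N + 1, z => ∫ s, meanLog m D N (act (D s) z) ∂m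

variable (m : Measure X) [IsProbabilityMeasure m]

theorem IsSLStep.measurable_integral (h : IsSLStep D κ) {φ : ℂ → ℝ} (hφ : Measurable φ) :
    Measurable fun z => ∫ s, φ (act (D s) z) ∂m :=
  ((hφ.comp (measurable_act h.measurable)).stronglyMeasurable.integral_prod_right').measurable

theorem IsSLStep.measurable_meanLog (h : IsSLStep D κ) (N : ℕ) : Measurable (meanLog m D N) := by
  induction N with
  | zero => exact Real.measurable_log.comp measurable_norm
  | succ N ih => exact h.measurable_integral m ih

theorem integrable_of_measurable_of_abs_le {φ : X → ℝ} (hφ : Measurable φ) {C : ℝ}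
    (hC : ∀ s, |φ s| ≤ C) : Integrable φ m :=
  Integrable.of_bound hφ.aestronglyMeasurable C (Eventually.of_forall hC)

theorem abs_integral_le_of_abs_le {φ : X → ℝ} {C : ℝ} (hC : ∀ s, |φ s| ≤ C) :
    |∫ s, φ s ∂m| ≤ C := by
  have := norm_integral_le_of_norm_le_const (μ := m) (f := φ) (C := C) (Eventually.of_forall hC)
  simpa using this

/-- A function at bounded distance from `log ‖·‖` is integrable along a step. -/
theorem IsSLStep.integrable_comp (h : IsSLStep D κ) {φ : ℂ → ℝ} (hφ : Measurable φ) {C : ℝ}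
    (hC : ∀ z, z ≠ 0 → |φ z - Real.log ‖z‖| ≤ C) {z : ℂ} (hz : z ≠ 0) :
    Integrable (fun s => φ (act (D s) z)) m := by
  apply integrable_of_measurable_of_abs_le m (hφ.comp (measurable_act_left h.measurable z))
    (C := C + Real.log (2 * κ) + |Real.log ‖z‖|)
  intro s
  have h1 := hC _ (h.act_ne_zero s hz)
  have h2 := h.abs_log_sub_le s hz
  have h3 := abs_le.1 (le_refl |Real.log ‖z‖|)
  simp only [Function.comp_apply, abs_le] at h1 h2 ⊢
  constructor <;> linarith

/-- The bound grows with N, but for each fixed N it supplies the integrability behind every later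
manipulation of `meanLog`. -/
theorem IsSLStep.abs_meanLog_sub_le (h : IsSLStep D κ) (N : ℕ) {z : ℂ} (hz : z ≠ 0) :
    |meanLog m D N z - Real.log ‖z‖| ≤ N * Real.log (2 * κ) := by
  induction N generalizing z with
  | zero => simp [meanLog]
  | succ N ih =>
    have hb (s : X) : |meanLog m D N (act (D s) z) - Real.log ‖z‖|
        ≤ ((N + 1 : ℕ) : ℝ) * Real.log (2 * κ) := by
      have h1 := ih (h.act_ne_zero s hz)
      have h2 := h.abs_log_sub_le s hz
      push_cast
      rw [abs_le] at *
      constructor <;> linarith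
    have hi' : Integrable (fun s => meanLog m D N (act (D s) z)) m :=
      h.integrable_comp m (h.measurable_meanLog m N) (fun _ hw => ih hw) hz
    have : meanLog m D (N + 1) z - Real.log ‖z‖
        = ∫ s, (meanLog m D N (act (D s) z) - Real.log ‖z‖) ∂m := by
      rw [integral_sub hi' (integrable_const _)]
      simp [meanLog]
    rw [this]
    exact abs_integral_le_of_abs_le m hb

theorem IsSLStep.integrable_meanLog (h : IsSLStep D κ) (N : ℕ) {z : ℂ} (hz : z ≠ 0) :
    Integrable (fun s => meanLog m D N (act (D s) z)) m :=
  h.integrable_comp m (h.measurable_meanLog m N)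
    (fun _ hw => h.abs_meanLog_sub_le m N hw) hz

/-- If `U` is a bounded perturbation of `log ‖·‖` whose mean increment is within `e` of `c`, then
the mean logarithmic growth rate is within `e` of `c`. -/
theorem IsSLStep.abs_meanLog_sub_mul_le (h : IsSLStep D κ) {U : ℂ → ℝ} (hU : Measurable U)
    {C₀ c e : ℝ} (hC : ∀ z, z ≠ 0 → |U z - Real.log ‖z‖| ≤ C₀)
    (he : ∀ z, z ≠ 0 → |(∫ s, U (act (D s) z) ∂m) - U z - c| ≤ e) (N : ℕ) {z : ℂ} (hz : z ≠ 0) :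
    |meanLog m D N z - U z - N * c| ≤ N * e + C₀ := by
  induction N generalizing z with
  | zero =>
    simpa [meanLog, abs_sub_comm] using hC z hz
  | succ N ih =>
    have hi := h.integrable_meanLog m N hz
    have hi' := h.integrable_comp m hU hC hz
    have hb : |∫ s, (meanLog m D N (act (D s) z) - U (act (D s) z) - N * c) ∂m| ≤ N * e + C₀ :=
      abs_integral_le_of_abs_le m fun s => ih (h.act_ne_zero s hz)
    rw [integral_sub (f := fun s => meanLog m D N (act (D s) z) - U (act (D s) z))
      (hi.sub hi') (integrable_const _), integral_sub hi hi'] at hb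
    have h2 := he z hz
    simp only [meanLog, integral_const, probReal_univ, one_smul] at hb ⊢
    push_cast
    rw [abs_le] at *
    constructor <;> linarith

end Step

/-! ### Average contraction of directions and existence of the growth rate -/

/-- The determinant of two vectors of the plane. -/
def wedge (x y : ℂ) : ℝ := x.re * y.im - x.im * y.re

theorem wedge_act {A : Matrix (Fin 2) (Fin 2) ℝ} (hA : A.det = 1) (x y : ℂ) :
    wedge (act A x) (act A y) = wedge x y := by
  rw [Matrix.det_fin_two] at hA
  simp only [wedge, act]
  linear_combination (x.re * y.im - x.im * y.re) * hA

theorem sq_norm_eq (z : ℂ) : ‖z‖ ^ 2 = z.re ^ 2 + z.im ^ 2 := by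
  rw [Complex.sq_norm, Complex.normSq_apply]; ring

theorem abs_wedge_le (x y : ℂ) : |wedge x y| ≤ ‖x‖ * ‖y‖ := by
  apply abs_le_of_sq_le_sq _ (by positivity)
  rw [mul_pow, sq_norm_eq, sq_norm_eq, wedge]
  nlinarith [sq_nonneg (x.re * y.re + x.im * y.im)]

theorem abs_log_sub_log_le {a b m : ℝ} (hm : 0 < m) (ha : m ≤ a) (hb : m ≤ b) :
    |Real.log a - Real.log b| ≤ |a - b| / m := by
  have key {a b : ℝ} (ha : m ≤ a) (hb : m ≤ b) : Real.log a - Real.log b ≤ |a - b| / m := by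
    have hb' : 0 < b := hm.trans_le hb
    have ha' : 0 < a := hm.trans_le ha
    rw [← Real.log_div ha'.ne' hb'.ne']
    calc Real.log (a / b) ≤ a / b - 1 := Real.log_le_sub_one_of_pos (by positivity)
      _ = (a - b) / b := by field_simp
      _ ≤ |a - b| / b := by gcongr; exact le_abs_self _
      _ ≤ |a - b| / m := by gcongr
  rw [abs_sub_le_iff]
  refine ⟨key ha hb, ?_⟩
  rw [abs_sub_comm]
  exact key hb ha

/-- The factor `wedge x y` makes the expansion rate Lipschitz in the direction, for the projective
distance |x ∧ y|/(‖x‖‖y‖). -/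
theorem sq_norm_act_sub (A : Matrix (Fin 2) (Fin 2) ℝ) (x y : ℂ) :
    ‖act A x‖ ^ 2 * ‖y‖ ^ 2 - ‖act A y‖ ^ 2 * ‖x‖ ^ 2 =
      wedge x y * (((A 0 0 ^ 2 + A 1 0 ^ 2) - (A 0 1 ^ 2 + A 1 1 ^ 2))
          * (x.re * y.im + x.im * y.re)
        + 2 * (A 0 0 * A 0 1 + A 1 0 * A 1 1) * (x.im * y.im - x.re * y.re)) := by
  simp only [sq_norm_eq, wedge, act]
  ring

section Step

variable {X : Type*} [MeasurableSpace X] {D : X → Matrix (Fin 2) (Fin 2) ℝ} {κ : ℝ}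

theorem IsSLStep.abs_log_act_sub_le (h : IsSLStep D κ) (s : X) {x y : ℂ} (hx : x ≠ 0)
    (hy : y ≠ 0) :
    |(Real.log ‖act (D s) x‖ - Real.log ‖x‖) - (Real.log ‖act (D s) y‖ - Real.log ‖y‖)|
      ≤ 12 * κ ^ 4 * (|wedge x y| / (‖x‖ * ‖y‖)) := by
  have hκ := h.one_le
  have hx' : 0 < ‖x‖ := norm_pos_iff.2 hx
  have hy' : 0 < ‖y‖ := norm_pos_iff.2 hy
  have hax : 0 < ‖act (D s) x‖ := norm_pos_iff.2 (h.act_ne_zero s hx)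
  have hay : 0 < ‖act (D s) y‖ := norm_pos_iff.2 (h.act_ne_zero s hy)
  have lower {w : ℂ} : ‖w‖ ^ 2 ≤ 4 * κ ^ 2 * ‖act (D s) w‖ ^ 2 := by
    have := norm_le_norm_act (h.bound s) (h.det_eq s) w
    calc ‖w‖ ^ 2 ≤ (2 * κ * ‖act (D s) w‖) ^ 2 := by gcongr
      _ = _ := by ring
  -- A common lower bound for the two products whose logarithms are compared, so that the logarithm
  -- is Lipschitz there with constant 1/M.
  set M : ℝ := ‖x‖ ^ 2 * ‖y‖ ^ 2 / (4 * κ ^ 2) with hM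
  have hM0 : 0 < M := by positivity
  have h1 : M ≤ ‖act (D s) x‖ ^ 2 * ‖y‖ ^ 2 := by
    rw [hM, div_le_iff₀ (by positivity)]
    nlinarith [mul_le_mul_of_nonneg_right (lower (w := x)) (sq_nonneg ‖y‖)]
  have h2 : M ≤ ‖act (D s) y‖ ^ 2 * ‖x‖ ^ 2 := by
    rw [hM, div_le_iff₀ (by positivity)]
    nlinarith [mul_le_mul_of_nonneg_right (lower (w := y)) (sq_nonneg ‖x‖)]
  have h3 := abs_log_sub_log_le hM0 h1 h2
  have e1 : Real.log (‖act (D s) x‖ ^ 2 * ‖y‖ ^ 2) - Real.log (‖act (D s) y‖ ^ 2 * ‖x‖ ^ 2)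
      = 2 * ((Real.log ‖act (D s) x‖ - Real.log ‖x‖)
        - (Real.log ‖act (D s) y‖ - Real.log ‖y‖)) := by
    rw [Real.log_mul (by positivity) (by positivity), Real.log_mul (by positivity) (by positivity)]
    simp only [Real.log_pow]
    push_cast
    ring
  have sq (i j) : D s i j ^ 2 ≤ κ ^ 2 :=
    sq_le_sq' (abs_le.1 (h.bound s i j)).1 (abs_le.1 (h.bound s i j)).2
  have b1 : |(D s 0 0 ^ 2 + D s 1 0 ^ 2) - (D s 0 1 ^ 2 + D s 1 1 ^ 2)| ≤ 2 * κ ^ 2 := by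
    rw [abs_le]
    constructor <;>
      linarith [sq 0 0, sq 0 1, sq 1 0, sq 1 1, sq_nonneg (D s 0 0), sq_nonneg (D s 0 1),
        sq_nonneg (D s 1 0), sq_nonneg (D s 1 1)]
  have b2 : |2 * (D s 0 0 * D s 0 1 + D s 1 0 * D s 1 1)| ≤ 4 * κ ^ 2 := by
    rw [abs_le]
    constructor <;>
      nlinarith [sq 0 0, sq 0 1, sq 1 0, sq 1 1, sq_nonneg (D s 0 0 + D s 0 1),
        sq_nonneg (D s 1 0 + D s 1 1), sq_nonneg (D s 0 0 - D s 0 1),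
        sq_nonneg (D s 1 0 - D s 1 1)]
  have b3 : |x.re * y.im + x.im * y.re| ≤ ‖x‖ * ‖y‖ := by
    apply abs_le_of_sq_le_sq _ (by positivity)
    rw [mul_pow, sq_norm_eq, sq_norm_eq]
    nlinarith [sq_nonneg (x.re * y.re - x.im * y.im)]
  have b4 : |x.im * y.im - x.re * y.re| ≤ ‖x‖ * ‖y‖ := by
    apply abs_le_of_sq_le_sq _ (by positivity)
    rw [mul_pow, sq_norm_eq, sq_norm_eq]
    nlinarith [sq_nonneg (x.re * y.im + x.im * y.re)]
  have b5 : |‖act (D s) x‖ ^ 2 * ‖y‖ ^ 2 - ‖act (D s) y‖ ^ 2 * ‖x‖ ^ 2|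
      ≤ |wedge x y| * (6 * κ ^ 2 * (‖x‖ * ‖y‖)) := by
    rw [sq_norm_act_sub, abs_mul]
    gcongr
    refine (abs_add_le _ _).trans ?_
    rw [abs_mul, abs_mul _ (x.im * y.im - x.re * y.re)]
    calc _ ≤ 2 * κ ^ 2 * (‖x‖ * ‖y‖) + 4 * κ ^ 2 * (‖x‖ * ‖y‖) := by gcongr
      _ = _ := by ring
  rw [e1, abs_mul, abs_two] at h3
  have h4 : |‖act (D s) x‖ ^ 2 * ‖y‖ ^ 2 - ‖act (D s) y‖ ^ 2 * ‖x‖ ^ 2| / M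
      ≤ 2 * (12 * κ ^ 4 * (|wedge x y| / (‖x‖ * ‖y‖))) := by
    calc _ ≤ |wedge x y| * (6 * κ ^ 2 * (‖x‖ * ‖y‖)) / M := by gcongr
      _ = _ := by rw [hM]; field_simp; ring
  linarith

variable (m : Measure X) [IsProbabilityMeasure m]

/-- If the mean increment of a bounded perturbation `U` of `log ‖·‖` is bounded below by a positive
constant, then `exp (-τ (U x + U y))` contracts on average for some `τ ∈ (0, 1]`. -/
theorem IsSLStep.exists_contraction (h : IsSLStep D κ) {U : ℂ → ℝ} (hU : Measurable U)
    {C₀ η : ℝ} (hC : ∀ z, z ≠ 0 → |U z - Real.log ‖z‖| ≤ C₀) (hη : 0 < η)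
    (hd : ∀ z, z ≠ 0 → η ≤ (∫ s, U (act (D s) z) ∂m) - U z) :
    ∃ τ ρ : ℝ, 0 < τ ∧ τ ≤ 1 ∧ 0 ≤ ρ ∧ ρ < 1 ∧ ∀ x y : ℂ, x ≠ 0 → y ≠ 0 →
      Integrable (fun s => Real.exp (-τ * (U (act (D s) x) + U (act (D s) y)))) m ∧
      ∫ s, Real.exp (-τ * (U (act (D s) x) + U (act (D s) y))) ∂m
        ≤ ρ * Real.exp (-τ * (U x + U y)) := by
  have hC₀ : 0 ≤ C₀ := (abs_nonneg _).trans (hC 1 one_ne_zero)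
  have hl := h.log_nonneg
  -- One increment of U is at most 2C₀ + log 2κ, so the first summand bounds the sum Z of two
  -- increments. The others give R ≥ 1 and R ≥ 2η, hence τR = η/R ≤ 1/2, which keeps τZ where |eˣ -
  -- 1 - x| ≤ x² applies.
  set R : ℝ := 2 * (2 * C₀ + Real.log (2 * κ)) + 1 + 2 * η with hR
  have hR1 : 1 ≤ R := by rw [hR]; nlinarith
  have hRη : 2 * η ≤ R := by rw [hR]; nlinarith
  have hR0 : 0 < R := by linarith
  set τ : ℝ := η / R ^ 2 with hτ
  have hτ0 : 0 < τ := by positivity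
  have hτR : τ * R ^ 2 = η := by rw [hτ]; field_simp
  have hτR1 : τ * R ≤ 1 / 2 := by
    have : τ * R * R ≤ 1 / 2 * R := by nlinarith
    exact le_of_mul_le_mul_right this hR0
  have hτ1 : τ ≤ 1 := by nlinarith
  have hτη : τ * η ≤ 1 := by nlinarith
  refine ⟨τ, 1 - τ * η, hτ0, hτ1, by linarith, by nlinarith, fun x y hx hy => ?_⟩
  have bd {z : ℂ} (hz : z ≠ 0) (s : X) : |U (act (D s) z) - U z| ≤ 2 * C₀ + Real.log (2 * κ) := by
    have h1 := hC z hz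
    have h2 := hC _ (h.act_ne_zero s hz)
    have h3 := h.abs_log_sub_le s hz
    rw [abs_le] at *
    constructor <;> linarith
  set Z : X → ℝ := fun s => (U (act (D s) x) - U x) + (U (act (D s) y) - U y) with hZ
  have hm {z : ℂ} : Measurable fun s => U (act (D s) z) :=
    hU.comp (measurable_act_left h.measurable z)
  have hZm : Measurable Z := (hm.sub measurable_const).add (hm.sub measurable_const)
  have hZR (s : X) : |Z s| ≤ R := by
    refine (abs_add_le _ _).trans ?_
    linarith [bd hx s, bd hy s]
  have hZi : Integrable Z m := integrable_of_measurable_of_abs_le m hZm hZR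
  have hZint : 2 * η ≤ ∫ s, Z s ∂m := by
    have hi {z : ℂ} (hz : z ≠ 0) : Integrable (fun s => U (act (D s) z) - U z) m :=
      (h.integrable_comp m hU hC hz).sub (integrable_const _)
    rw [hZ, integral_add (hi hx) (hi hy), integral_sub (h.integrable_comp m hU hC hx)
      (integrable_const _), integral_sub (h.integrable_comp m hU hC hy) (integrable_const _)]
    simp only [integral_const, probReal_univ, one_smul]
    linarith [hd x hx, hd y hy]
  -- The quadratic term is at most τ²R² = τη, half of the mean gain 2τη of the linear term; the
  -- contraction factor is therefore 1 - τη.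
  have hexp (s : X) : Real.exp (-τ * Z s) ≤ 1 + τ * η - τ * Z s := by
    have hz : |-τ * Z s| ≤ 1 := by
      rw [abs_mul, abs_neg, abs_of_pos hτ0]
      nlinarith [hZR s]
    have h1 := (abs_le.1 (Real.abs_exp_sub_one_sub_id_le hz)).2
    have h2 : (-τ * Z s) ^ 2 ≤ τ * η := by
      have : Z s ^ 2 ≤ R ^ 2 := sq_le_sq' (abs_le.1 (hZR s)).1 (abs_le.1 (hZR s)).2
      calc (-τ * Z s) ^ 2 = τ ^ 2 * Z s ^ 2 := by ring
        _ ≤ τ ^ 2 * R ^ 2 := by gcongr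
        _ = τ * η := by rw [← hτR]; ring
    linarith
  have hEm : Measurable fun s => Real.exp (-τ * Z s) :=
    Real.measurable_exp.comp (measurable_const.mul hZm)
  have hEi : Integrable (fun s => Real.exp (-τ * Z s)) m := by
    apply integrable_of_measurable_of_abs_le m hEm (C := 1 + τ * η + τ * R)
    intro s
    rw [abs_of_pos (Real.exp_pos _)]
    nlinarith [hexp s, neg_le_of_abs_le (hZR s)]
  have heq : (fun s => Real.exp (-τ * (U (act (D s) x) + U (act (D s) y))))
      = fun s => Real.exp (-τ * (U x + U y)) * Real.exp (-τ * Z s) := by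
    funext s
    rw [← Real.exp_add, hZ]
    ring_nf
  rw [heq]
  refine ⟨hEi.const_mul _, ?_⟩
  rw [integral_const_mul, mul_comm]
  gcongr
  calc ∫ s, Real.exp (-τ * Z s) ∂m ≤ ∫ s, (1 + τ * η - τ * Z s) ∂m :=
        integral_mono hEi ((integrable_const _).sub (hZi.const_mul _)) hexp
    _ = 1 + τ * η - τ * ∫ s, Z s ∂m := by
        rw [integral_sub (integrable_const _) (hZi.const_mul _), integral_const_mul]
        simp
    _ ≤ 1 - τ * η := by nlinarith

/-- The increment `L_{N+1} - L_N` of the mean logarithm. -/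
def meanInc (m : Measure X) (D : X → Matrix (Fin 2) (Fin 2) ℝ) (N : ℕ) (z : ℂ) : ℝ :=
  meanLog m D (N + 1) z - meanLog m D N z

/-- The increments are iterates of one averaging operator, so oscillation bounds on `meanInc m D 0`
propagate in N. -/
theorem IsSLStep.meanInc_succ (h : IsSLStep D κ) (N : ℕ) {z : ℂ} (hz : z ≠ 0) :
    meanInc m D (N + 1) z = ∫ s, meanInc m D N (act (D s) z) ∂m := by
  simp only [meanInc]
  rw [integral_sub (h.integrable_meanLog m _ hz) (h.integrable_meanLog m _ hz)]
  rfl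

theorem IsSLStep.integrable_meanInc (h : IsSLStep D κ) (N : ℕ) {z : ℂ} (hz : z ≠ 0) :
    Integrable (fun s => meanInc m D N (act (D s) z)) m :=
  (h.integrable_meanLog m _ hz).sub (h.integrable_meanLog m _ hz)

theorem IsSLStep.meanInc_zero (h : IsSLStep D κ) {z : ℂ} (hz : z ≠ 0) :
    meanInc m D 0 z = ∫ s, (Real.log ‖act (D s) z‖ - Real.log ‖z‖) ∂m := by
  have := h.integrable_meanLog m 0 hz
  simp only [meanLog] at this
  rw [integral_sub this (integrable_const _)]
  simp [meanInc, meanLog]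

theorem IsSLStep.abs_meanInc_le (h : IsSLStep D κ) (N : ℕ) {z : ℂ} (hz : z ≠ 0) :
    |meanInc m D N z| ≤ Real.log (2 * κ) := by
  induction N generalizing z with
  | zero =>
    rw [h.meanInc_zero m hz]
    exact abs_integral_le_of_abs_le m fun s => h.abs_log_sub_le s hz
  | succ N ih =>
    rw [h.meanInc_succ m N hz]
    exact abs_integral_le_of_abs_le m fun s => ih (h.act_ne_zero s hz)

/-- A uniform positive drift forces the growth rate to exist and to be independent of the
initial vector. -/
theorem IsSLStep.exists_tendsto (h : IsSLStep D κ) {U : ℂ → ℝ} (hU : Measurable U)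
    {C₀ η : ℝ} (hC : ∀ z, z ≠ 0 → |U z - Real.log ‖z‖| ≤ C₀) (hη : 0 < η)
    (hd : ∀ z, z ≠ 0 → η ≤ (∫ s, U (act (D s) z) ∂m) - U z) :
    ∃ γ : ℝ, ∀ z, z ≠ 0 → Tendsto (fun N : ℕ => (N : ℝ)⁻¹ * meanLog m D N z) atTop (𝓝 γ) := by
  obtain ⟨τ, ρ, hτ0, hτ1, hρ0, hρ1, hcon⟩ := h.exists_contraction m hU hC hη hd
  have hκ := h.one_le
  set C : ℝ := 12 * κ ^ 4 * Real.exp (2 * C₀) with hCdef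
  have hCpos : 0 < C := by positivity
  -- The projective distance d is at most 1 and τ ≤ 1, so d ≤ d^τ; replacing log ‖·‖ by U in d^τ
  -- costs at most the factor exp(2C₀).
  have base {x y : ℂ} (hx : x ≠ 0) (hy : y ≠ 0) : |wedge x y| / (‖x‖ * ‖y‖)
      ≤ Real.exp (2 * C₀) * (|wedge x y| ^ τ * Real.exp (-τ * (U x + U y))) := by
    have hx' : 0 < ‖x‖ := norm_pos_iff.2 hx
    have hy' : 0 < ‖y‖ := norm_pos_iff.2 hy
    have hd1 : |wedge x y| / (‖x‖ * ‖y‖) ≤ 1 := by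
      rw [div_le_one (by positivity)]; exact abs_wedge_le x y
    have hC₀ : 0 ≤ C₀ := (abs_nonneg _).trans (hC 1 one_ne_zero)
    calc |wedge x y| / (‖x‖ * ‖y‖) ≤ (|wedge x y| / (‖x‖ * ‖y‖)) ^ τ :=
          Real.self_le_rpow_of_le_one (by positivity) hd1 hτ1
      _ = |wedge x y| ^ τ * Real.exp (-τ * (Real.log ‖x‖ + Real.log ‖y‖)) := by
          rw [Real.div_rpow (abs_nonneg _) (by positivity), div_eq_mul_inv,
            Real.rpow_def_of_pos (by positivity : 0 < ‖x‖ * ‖y‖), ← Real.exp_neg,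
            Real.log_mul hx'.ne' hy'.ne']
          ring_nf
      _ ≤ |wedge x y| ^ τ * Real.exp (2 * C₀ + -τ * (U x + U y)) := by
          gcongr
          have h1 := abs_le.1 (hC x hx)
          have h2 := abs_le.1 (hC y hy)
          nlinarith
      _ = _ := by rw [Real.exp_add]; ring
  have decay (N : ℕ) : ∀ {x y : ℂ}, x ≠ 0 → y ≠ 0 → |meanInc m D N x - meanInc m D N y|
      ≤ C * ρ ^ N * (|wedge x y| ^ τ * Real.exp (-τ * (U x + U y))) := by
    induction N with
    | zero =>
      intro x y hx hy
      have hi {z : ℂ} (hz : z ≠ 0) : Integrable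
          (fun s => Real.log ‖act (D s) z‖ - Real.log ‖z‖) m :=
        (h.integrable_meanLog m 0 hz).sub (integrable_const _)
      rw [h.meanInc_zero m hx, h.meanInc_zero m hy, ← integral_sub (hi hx) (hi hy)]
      have h1 := abs_integral_le_of_abs_le m fun s => h.abs_log_act_sub_le s hx hy
      refine h1.trans ?_
      rw [hCdef, pow_zero, mul_one, mul_assoc (12 * κ ^ 4)]
      gcongr
      exact base hx hy
    | succ N ih =>
      intro x y hx hy
      obtain ⟨hint, hle⟩ := hcon x y hx hy
      rw [h.meanInc_succ m N hx, h.meanInc_succ m N hy,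
        ← integral_sub (h.integrable_meanInc m N hx) (h.integrable_meanInc m N hy)]
      calc |∫ s, (meanInc m D N (act (D s) x) - meanInc m D N (act (D s) y)) ∂m|
          ≤ ∫ s, |meanInc m D N (act (D s) x) - meanInc m D N (act (D s) y)| ∂m :=
            abs_integral_le_integral_abs
        _ ≤ ∫ s, C * ρ ^ N * |wedge x y| ^ τ
              * Real.exp (-τ * (U (act (D s) x) + U (act (D s) y))) ∂m := by
            apply integral_mono _ (hint.const_mul _)
            · intro s
              have := ih (h.act_ne_zero s hx) (h.act_ne_zero s hy)
              -- The wedge is unchanged by the step, so only the exponential is averaged and the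
              -- contraction gains a factor ρ.
              rw [wedge_act (h.det_eq s)] at this
              simpa only [mul_assoc] using this
            · exact ((h.integrable_meanInc m N hx).sub (h.integrable_meanInc m N hy)).abs
        _ = C * ρ ^ N * |wedge x y| ^ τ
              * ∫ s, Real.exp (-τ * (U (act (D s) x) + U (act (D s) y))) ∂m :=
            integral_const_mul _ _
        _ ≤ C * ρ ^ N * |wedge x y| ^ τ * (ρ * Real.exp (-τ * (U x + U y))) := by gcongr
        _ = _ := by rw [pow_succ]; ring
  set K : ℝ := C * Real.exp (2 * C₀) with hK
  have unif (N : ℕ) {x y : ℂ} (hx : x ≠ 0) (hy : y ≠ 0) :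
      |meanInc m D N x - meanInc m D N y| ≤ K * ρ ^ N := by
    refine (decay N hx hy).trans ?_
    have hx' : 0 < ‖x‖ := norm_pos_iff.2 hx
    have hy' : 0 < ‖y‖ := norm_pos_iff.2 hy
    have hC₀ : 0 ≤ C₀ := (abs_nonneg _).trans (hC 1 one_ne_zero)
    have : |wedge x y| ^ τ * Real.exp (-τ * (U x + U y)) ≤ Real.exp (2 * C₀) := by
      calc |wedge x y| ^ τ * Real.exp (-τ * (U x + U y))
          ≤ (‖x‖ * ‖y‖) ^ τ * Real.exp (-τ * (U x + U y)) := by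
            gcongr
            exact abs_wedge_le x y
        _ = Real.exp (τ * (Real.log ‖x‖ + Real.log ‖y‖) + -τ * (U x + U y)) := by
            rw [Real.rpow_def_of_pos (by positivity), Real.log_mul hx'.ne' hy'.ne', Real.exp_add,
              mul_comm τ]
        _ ≤ Real.exp (2 * C₀) := by
            gcongr
            have h1 := abs_le.1 (hC x hx)
            have h2 := abs_le.1 (hC y hy)
            nlinarith
    calc C * ρ ^ N * (|wedge x y| ^ τ * Real.exp (-τ * (U x + U y)))
        ≤ C * ρ ^ N * Real.exp (2 * C₀) := by gcongr
      _ = K * ρ ^ N := by rw [hK]; ring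
  -- The next increment averages the current one over other directions, and those values differ by
  -- at most K ρ^N: the sequence is Cauchy.
  have step {z : ℂ} (hz : z ≠ 0) (N : ℕ) :
      dist (meanInc m D N z) (meanInc m D (N + 1) z) ≤ K * ρ ^ N := by
    rw [dist_comm, Real.dist_eq, h.meanInc_succ m N hz]
    have : (∫ s, meanInc m D N (act (D s) z) ∂m) - meanInc m D N z
        = ∫ s, (meanInc m D N (act (D s) z) - meanInc m D N z) ∂m := by
      rw [integral_sub (h.integrable_meanInc m N hz) (integrable_const _)]
      simp
    rw [this]
    exact abs_integral_le_of_abs_le m fun s => unif N (h.act_ne_zero s hz) hz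
  obtain ⟨γ, hγ⟩ := cauchySeq_tendsto_of_complete
    (cauchySeq_of_le_geometric ρ K hρ1 (step one_ne_zero))
  have lim {z : ℂ} (hz : z ≠ 0) : Tendsto (fun N => meanInc m D N z) atTop (𝓝 γ) := by
    have h0 : Tendsto (fun N => meanInc m D N z - meanInc m D N 1) atTop (𝓝 0) := by
      apply squeeze_zero_norm (fun N => unif N hz one_ne_zero)
      simpa using (tendsto_pow_atTop_nhds_zero_of_lt_one hρ0 hρ1).const_mul K
    simpa using h0.add hγ
  refine ⟨γ, fun z hz => ?_⟩
  -- The growth rate is the Cesàro mean of convergent increments.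
  have hsum (N : ℕ) : meanLog m D N z = Real.log ‖z‖ + ∑ k ∈ Finset.range N, meanInc m D k z := by
    simp only [meanInc]
    rw [Finset.sum_range_sub (fun k => meanLog m D k z)]
    simp [meanLog]
  have h1 := (lim hz).cesaro
  have h2 : Tendsto (fun N : ℕ => (N : ℝ)⁻¹ * Real.log ‖z‖) atTop (𝓝 0) := by
    simpa using tendsto_natCast_atTop_atTop.inv_tendsto_atTop.mul_const (Real.log ‖z‖)
  have h3 := h2.add h1
  rw [zero_add] at h3
  refine h3.congr fun N => ?_
  rw [hsum]
  ring

end Step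

/-! ### From infinite codes to the recursion for the mean logarithm -/

/-- The code with first letter `p.1` followed by the code `p.2`. -/
def consCode {S : Type*} (p : S × (ℕ → S)) : ℕ → S
  | 0 => p.1
  | n + 1 => p.2 n

theorem transferProd_consCode {S : Type*} (v : S → ℝ) (ε lam : ℝ) (a : S) (ω : ℕ → S) (N : ℕ) :
    transferProd v ε lam (consCode (a, ω)) (N + 1)
      = transferProd v ε lam ω N * transfer ε lam (v a) := by
  induction N with
  | zero => simp [transferProd, consCode]
  | succ N ih =>
    rw [transferProd, ih, transferProd, mul_assoc]
    rfl

section Codes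

variable {S : Type*} [MeasurableSpace S]

theorem measurable_consCode : Measurable (consCode : S × (ℕ → S) → ℕ → S) := by
  rw [measurable_pi_iff]
  intro n
  cases n with
  | zero => exact measurable_fst
  | succ n => exact (measurable_pi_apply n).comp measurable_snd

variable (μ : Measure S) [IsProbabilityMeasure μ]

/-- Prepending an independent letter preserves the product law. This lets the integral over infinite
codes satisfy the recursion of `meanLog`, which averages over the letter that acts first. -/
theorem map_consCode : (μ.prod (Measure.infinitePi fun _ : ℕ => μ)).map consCode
    = Measure.infinitePi fun _ : ℕ => μ := by
  apply Measure.eq_infinitePi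
  intro s t ht
  rw [Measure.map_apply measurable_consCode (MeasurableSet.pi s.countable_toSet fun i _ => ht i)]
  set s' : Finset ℕ := s.preimage Nat.succ Nat.succ_injective.injOn with hs'
  have hpre : (consCode ⁻¹' (Set.pi s t) : Set (S × (ℕ → S)))
      = (if 0 ∈ s then t 0 else Set.univ) ×ˢ (Set.pi s' fun n => t (n + 1)) := by
    ext p
    simp only [Set.mem_preimage, Set.mem_pi, Set.mem_prod, Finset.mem_coe, hs',
      Finset.mem_preimage]
    constructor
    · intro h
      refine ⟨?_, fun i hi => h (i + 1) hi⟩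
      split_ifs with h0
      · exact h 0 h0
      · trivial
    · rintro ⟨h1, h2⟩ i hi
      cases i with
      | zero => simpa [hi, consCode] using h1
      | succ i => exact h2 i hi
  rw [hpre, Measure.prod_prod, Measure.infinitePi_pi]
  · have himg : s.erase 0 = s'.map ⟨Nat.succ, Nat.succ_injective⟩ := by
      ext i
      cases i with
      | zero => simp
      | succ i => simp [hs']
    have hprod : ∏ i ∈ s', μ (t (i + 1)) = ∏ i ∈ s.erase 0, μ (t i) := by
      rw [himg, Finset.prod_map]; rfl
    rw [hprod]
    split_ifs with h0
    · rw [Finset.mul_prod_erase s (fun i => μ (t i)) h0]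
    · rw [measure_univ, one_mul, Finset.erase_eq_of_notMem h0]
  · exact fun i _ => ht (i + 1)

theorem integral_consCode {F : (ℕ → S) → ℝ}
    (hF : Integrable F (Measure.infinitePi fun _ : ℕ => μ)) :
    ∫ ω, F ω ∂(Measure.infinitePi fun _ : ℕ => μ)
      = ∫ a, ∫ ω, F (consCode (a, ω)) ∂(Measure.infinitePi fun _ : ℕ => μ) ∂μ := by
  rw [← map_consCode μ] at hF
  conv_lhs => rw [← map_consCode μ]
  rw [integral_map measurable_consCode.aemeasurable hF.aestronglyMeasurable, integral_prod]
  exact (integrable_map_measure hF.aestronglyMeasurable measurable_consCode.aemeasurable).1 hF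

variable {v : S → ℝ} {ε lam : ℝ}

theorem isSLStep_transfer (hv : Measurable v) {B : ℝ} (hB0 : 0 ≤ B) (hB : ∀ s, |v s| ≤ B) :
    IsSLStep (fun s => transfer ε lam (v s)) (|lam| * B + |ε| * lam ^ 2 + 1) where
  measurable i j := by
    fin_cases i <;> fin_cases j <;> simp [transfer]
    exact (hv.const_mul lam).sub_const _
  det_eq s := by simp [transfer, Matrix.det_fin_two]
  bound s i j := by
    have h0 : 0 ≤ |lam| * B + |ε| * lam ^ 2 := by positivity
    fin_cases i <;> fin_cases j <;> simp [transfer]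
    · refine (abs_sub _ _).trans ?_
      rw [abs_mul, abs_mul, abs_of_nonneg (sq_nonneg lam)]
      have := mul_le_mul_of_nonneg_left (hB s) (abs_nonneg lam)
      linarith
    · exact h0
    · exact h0
    · linarith
  one_le := by
    have h0 : 0 ≤ |lam| * B + |ε| * lam ^ 2 := by positivity
    linarith

theorem IsSLStep.mul {X Y : Type*} [MeasurableSpace X] [MeasurableSpace Y]
    {D : X → Matrix (Fin 2) (Fin 2) ℝ} {D' : Y → Matrix (Fin 2) (Fin 2) ℝ} {κ κ' : ℝ}
    (h : IsSLStep D κ) (h' : IsSLStep D' κ') {Z : Type*} [MeasurableSpace Z] {f : Z → X}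
    {g : Z → Y} (hf : Measurable f) (hg : Measurable g) :
    IsSLStep (fun z => D (f z) * D' (g z)) (2 * (κ * κ')) where
  measurable i j := by
    simp only [Matrix.mul_apply, Fin.sum_univ_two]
    exact (((h.measurable i 0).comp hf).mul ((h'.measurable 0 j).comp hg)).add
      (((h.measurable i 1).comp hf).mul ((h'.measurable 1 j).comp hg))
  det_eq z := by rw [Matrix.det_mul, h.det_eq, h'.det_eq, one_mul]
  bound z i j := by
    have hκ := h.one_le
    have (k : Fin 2) : |D (f z) i k * D' (g z) k j| ≤ κ * κ' := by
      rw [abs_mul]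
      exact mul_le_mul (h.bound _ _ _) (h'.bound _ _ _) (abs_nonneg _) (by linarith)
    simp only [Matrix.mul_apply, Fin.sum_univ_two]
    refine (abs_add_le _ _).trans ?_
    linarith [this 0, this 1]
  one_le := by nlinarith [h.one_le, h'.one_le]

theorem IsSLStep.neg {X : Type*} [MeasurableSpace X]
    {D : X → Matrix (Fin 2) (Fin 2) ℝ} {κ : ℝ} (h : IsSLStep D κ) :
    IsSLStep (fun z => -D z) κ where
  measurable i j := (h.measurable i j).neg
  det_eq z := by
    have := h.det_eq z
    rw [Matrix.det_fin_two] at *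
    simpa using this
  bound z i j := by simpa using h.bound z i j
  one_le := h.one_le

theorem exists_isSLStep_transferProd {κ : ℝ} (h : IsSLStep (fun s => transfer ε lam (v s)) κ)
    (N : ℕ) : ∃ κ', IsSLStep (fun ω => transferProd v ε lam ω N) κ' := by
  induction N with
  | zero =>
    refine ⟨1, fun i j => ?_, fun _ => by simp [transferProd], fun _ i j => ?_, le_rfl⟩
    · simp [transferProd]
    · simp only [transferProd]
      fin_cases i <;> fin_cases j <;> simp
  | succ N ih =>
    obtain ⟨κ', h'⟩ := ih
    exact ⟨_, h.mul h' (measurable_pi_apply N) measurable_id⟩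

theorem integral_log_norm_act_transferProd {κ : ℝ}
    (h : IsSLStep (fun s => transfer ε lam (v s)) κ) (N : ℕ) {z : ℂ} (hz : z ≠ 0) :
    ∫ ω, Real.log ‖act (transferProd v ε lam ω N) z‖ ∂(Measure.infinitePi fun _ : ℕ => μ)
      = meanLog μ (fun s => transfer ε lam (v s)) N z := by
  induction N generalizing z with
  | zero => simp [transferProd, act_one, meanLog]
  | succ N ih =>
    obtain ⟨κ', h'⟩ := exists_isSLStep_transferProd h (N + 1)
    have hi := h'.integrable_meanLog (Measure.infinitePi fun _ : ℕ => μ) 0 hz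
    simp only [meanLog] at hi
    rw [integral_consCode μ hi, meanLog]
    congr 1
    funext a
    rw [← ih (h.act_ne_zero a hz)]
    congr 1
    funext ω
    rw [transferProd_consCode, act_mul]

theorem norm_toLp_mulVec_unitVec (A : Matrix (Fin 2) (Fin 2) ℝ) (θ : ℝ) :
    ‖WithLp.toLp 2 (A.mulVec (unitVec θ))‖ = ‖act A (Complex.exp (θ * Complex.I))‖ := by
  rw [EuclideanSpace.norm_eq, Complex.norm_eq_sqrt_sq_add_sq]
  simp [Fin.sum_univ_two, act, Matrix.mulVec, dotProduct, unitVec, Complex.exp_ofReal_mul_I_re,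
    Complex.exp_ofReal_mul_I_im]

theorem meanLogGrowth_eq {κ : ℝ} (h : IsSLStep (fun s => transfer ε lam (v s)) κ) (θ : ℝ) (N : ℕ) :
    meanLogGrowth μ v ε lam θ N
      = meanLog μ (fun s => transfer ε lam (v s)) N (Complex.exp (θ * Complex.I)) := by
  rw [← integral_log_norm_act_transferProd μ h N (Complex.exp_ne_zero _)]
  simp only [meanLogGrowth, norm_toLp_mulVec_unitVec]

/-- Allows an almost surely bounded or constant potential to be replaced by one with that property
everywhere. -/
theorem meanLogGrowth_congr {v' : S → ℝ} (h : v =ᵐ[μ] v') (θ : ℝ) (N : ℕ) :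
    meanLogGrowth μ v ε lam θ N = meanLogGrowth μ v' ε lam θ N := by
  have hall : ∀ᵐ ω ∂(Measure.infinitePi fun _ : ℕ => μ), ∀ n : ℕ, v (ω n) = v' (ω n) := by
    rw [ae_all_iff]
    intro n
    exact (measurePreserving_eval_infinitePi (fun _ : ℕ => μ) n).quasiMeasurePreserving.ae h
  apply integral_congr_ae
  filter_upwards [hall] with ω hω
  have : transferProd v ε lam ω N = transferProd v' ε lam ω N := by
    induction N with
    | zero => rfl
    | succ N ih => rw [transferProd, ih, hω N]; rfl
  rw [this]

theorem meanLog_neg {X : Type*} [MeasurableSpace X] (m : Measure X)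
    (D : X → Matrix (Fin 2) (Fin 2) ℝ) (N : ℕ) (z : ℂ) : meanLog m D N (-z) = meanLog m D N z := by
  induction N generalizing z with
  | zero => simp [meanLog]
  | succ N ih => simp only [meanLog, act_neg_right, ih]

/-! ### Grouping the letters in pairs -/

/-- Minus the product of two transfer matrices; the second letter comes first in time. -/
def pairStep (v : S → ℝ) (ε lam : ℝ) (s : S × S) : Matrix (Fin 2) (Fin 2) ℝ :=
  -(transfer ε lam (v s.1) * transfer ε lam (v s.2))

theorem IsSLStep.pairStep {κ : ℝ} (h : IsSLStep (fun s => transfer ε lam (v s)) κ) :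
    IsSLStep (pairStep v ε lam) (2 * (κ * κ)) :=
  (h.mul h measurable_fst measurable_snd).neg

theorem meanLog_pairStep {κ : ℝ} (h : IsSLStep (fun s => transfer ε lam (v s)) κ) (N : ℕ)
    {z : ℂ} (hz : z ≠ 0) :
    meanLog (μ.prod μ) (pairStep v ε lam) N z
      = meanLog μ (fun s => transfer ε lam (v s)) (2 * N) z := by
  induction N generalizing z with
  | zero => simp [meanLog]
  | succ N ih =>
    have hi := h.pairStep.integrable_meanLog (μ.prod μ) N hz
    -- The second coordinate acts first in time, so it has to be the outer variable of integration.
    rw [meanLog, integral_prod_symm _ hi, show 2 * (N + 1) = 2 * N + 1 + 1 by ring, meanLog]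
    congr 1
    funext a
    rw [meanLog]
    congr 1
    funext b
    rw [ih (h.pairStep.act_ne_zero _ hz)]
    simp only [AndersonBandCenter.pairStep, act_neg_left, act_mul, meanLog_neg]

/-- Pairs control even lengths only. Bounded increments take care of odd lengths, and the rate per
letter is half the rate per pair. -/
theorem tendsto_inv_mul_of_even {a : ℕ → ℝ} {C γ : ℝ} (hC : ∀ n, |a (n + 1) - a n| ≤ C)
    (ha : Tendsto (fun N : ℕ => (N : ℝ)⁻¹ * a (2 * N)) atTop (𝓝 γ)) :
    Tendsto (fun n : ℕ => (n : ℝ)⁻¹ * a n) atTop (𝓝 (γ / 2)) := by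
  have hC0 : 0 ≤ C := (abs_nonneg _).trans (hC 0)
  have hdiv : Tendsto (fun n : ℕ => n / 2) atTop atTop :=
    Nat.tendsto_div_const_atTop two_ne_zero
  have h1 := ha.comp hdiv
  have hinv : Tendsto (fun n : ℕ => (n : ℝ)⁻¹) atTop (𝓝 0) :=
    tendsto_inv_atTop_zero.comp tendsto_natCast_atTop_atTop
  have h2 : Tendsto (fun n : ℕ => (n : ℝ)⁻¹ * ((n / 2 : ℕ) : ℝ)) atTop (𝓝 (1 / 2)) := by
    have : Tendsto (fun n : ℕ => (n : ℝ)⁻¹ * ((n / 2 : ℕ) : ℝ) - 1 / 2) atTop (𝓝 0) := by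
      apply squeeze_zero_norm' _ hinv
      filter_upwards [eventually_gt_atTop 0] with n hn
      have hn' : (0 : ℝ) < n := by exact_mod_cast hn
      have e : (n : ℝ) = 2 * ((n / 2 : ℕ) : ℝ) + ((n % 2 : ℕ) : ℝ) := by
        exact_mod_cast (Nat.div_add_mod n 2).symm
      have hm : ((n % 2 : ℕ) : ℝ) ≤ 1 := by
        exact_mod_cast Nat.lt_succ_iff.1 (Nat.mod_lt n two_pos)
      have hm0 : (0 : ℝ) ≤ ((n % 2 : ℕ) : ℝ) := by positivity
      have : (n : ℝ)⁻¹ * ((n / 2 : ℕ) : ℝ) - 1 / 2 = (n : ℝ)⁻¹ * (-((n % 2 : ℕ) : ℝ) / 2) := by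
        have h3 : ((n / 2 : ℕ) : ℝ) = ((n : ℝ) - ((n % 2 : ℕ) : ℝ)) / 2 := by linarith
        rw [h3]
        field_simp
        ring
      rw [this, norm_mul, Real.norm_of_nonneg (by positivity : (0 : ℝ) ≤ (n : ℝ)⁻¹)]
      have h4 : ‖-((n % 2 : ℕ) : ℝ) / 2‖ ≤ 1 := by
        rw [Real.norm_eq_abs, abs_le]; constructor <;> linarith
      calc (n : ℝ)⁻¹ * ‖-((n % 2 : ℕ) : ℝ) / 2‖ ≤ (n : ℝ)⁻¹ * 1 := by gcongr
        _ = _ := mul_one _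
    have h5 := this.add_const (1 / 2)
    simpa only [sub_add_cancel, zero_add] using h5
  have h3 : Tendsto (fun n : ℕ => (n : ℝ)⁻¹ * (a n - a (2 * (n / 2)))) atTop (𝓝 0) := by
    apply squeeze_zero_norm (a := fun n : ℕ => (n : ℝ)⁻¹ * C)
    · intro n
      rw [norm_mul, Real.norm_of_nonneg (by positivity : (0 : ℝ) ≤ (n : ℝ)⁻¹)]
      gcongr
      rcases Nat.mod_two_eq_zero_or_one n with h | h
      · have : 2 * (n / 2) = n := by omega
        rw [this, sub_self, norm_zero]; exact hC0
      · have : n = 2 * (n / 2) + 1 := by omega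
        conv_lhs => rw [this]
        have e : 2 * ((2 * (n / 2) + 1) / 2) = 2 * (n / 2) := by omega
        rw [e]
        exact hC _
    · simpa using hinv.mul_const C
  have h4 := (h2.mul h1).add h3
  rw [show 1 / 2 * γ + 0 = γ / 2 by ring] at h4
  refine h4.congr' ?_
  filter_upwards [eventually_ge_atTop 2] with n hn
  have hk : ((n / 2 : ℕ) : ℝ) ≠ 0 := by
    have : n / 2 ≠ 0 := by omega
    exact_mod_cast this
  simp only [Function.comp_apply]
  field_simp
  ring

end Codes

/-! ### The Lyapunov exponent from a corrected logarithm -/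

section Codes

variable {S : Type*} [MeasurableSpace S] (μ : Measure S) [IsProbabilityMeasure μ]
  {v : S → ℝ} {ε lam : ℝ}

theorem exists_isLyapunovExponent {κ : ℝ} (h : IsSLStep (fun s => transfer ε lam (v s)) κ)
    {U : ℂ → ℝ} (hU : Measurable U) {C₀ c e : ℝ} (hC : ∀ z, z ≠ 0 → |U z - Real.log ‖z‖| ≤ C₀)
    (he : ∀ z, z ≠ 0 → |(∫ s, U (act (pairStep v ε lam s) z) ∂(μ.prod μ)) - U z - c| ≤ e)
    (hce : e < c) :
    ∃ g, IsLyapunovExponent μ v ε lam g ∧ |2 * g - c| ≤ e := by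
  obtain ⟨γ, hγ⟩ := h.pairStep.exists_tendsto (μ.prod μ) hU hC (η := c - e) (by linarith)
    (fun z hz => by linarith [(abs_le.1 (he z hz)).1])
  refine ⟨γ / 2, fun θ => ?_, ?_⟩
  · have hz := Complex.exp_ne_zero (θ * Complex.I)
    have h1 := tendsto_inv_mul_of_even
      (a := fun n => meanLog μ (fun s => transfer ε lam (v s)) n (Complex.exp (θ * Complex.I)))
      (fun n => h.abs_meanInc_le μ n hz)
      ((hγ _ hz).congr fun N => by rw [meanLog_pairStep μ h N hz])
    refine h1.congr fun N => ?_
    rw [meanLogGrowth_eq μ h, one_div]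
  · have h1 := hγ 1 one_ne_zero
    have h2 : Tendsto (fun N : ℕ => e + (N : ℝ)⁻¹ * (C₀ + |U 1|)) atTop (𝓝 e) := by
      simpa using (((tendsto_inv_atTop_zero (𝕜 := ℝ)).comp
        tendsto_natCast_atTop_atTop).mul_const (C₀ + |U 1|)).const_add e
    rw [show 2 * (γ / 2) - c = γ - c by ring]
    -- The estimate for finite N has error e + O(1/N), where the O(1/N) collects the bounded
    -- boundary terms.
    refine le_of_tendsto_of_tendsto (h1.sub_const c).abs h2 ?_
    filter_upwards [eventually_gt_atTop 0] with N hN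
    have hN' : (0 : ℝ) < N := by exact_mod_cast hN
    have h3 := h.pairStep.abs_meanLog_sub_mul_le (μ.prod μ) hU hC he N one_ne_zero
    set L := meanLog (μ.prod μ) (pairStep v ε lam) N 1
    have h4 : |L - N * c| ≤ N * e + (C₀ + |U 1|) := by
      have := abs_add_le (L - U 1 - N * c) (U 1)
      rw [show L - U 1 - N * c + U 1 = L - N * c by ring] at this
      linarith
    have h5 : (N : ℝ)⁻¹ * L - c = (N : ℝ)⁻¹ * (L - N * c) := by field_simp
    rw [h5, abs_mul, abs_of_pos (inv_pos.2 hN')]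
    calc (N : ℝ)⁻¹ * |L - N * c| ≤ (N : ℝ)⁻¹ * (N * e + (C₀ + |U 1|)) := by gcongr
      _ = _ := by field_simp

/-- A deterministic elliptic transfer matrix has vanishing Lyapunov exponent. -/
theorem isLyapunovExponent_zero_of_const {t : ℝ} (ht : |t| < 2)
    (hv : ∀ s, lam * v s - ε * lam ^ 2 = t) : IsLyapunovExponent μ v ε lam 0 := by
  have hT (s : S) : transfer ε lam (v s) = !![t, -1; 1, 0] := by rw [transfer, hv s]
  have h : IsSLStep (fun s => transfer ε lam (v s)) 2 := by
    refine ⟨fun i j => ?_, fun s => ?_, fun s i j => ?_, one_le_two⟩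
    · simp only [hT]; exact measurable_const
    · simp [hT, Matrix.det_fin_two]
    · rw [hT]
      fin_cases i <;> fin_cases j <;> simp [ht.le]
  -- This form is invariant under [[t, -1], [1, 0]] and positive definite because |t| < 2. Thus U =
  -- (log q)/2 has zero drift, and telescoping alone gives the limit, without any contraction.
  set q : ℂ → ℝ := fun z => z.re ^ 2 - t * z.re * z.im + z.im ^ 2 with hq
  set U : ℂ → ℝ := fun z => Real.log (q z) / 2 with hUdef
  have hqm : Measurable q := by
    have h1 := Complex.measurable_re
    have h2 := Complex.measurable_im
    fun_prop
  have hU : Measurable U := (Real.measurable_log.comp hqm).div_const 2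
  have ha : 0 < 1 - |t| / 2 := by linarith
  have hxy (z : ℂ) : |t * z.re * z.im| ≤ |t| / 2 * ‖z‖ ^ 2 := by
    rw [mul_assoc, abs_mul, sq_norm_eq]
    have : |z.re * z.im| ≤ (z.re ^ 2 + z.im ^ 2) / 2 := by
      rw [abs_le]
      constructor <;> nlinarith [sq_nonneg (z.re + z.im), sq_nonneg (z.re - z.im)]
    nlinarith [abs_nonneg t]
  have hC (z : ℂ) (hz : z ≠ 0) : |U z - Real.log ‖z‖|
      ≤ (|Real.log (1 - |t| / 2)| + |Real.log (1 + |t| / 2)|) / 2 := by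
    have hz' : 0 < ‖z‖ := norm_pos_iff.2 hz
    have h1 := abs_le.1 (hxy z)
    have hz2 := sq_norm_eq z
    have hlow : (1 - |t| / 2) * ‖z‖ ^ 2 ≤ q z := by rw [hq]; simp only; linarith
    have hup : q z ≤ (1 + |t| / 2) * ‖z‖ ^ 2 := by rw [hq]; simp only; linarith
    have hqpos : 0 < q z := lt_of_lt_of_le (by positivity) hlow
    have l1 := Real.log_le_log (by positivity) hlow
    have l2 := Real.log_le_log hqpos hup
    rw [Real.log_mul ha.ne' (by positivity), Real.log_pow] at l1
    rw [Real.log_mul (by positivity) (by positivity), Real.log_pow] at l2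
    push_cast at l1 l2
    have a1 := abs_le.1 (le_refl |Real.log (1 - |t| / 2)|)
    have a2 := abs_le.1 (le_refl |Real.log (1 + |t| / 2)|)
    rw [abs_le, hUdef]
    constructor <;> simp only <;> linarith [a1.1, a1.2, a2.1, a2.2]
  have he (z : ℂ) (_ : z ≠ 0) :
      |(∫ s, U (act (transfer ε lam (v s)) z) ∂μ) - U z - 0| ≤ 0 := by
    have (s : S) : U (act (transfer ε lam (v s)) z) = U z := by
      have : q (act (transfer ε lam (v s)) z) = q z := by
        simp [hT, hq, act]; ring
      rw [hUdef]; simp only [this]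
    simp [this]
  intro θ
  set z := Complex.exp (θ * Complex.I)
  have hz : z ≠ 0 := Complex.exp_ne_zero _
  set C₀ := (|Real.log (1 - |t| / 2)| + |Real.log (1 + |t| / 2)|) / 2
  apply squeeze_zero_norm (a := fun N : ℕ => (N : ℝ)⁻¹ * (C₀ + |U z|))
  · intro N
    have h3 := h.abs_meanLog_sub_mul_le μ hU hC he N hz
    rw [meanLogGrowth_eq μ h, one_div, norm_mul,
      Real.norm_of_nonneg (by positivity : (0 : ℝ) ≤ (N : ℝ)⁻¹)]
    gcongr
    have h4 := abs_add_le (meanLog μ (fun s => transfer ε lam (v s)) N z - U z - N * 0) (U z)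
    rw [mul_zero, sub_zero, sub_add_cancel] at h4
    rw [mul_zero, sub_zero] at h3
    rw [Real.norm_eq_abs]
    linarith
  · simpa using ((tendsto_inv_atTop_zero (𝕜 := ℝ)).comp
        tendsto_natCast_atTop_atTop).mul_const (C₀ + |U z|)

end Codes

/-! ### Second order Taylor expansions -/

/-- The first conclusion keeps 1 + u away from 0; the second is the logarithm series cut after
degree two, with everything of order λ³ collected. -/
theorem norm_log_one_add_sub_le {K lam : ℝ} {z₁ z₂ z₃ : ℂ} (h1 : ‖z₁‖ ≤ K) (h2 : ‖z₂‖ ≤ K)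
    (h3 : ‖z₃‖ ≤ K) (hlam : |lam| ≤ 1) (hK : 3 * K * |lam| ≤ 1 / 2) :
    ‖(lam * z₁ + lam ^ 2 * z₂ + lam ^ 3 * z₃ : ℂ)‖ ≤ 1 / 2 ∧
    ‖Complex.log (1 + (lam * z₁ + lam ^ 2 * z₂ + lam ^ 3 * z₃))
      - (lam * z₁ + lam ^ 2 * (z₂ - z₁ ^ 2 / 2))‖ ≤ (18 * K ^ 3 + 4 * K ^ 2 + K) * |lam| ^ 3 := by
  have hK0 : 0 ≤ K := (norm_nonneg _).trans h1
  have l0 := abs_nonneg lam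
  have l2 : |lam| ^ 2 ≤ |lam| := by nlinarith
  have l3 : |lam| ^ 3 ≤ |lam| ^ 2 := by nlinarith [sq_nonneg |lam|]
  set u : ℂ := lam * z₁ + lam ^ 2 * z₂ + lam ^ 3 * z₃ with hu
  have n1 : ‖(lam * z₁ : ℂ)‖ ≤ K * |lam| := by
    rw [norm_mul, Complex.norm_real, Real.norm_eq_abs, mul_comm]; gcongr
  have n2 : ‖(lam ^ 2 * z₂ : ℂ)‖ ≤ K * |lam| ^ 2 := by
    rw [norm_mul, norm_pow, Complex.norm_real, Real.norm_eq_abs, mul_comm]; gcongr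
  have n3 : ‖(lam ^ 3 * z₃ : ℂ)‖ ≤ K * |lam| ^ 3 := by
    rw [norm_mul, norm_pow, Complex.norm_real, Real.norm_eq_abs, mul_comm]; gcongr
  have hul : ‖u‖ ≤ 3 * K * |lam| := by
    refine (norm_add₃_le).trans ?_
    nlinarith
  have hu2 : ‖u‖ ≤ 1 / 2 := hul.trans hK
  refine ⟨hu2, ?_⟩
  have hT : Complex.logTaylor 3 u = u - u ^ 2 / 2 := by
    simp [Complex.logTaylor, Finset.sum_range_succ]
    ring
  have ht := Complex.norm_log_sub_logTaylor_le 2 (lt_of_le_of_lt hu2 (by norm_num : (1 / 2 : ℝ) < 1))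
  rw [show 2 + 1 = 3 by norm_num, hT] at ht
  have ht' : ‖Complex.log (1 + u) - (u - u ^ 2 / 2)‖ ≤ 18 * K ^ 3 * |lam| ^ 3 := by
    refine ht.trans ?_
    have hinv : (1 - ‖u‖)⁻¹ ≤ 2 := by
      rw [inv_le_comm₀ (by linarith) two_pos]
      linarith
    have hinv0 : 0 ≤ (1 - ‖u‖)⁻¹ := inv_nonneg.2 (by linarith)
    calc ‖u‖ ^ 3 * (1 - ‖u‖)⁻¹ / (((2 : ℕ) : ℝ) + 1) ≤ (3 * K * |lam|) ^ 3 * 2 / (((2 : ℕ) : ℝ) + 1) := by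
          gcongr
      _ = _ := by push_cast; ring
  -- Replacing u² by (λz₁)² costs order λ³: the difference of squares has one factor of order λ² and
  -- one of order λ.
  have hq : ‖(u - lam * z₁) * (u + lam * z₁)‖ ≤ 8 * K ^ 2 * |lam| ^ 3 := by
    rw [norm_mul]
    have a1 : ‖u - lam * z₁‖ ≤ 2 * K * |lam| ^ 2 := by
      rw [show u - lam * z₁ = lam ^ 2 * z₂ + lam ^ 3 * z₃ by rw [hu]; ring]
      refine (norm_add_le _ _).trans ?_
      nlinarith
    have a2 : ‖u + lam * z₁‖ ≤ 4 * K * |lam| := by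
      refine (norm_add_le _ _).trans ?_
      linarith
    calc _ ≤ 2 * K * |lam| ^ 2 * (4 * K * |lam|) := by gcongr
      _ = _ := by ring
  have hdec : Complex.log (1 + u) - (lam * z₁ + lam ^ 2 * (z₂ - z₁ ^ 2 / 2))
      = (Complex.log (1 + u) - (u - u ^ 2 / 2)) + lam ^ 3 * z₃
        + -((u - lam * z₁) * (u + lam * z₁) / 2) := by
    linear_combination hu
  rw [hdec]
  refine (norm_add₃_le).trans ?_
  rw [norm_neg, norm_div, Complex.norm_two]
  linarith

/-- Mean value inequality on [-|y|, |y|]; the factor 1/(n + 1) of exact integration is given up.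
Three applications give the Taylor remainder below. -/
theorem abs_le_mul_pow_of_hasDerivAt {f f' : ℝ → ℝ} {M : ℝ} {n : ℕ}
    (hf : ∀ t, HasDerivAt f (f' t) t) (hf0 : f 0 = 0) (hM0 : 0 ≤ M) (hM : ∀ t, |f' t| ≤ M * |t| ^ n)
    (y : ℝ) : |f y| ≤ M * |y| ^ (n + 1) := by
  have := (convex_Icc (-|y|) |y|).norm_image_sub_le_of_norm_hasDerivWithin_le
    (f := f) (f' := f') (C := M * |y| ^ n) (x := 0) (y := y)
    (fun t _ => (hf t).hasDerivWithinAt) (fun t ht => by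
      refine (hM t).trans ?_
      have : |t| ≤ |y| := abs_le.2 ht
      gcongr) (by simp) (abs_le.1 le_rfl)
  rw [hf0, sub_zero, sub_zero, Real.norm_eq_abs, Real.norm_eq_abs] at this
  rw [pow_succ, ← mul_assoc]
  exact this

theorem abs_taylor_two_le {G G₁ G₂ G₃ : ℝ → ℝ} {K : ℝ} (h1 : ∀ t, HasDerivAt G (G₁ t) t)
    (h2 : ∀ t, HasDerivAt G₁ (G₂ t) t) (h3 : ∀ t, HasDerivAt G₂ (G₃ t) t) (hK : ∀ t, |G₃ t| ≤ K)
    (θ y : ℝ) : |G (θ + y) - G θ - G₁ θ * y - G₂ θ / 2 * y ^ 2| ≤ K * |y| ^ 3 := by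
  have hK0 : 0 ≤ K := (abs_nonneg _).trans (hK 0)
  have c {f f' : ℝ → ℝ} (hf : ∀ t, HasDerivAt f (f' t) t) (t : ℝ) :
      HasDerivAt (fun t => f (θ + t)) (f' (θ + t)) t := by
    simpa using (hf (θ + t)).comp_const_add θ t
  have b2 := abs_le_mul_pow_of_hasDerivAt (n := 0) (f := fun t => G₂ (θ + t) - G₂ θ)
    (fun t => (c h3 t).sub_const _) (by simp) hK0 (fun t => by simpa using hK (θ + t))
  have b1 := abs_le_mul_pow_of_hasDerivAt (n := 1)
    (f := fun t => G₁ (θ + t) - G₁ θ - G₂ θ * t) (f' := fun t => G₂ (θ + t) - G₂ θ)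
    (fun t => by
      simpa using ((c h2 t).sub_const (G₁ θ)).fun_sub ((hasDerivAt_id' t).const_mul (G₂ θ)))
    (by simp) hK0 b2
  exact abs_le_mul_pow_of_hasDerivAt (n := 2)
    (f := fun t => G (θ + t) - G θ - G₁ θ * t - G₂ θ / 2 * t ^ 2)
    (f' := fun t => G₁ (θ + t) - G₁ θ - G₂ θ * t)
    (fun t => by
      refine ((((c h1 t).sub_const (G θ)).fun_sub ((hasDerivAt_id' t).const_mul (G₁ θ))).fun_sub
        (((hasDerivAt_id' t).fun_pow 2).const_mul (G₂ θ / 2))).congr_deriv ?_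
      push_cast
      ring) (by simp) hK0 b1 y

theorem sq_div_two_re (z : ℂ) : (z ^ 2 / 2).re = (z.re ^ 2 - z.im ^ 2) / 2 := by
  rw [Complex.div_ofNat_re, pow_two, Complex.mul_re]; ring

theorem sq_div_two_im (z : ℂ) : (z ^ 2 / 2).im = z.re * z.im := by
  rw [Complex.div_ofNat_im, pow_two, Complex.mul_im]; ring

/-- The second order expansion in `lam` of the increment of `log ‖z‖ + G (arg z)` when `z` is
multiplied by `1 + lam z₁ + lam² z₂ + lam³ z₃`. -/
theorem exists_abs_increment_sub_le {K : ℝ} (hK0 : 0 ≤ K) : ∃ C : ℝ, ∀ (lam : ℝ) (z₁ z₂ z₃ : ℂ),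
    |lam| ≤ 1 → 3 * K * |lam| ≤ 1 / 2 → ‖z₁‖ ≤ K → ‖z₂‖ ≤ K → ‖z₃‖ ≤ K →
    ∀ (G : ℝ → ℝ) (θ g₁ g₂ : ℝ), |g₁| ≤ K → |g₂| ≤ K →
    (∀ y, |G (θ + y) - G θ - g₁ * y - g₂ / 2 * y ^ 2| ≤ K * |y| ^ 3) →
    ∀ w : ℂ, w = Complex.log (1 + (lam * z₁ + lam ^ 2 * z₂ + lam ^ 3 * z₃)) →
    |w.re + (G (θ + w.im) - G θ)
      - (lam * z₁.re + lam ^ 2 * (z₂.re - (z₁.re ^ 2 - z₁.im ^ 2) / 2)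
        + g₁ * (lam * z₁.im + lam ^ 2 * (z₂.im - z₁.re * z₁.im))
        + g₂ / 2 * (lam ^ 2 * z₁.im ^ 2))| ≤ C * |lam| ^ 3 := by
  set C₁ : ℝ := 18 * K ^ 3 + 4 * K ^ 2 + K with hC₁
  set C₂ : ℝ := C₁ + 2 * (K + K ^ 2) with hC₂
  refine ⟨C₁ + K * C₁ + K * (C₂ + K) ^ 3 + K * (C₂ * (C₂ + 2 * K)), ?_⟩
  intro lam z₁ z₂ z₃ hlam hKlam h1 h2 h3 G θ g₁ g₂ hg1 hg2 hG w hw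
  obtain ⟨-, hlog⟩ := norm_log_one_add_sub_le h1 h2 h3 hlam hKlam
  rw [← hw] at hlog
  have l0 := abs_nonneg lam
  have l2 : |lam| ^ 2 ≤ |lam| := by nlinarith
  have l3 : |lam| ^ 3 ≤ |lam| ^ 2 := by nlinarith [sq_nonneg |lam|]
  have hC₁0 : 0 ≤ C₁ := by positivity
  have hC₂0 : 0 ≤ C₂ := by positivity
  have hre := (Complex.abs_re_le_norm _).trans hlog
  have him := (Complex.abs_im_le_norm _).trans hlog
  set X₀ : ℝ := lam * z₁.re + lam ^ 2 * (z₂.re - (z₁.re ^ 2 - z₁.im ^ 2) / 2) with hX₀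
  set b : ℝ := z₂.im - z₁.re * z₁.im with hb
  set p : ℝ := z₁.im with hp
  have ecast : (lam * z₁ + lam ^ 2 * (z₂ - z₁ ^ 2 / 2) : ℂ)
      = ((lam : ℝ) : ℂ) * z₁ + ((lam ^ 2 : ℝ) : ℂ) * (z₂ - z₁ ^ 2 / 2) := by push_cast; ring
  have ere : (w - (lam * z₁ + lam ^ 2 * (z₂ - z₁ ^ 2 / 2))).re = w.re - X₀ := by
    rw [ecast, Complex.sub_re, Complex.add_re,
      Complex.re_ofReal_mul, Complex.re_ofReal_mul,
      Complex.sub_re, sq_div_two_re, hX₀]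
  have eim : (w - (lam * z₁ + lam ^ 2 * (z₂ - z₁ ^ 2 / 2))).im
      = w.im - (lam * p + lam ^ 2 * b) := by
    rw [ecast, Complex.sub_im, Complex.add_im,
      Complex.im_ofReal_mul, Complex.im_ofReal_mul,
      Complex.sub_im, sq_div_two_im, hb, hp]
  rw [ere] at hre
  rw [eim] at him
  have hpK : |p| ≤ K := (Complex.abs_im_le_norm _).trans h1
  have hbK : |b| ≤ K + K ^ 2 := by
    rw [hb]
    refine (abs_sub _ _).trans ?_
    rw [abs_mul, pow_two]
    have a1 := (Complex.abs_im_le_norm z₂).trans h2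
    have a2 := (Complex.abs_re_le_norm z₁).trans h1
    gcongr
  -- The angle change w.im equals λp to first order, which suffices in the quadratic term of G; the
  -- linear term uses the second order approximation `him`.
  have hY1 : |w.im - lam * p| ≤ C₂ * |lam| ^ 2 := by
    have := abs_add_le (w.im - (lam * p + lam ^ 2 * b)) (lam ^ 2 * b)
    rw [show w.im - (lam * p + lam ^ 2 * b) + lam ^ 2 * b = w.im - lam * p by ring, abs_mul,
      abs_pow] at this
    have h5 : |lam| ^ 2 * |b| ≤ |lam| ^ 2 * (K + K ^ 2) := by gcongr
    have h6 : C₁ * |lam| ^ 3 ≤ C₁ * |lam| ^ 2 := by gcongr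
    have h7 : 0 ≤ (K + K ^ 2) * |lam| ^ 2 := by positivity
    rw [hC₂]
    nlinarith
  have hlp : |lam * p| ≤ K * |lam| := by rw [abs_mul, mul_comm]; gcongr
  have hY : |w.im| ≤ (C₂ + K) * |lam| := by
    have := abs_add_le (w.im - lam * p) (lam * p)
    rw [sub_add_cancel] at this
    have h6 : C₂ * |lam| ^ 2 ≤ C₂ * |lam| := by gcongr
    linarith
  have hY2 : |w.im ^ 2 - lam ^ 2 * p ^ 2| ≤ C₂ * (C₂ + 2 * K) * |lam| ^ 3 := by
    rw [show w.im ^ 2 - lam ^ 2 * p ^ 2 = (w.im - lam * p) * (w.im + lam * p) by ring, abs_mul]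
    have : |w.im + lam * p| ≤ (C₂ + 2 * K) * |lam| := by
      refine (abs_add_le _ _).trans ?_
      linarith
    calc _ ≤ C₂ * |lam| ^ 2 * ((C₂ + 2 * K) * |lam|) := by gcongr
      _ = _ := by ring
  have hT : |G (θ + w.im) - G θ - g₁ * w.im - g₂ / 2 * w.im ^ 2|
      ≤ K * (C₂ + K) ^ 3 * |lam| ^ 3 := by
    refine (hG w.im).trans ?_
    calc K * |w.im| ^ 3 ≤ K * ((C₂ + K) * |lam|) ^ 3 := by gcongr
      _ = _ := by ring
  have t1 : |g₁ * (w.im - (lam * p + lam ^ 2 * b))| ≤ K * C₁ * |lam| ^ 3 := by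
    rw [abs_mul, mul_assoc K]; gcongr
  have t2 : |g₂ / 2 * (w.im ^ 2 - lam ^ 2 * p ^ 2)| ≤ K * (C₂ * (C₂ + 2 * K)) * |lam| ^ 3 := by
    rw [abs_mul, mul_assoc K]
    have : |g₂ / 2| ≤ K := by
      rw [abs_div, abs_two]; linarith [abs_nonneg g₂]
    gcongr
  have hsplit : w.re + (G (θ + w.im) - G θ)
      - (X₀ + g₁ * (lam * p + lam ^ 2 * b) + g₂ / 2 * (lam ^ 2 * p ^ 2))
      = (w.re - X₀) + (G (θ + w.im) - G θ - g₁ * w.im - g₂ / 2 * w.im ^ 2)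
        + g₁ * (w.im - (lam * p + lam ^ 2 * b)) + g₂ / 2 * (w.im ^ 2 - lam ^ 2 * p ^ 2) := by ring
  rw [hsplit]
  refine (abs_add_le _ _).trans ((add_le_add_left (abs_add_three _ _ _) _).trans ?_)
  linarith

theorem integrable_and_integral_quadratic {S : Type*} [MeasurableSpace S] (μ : Measure S)
    [IsProbabilityMeasure μ] {v : S → ℝ} (h1 : Integrable v μ)
    (h2 : Integrable (fun s => v s ^ 2) μ) (c₀ c₁ c₂ c₃ c₄ c₅ : ℝ) :
    Integrable (fun s : S × S => c₀ + c₁ * v s.1 + c₂ * v s.2 + c₃ * (v s.1 * v s.2)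
      + c₄ * v s.1 ^ 2 + c₅ * v s.2 ^ 2) (μ.prod μ) ∧
    ∫ s : S × S, (c₀ + c₁ * v s.1 + c₂ * v s.2 + c₃ * (v s.1 * v s.2)
      + c₄ * v s.1 ^ 2 + c₅ * v s.2 ^ 2) ∂(μ.prod μ)
      = c₀ + (c₁ + c₂) * (∫ s, v s ∂μ) + c₃ * (∫ s, v s ∂μ) ^ 2
        + (c₄ + c₅) * ∫ s, v s ^ 2 ∂μ := by
  have i0 : Integrable (fun _ : S × S => c₀) (μ.prod μ) := integrable_const _
  have i1 : Integrable (fun s : S × S => c₁ * v s.1) (μ.prod μ) := (h1.comp_fst μ).const_mul c₁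
  have i2 : Integrable (fun s : S × S => c₂ * v s.2) (μ.prod μ) := (h1.comp_snd μ).const_mul c₂
  have i3 : Integrable (fun s : S × S => c₃ * (v s.1 * v s.2)) (μ.prod μ) :=
    (h1.mul_prod h1).const_mul c₃
  have i4 : Integrable (fun s : S × S => c₄ * v s.1 ^ 2) (μ.prod μ) := (h2.comp_fst μ).const_mul c₄
  have i5 : Integrable (fun s : S × S => c₅ * v s.2 ^ 2) (μ.prod μ) := (h2.comp_snd μ).const_mul c₅
  have i01 : Integrable (fun s : S × S => c₀ + c₁ * v s.1) (μ.prod μ) := i0.add i1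
  have i02 : Integrable (fun s : S × S => c₀ + c₁ * v s.1 + c₂ * v s.2) (μ.prod μ) := i01.add i2
  have i03 : Integrable (fun s : S × S => c₀ + c₁ * v s.1 + c₂ * v s.2 + c₃ * (v s.1 * v s.2))
    (μ.prod μ) := i02.add i3
  have i04 : Integrable (fun s : S × S => c₀ + c₁ * v s.1 + c₂ * v s.2 + c₃ * (v s.1 * v s.2)
    + c₄ * v s.1 ^ 2) (μ.prod μ) := i03.add i4
  refine ⟨i04.add i5, ?_⟩
  have e1 : ∫ s : S × S, v s.1 ∂(μ.prod μ) = ∫ s, v s ∂μ := by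
    simpa using integral_fun_fst (μ := μ) (ν := μ) v
  have e2 : ∫ s : S × S, v s.2 ∂(μ.prod μ) = ∫ s, v s ∂μ := by
    simpa using integral_fun_snd (μ := μ) (ν := μ) v
  have e3 : ∫ s : S × S, v s.1 * v s.2 ∂(μ.prod μ) = (∫ s, v s ∂μ) ^ 2 := by
    rw [integral_prod_mul, pow_two]
  have e4 : ∫ s : S × S, v s.1 ^ 2 ∂(μ.prod μ) = ∫ s, v s ^ 2 ∂μ := by
    simpa using integral_fun_fst (μ := μ) (ν := μ) fun s => v s ^ 2
  have e5 : ∫ s : S × S, v s.2 ^ 2 ∂(μ.prod μ) = ∫ s, v s ^ 2 ∂μ := by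
    simpa using integral_fun_snd (μ := μ) (ν := μ) fun s => v s ^ 2
  rw [integral_add i04 i5, integral_add i03 i4, integral_add i02 i3, integral_add i01 i2,
    integral_add i0 i1, integral_const_mul, integral_const_mul,
    integral_const_mul, integral_const_mul, integral_const_mul, e1, e2, e3, e4, e5]
  simp only [integral_const, probReal_univ, one_smul]
  ring

/-! ### Drift of the corrected logarithm along a pair step -/

/-- Bounded `2π`-periodic functions `G` with bounded `G₁ = G'`, `G₂ = G''` and a uniform
third order Taylor bound. -/
structure IsPhaseFunction (G G₁ G₂ : ℝ → ℝ) (K : ℝ) : Prop where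
  periodic : Function.Periodic G (2 * Real.pi)
  measurable : Measurable G
  abs_le : ∀ θ, |G θ| ≤ K
  abs_le₁ : ∀ θ, |G₁ θ| ≤ K
  abs_le₂ : ∀ θ, |G₂ θ| ≤ K
  taylor : ∀ θ y, |G (θ + y) - G θ - G₁ θ * y - G₂ θ / 2 * y ^ 2| ≤ K * |y| ^ 3

theorem IsPhaseFunction.mono {G G₁ G₂ : ℝ → ℝ} {K K' : ℝ} (h : IsPhaseFunction G G₁ G₂ K)
    (hK : K ≤ K') : IsPhaseFunction G G₁ G₂ K' where
  periodic := h.periodic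
  measurable := h.measurable
  abs_le θ := (h.abs_le θ).trans hK
  abs_le₁ θ := (h.abs_le₁ θ).trans hK
  abs_le₂ θ := (h.abs_le₂ θ).trans hK
  taylor θ y := (h.taylor θ y).trans (by gcongr)

/-- Arguments add only modulo 2π; this is why correctors must be periodic. -/
theorem periodic_arg_mul {G : ℝ → ℝ} (hG : Function.Periodic G (2 * Real.pi)) {z w : ℂ}
    (hz : z ≠ 0) (hw : w ≠ 0) : G (z * w).arg = G (z.arg + w.arg) := by
  have h := Complex.arg_mul_coe_angle hz hw
  rw [← Real.Angle.coe_add, Real.Angle.angle_eq_iff_two_pi_dvd_sub] at h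
  obtain ⟨k, hk⟩ := h
  rw [show (z * w).arg = z.arg + w.arg + k * (2 * Real.pi) by linarith]
  exact hG.int_mul k _

section Expansion

variable {S : Type*} {v : S → ℝ} {ε lam : ℝ}

/-- The image of z divided by z depends on z through its direction only, so a real-linear step
becomes a complex multiplication. The imaginary part of the λ coefficient is the phase polynomial of
`pairP`. -/
theorem act_pairStep (s : S × S) (z : ℂ) :
    act (pairStep v ε lam s) z = z * (1 + (lam *
        (⟨(v s.1 - v s.2) * (Real.sin z.arg * Real.cos z.arg),
          -(v s.1 * Real.sin z.arg ^ 2 + v s.2 * Real.cos z.arg ^ 2)⟩ : ℂ)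
      + lam ^ 2 * (⟨-(v s.1 * v s.2) * Real.cos z.arg ^ 2,
          v s.1 * v s.2 * (Real.sin z.arg * Real.cos z.arg) + ε⟩ : ℂ)
      + lam ^ 3 * (⟨(ε * (v s.1 + v s.2) - lam * ε ^ 2) * Real.cos z.arg ^ 2,
          -((ε * (v s.1 + v s.2) - lam * ε ^ 2) * (Real.sin z.arg * Real.cos z.arg))⟩ : ℂ))) := by
  have hre : z.re = ‖z‖ * Real.cos z.arg := (Complex.norm_mul_cos_arg z).symm
  have him : z.im = ‖z‖ * Real.sin z.arg := (Complex.norm_mul_sin_arg z).symm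
  have h := Real.cos_sq_add_sin_sq z.arg
  set c := Real.cos z.arg
  set t := Real.sin z.arg
  set r := ‖z‖
  set x := v s.2 with hx
  set y := v s.1 with hy
  have e2 : (lam : ℂ) ^ 2 = ((lam ^ 2 : ℝ) : ℂ) := by push_cast; rfl
  have e3 : (lam : ℂ) ^ 3 = ((lam ^ 3 : ℝ) : ℂ) := by push_cast; rfl
  rw [e2, e3]
  apply Complex.ext
  · simp only [act, pairStep, transfer, Matrix.neg_apply, Matrix.mul_apply, Fin.sum_univ_two,
      Matrix.of_apply, Matrix.cons_val', Matrix.cons_val_zero, Matrix.cons_val_one,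
      Matrix.cons_val_fin_one, Complex.mul_re, Complex.mul_im, Complex.add_re, Complex.add_im, Complex.one_re,
      Complex.one_im, Complex.ofReal_re, Complex.ofReal_im, hre, him, ← hx, ← hy]
    linear_combination (-lam * r * y * t + lam ^ 2 * r * x * y * c
      - lam ^ 3 * r * (ε * (y + x) - lam * ε ^ 2) * c) * h
  · simp only [act, pairStep, transfer, Matrix.neg_apply, Matrix.mul_apply, Fin.sum_univ_two,
      Matrix.of_apply, Matrix.cons_val', Matrix.cons_val_zero, Matrix.cons_val_one,
      Matrix.cons_val_fin_one, Complex.mul_re, Complex.mul_im, Complex.add_re, Complex.add_im, Complex.one_re,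
      Complex.one_im, Complex.ofReal_re, Complex.ofReal_im, hre, him, ← hx, ← hy]
    linear_combination (lam * r * x * c) * h

/-- The second order expansion of the mean increment of `log ‖z‖ + G (arg z)` at `θ = arg z`, in
terms of the first two moments `m₁`, `m₂` of the potential. -/
def driftExpansion (m₁ m₂ ε lam g₁ g₂ θ : ℝ) : ℝ :=
  lam ^ 2 * (-m₁ ^ 2 * Real.cos θ ^ 2 - ((2 * m₂ - 2 * m₁ ^ 2) * (Real.sin θ * Real.cos θ) ^ 2
      - (m₂ * (Real.sin θ ^ 4 + Real.cos θ ^ 4)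
        + 2 * m₁ ^ 2 * (Real.sin θ * Real.cos θ) ^ 2)) / 2)
    + g₁ * (-lam * m₁ * (Real.sin θ ^ 2 + Real.cos θ ^ 2)
      + lam ^ 2 * (m₁ ^ 2 * (Real.sin θ * Real.cos θ) + ε
        + Real.sin θ * Real.cos θ * (m₂ - m₁ ^ 2) * (Real.sin θ ^ 2 - Real.cos θ ^ 2)))
    + g₂ / 2 * (lam ^ 2 * (m₂ * (Real.sin θ ^ 4 + Real.cos θ ^ 4)
        + 2 * m₁ ^ 2 * (Real.sin θ * Real.cos θ) ^ 2))

variable [MeasurableSpace S] (μ : Measure S) [IsProbabilityMeasure μ]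

/-- The constants depend on the phase function only through K₀, so the function may itself vary with
λ, as it does for a potential of nonzero mean. -/
theorem exists_drift_expansion (hv : Measurable v) {B : ℝ} (hB0 : 0 ≤ B) (hB : ∀ s, |v s| ≤ B)
    (ε K₀ : ℝ) (hK₀ : 0 ≤ K₀) : ∃ C l₀ : ℝ, 0 < l₀ ∧ ∀ lam : ℝ, |lam| ≤ l₀ →
      ∀ G G₁ G₂ : ℝ → ℝ, IsPhaseFunction G G₁ G₂ K₀ → ∀ z : ℂ, z ≠ 0 →
      |(∫ s, (Real.log ‖act (pairStep v ε lam s) z‖ + G (act (pairStep v ε lam s) z).arg)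
          ∂(μ.prod μ)) - (Real.log ‖z‖ + G z.arg)
        - driftExpansion (∫ s, v s ∂μ) (∫ s, v s ^ 2 ∂μ) ε lam (G₁ z.arg) (G₂ z.arg) z.arg|
        ≤ C * |lam| ^ 3 := by
  -- The summand 4B dominates z₁, 2B² + |ε| dominates z₂, and the rest beyond K₀ dominates z₃ for
  -- |λ| ≤ 1.
  set K : ℝ := K₀ + 4 * B + 2 * B ^ 2 + |ε| + 4 * |ε| * B + 2 * ε ^ 2 with hK
  have hKpos : 0 ≤ K := by positivity
  obtain ⟨C, hC⟩ := exists_abs_increment_sub_le hKpos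
  refine ⟨C, min 1 (1 / (6 * (K + 1))), by positivity, ?_⟩
  intro lam hlam G G₁ G₂ hG z hz
  have hlam1 : |lam| ≤ 1 := hlam.trans (min_le_left _ _)
  have hlamK : 3 * K * |lam| ≤ 1 / 2 := by
    have h1 : |lam| ≤ 1 / (6 * (K + 1)) := hlam.trans (min_le_right _ _)
    rw [le_div_iff₀ (by positivity)] at h1
    nlinarith [abs_nonneg lam]
  have hG' : IsPhaseFunction G G₁ G₂ K := hG.mono (by
    rw [hK]
    have : 0 ≤ 4 * B + 2 * B ^ 2 + |ε| + 4 * |ε| * B + 2 * ε ^ 2 := by positivity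
    linarith)
  have hstep := (isSLStep_transfer (ε := ε) (lam := lam) hv hB0 hB).pairStep
  have h1i : Integrable v μ := integrable_of_measurable_of_abs_le μ hv hB
  have h2i : Integrable (fun s => v s ^ 2) μ :=
    integrable_of_measurable_of_abs_le μ (hv.pow_const 2) (C := B ^ 2) (fun s => by
      rw [abs_pow]; exact pow_le_pow_left₀ (abs_nonneg _) (hB s) 2)
  set θ := z.arg with hθ
  set c := Real.cos θ with hc
  set t := Real.sin θ with ht
  have hc1 : |c| ≤ 1 := Real.abs_cos_le_one _
  have ht1 : |t| ≤ 1 := Real.abs_sin_le_one _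
  have hc2 : c ^ 2 ≤ 1 := Real.cos_sq_le_one _
  have ht2 : t ^ 2 ≤ 1 := Real.sin_sq_le_one _
  have htc : |t * c| ≤ 1 := by
    rw [abs_mul]; exact mul_le_one₀ ht1 (abs_nonneg _) hc1
  set g₁ := G₁ θ
  set g₂ := G₂ θ
  set Bk : S × S → ℝ := fun s =>
    lam * ((v s.1 - v s.2) * (t * c))
      + lam ^ 2 * (-(v s.1 * v s.2) * c ^ 2 - (((v s.1 - v s.2) * (t * c)) ^ 2
          - (-(v s.1 * t ^ 2 + v s.2 * c ^ 2)) ^ 2) / 2)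
      + g₁ * (lam * (-(v s.1 * t ^ 2 + v s.2 * c ^ 2)) + lam ^ 2 * (v s.1 * v s.2 * (t * c) + ε
          - (v s.1 - v s.2) * (t * c) * (-(v s.1 * t ^ 2 + v s.2 * c ^ 2))))
      + g₂ / 2 * (lam ^ 2 * (-(v s.1 * t ^ 2 + v s.2 * c ^ 2)) ^ 2) with hBk
  have hpt (s : S × S) : |(Real.log ‖act (pairStep v ε lam s) z‖
      + G (act (pairStep v ε lam s) z).arg) - (Real.log ‖z‖ + G θ) - Bk s| ≤ C * |lam| ^ 3 := by
    have hx := hB s.2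
    have hy := hB s.1
    have habs (a b : ℝ) : ‖(⟨a, b⟩ : ℂ)‖ ≤ |a| + |b| := Complex.norm_le_abs_re_add_abs_im _
    have hxy : |v s.1 * v s.2| ≤ B ^ 2 := by
      rw [abs_mul, pow_two]; gcongr
    have hε := abs_nonneg ε
    have hp1 : 0 ≤ |ε| * B := by positivity
    have hp2 : 0 ≤ ε ^ 2 := sq_nonneg ε
    have hp3 : 0 ≤ B ^ 2 := sq_nonneg B
    set z₁ : ℂ := ⟨(v s.1 - v s.2) * (t * c), -(v s.1 * t ^ 2 + v s.2 * c ^ 2)⟩ with hz₁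
    set z₂ : ℂ := ⟨-(v s.1 * v s.2) * c ^ 2, v s.1 * v s.2 * (t * c) + ε⟩ with hz₂
    set z₃ : ℂ := ⟨(ε * (v s.1 + v s.2) - lam * ε ^ 2) * c ^ 2,
      -((ε * (v s.1 + v s.2) - lam * ε ^ 2) * (t * c))⟩ with hz₃
    have n1 : ‖z₁‖ ≤ K := by
      refine (habs _ _).trans ?_
      have a1 : |(v s.1 - v s.2) * (t * c)| ≤ (B + B) * 1 := by
        rw [abs_mul]
        gcongr
        exact (abs_sub _ _).trans (add_le_add hy hx)
      have a2 : |-(v s.1 * t ^ 2 + v s.2 * c ^ 2)| ≤ B * 1 + B * 1 := by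
        rw [abs_neg]
        refine (abs_add_le _ _).trans ?_
        rw [abs_mul, abs_mul, abs_of_nonneg (sq_nonneg t), abs_of_nonneg (sq_nonneg c)]
        gcongr
      rw [hK]; linarith
    have n2 : ‖z₂‖ ≤ K := by
      refine (habs _ _).trans ?_
      have a1 : |-(v s.1 * v s.2) * c ^ 2| ≤ B ^ 2 * 1 := by
        rw [abs_mul, abs_neg, abs_of_nonneg (sq_nonneg c)]; gcongr
      have a2 : |v s.1 * v s.2 * (t * c) + ε| ≤ B ^ 2 * 1 + |ε| := by
        refine (abs_add_le _ _).trans ?_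
        rw [abs_mul]
        gcongr
      rw [hK]; linarith
    have n3 : ‖z₃‖ ≤ K := by
      refine (habs _ _).trans ?_
      have a0 : |ε * (v s.1 + v s.2) - lam * ε ^ 2| ≤ |ε| * (B + B) + 1 * ε ^ 2 := by
        refine (abs_sub _ _).trans ?_
        rw [abs_mul, abs_mul, abs_of_nonneg (sq_nonneg ε)]
        gcongr
        exact (abs_add_le _ _).trans (add_le_add hy hx)
      have a1 : |(ε * (v s.1 + v s.2) - lam * ε ^ 2) * c ^ 2|
          ≤ (|ε| * (B + B) + 1 * ε ^ 2) * 1 := by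
        rw [abs_mul, abs_of_nonneg (sq_nonneg c)]; gcongr
      have a2 : |-((ε * (v s.1 + v s.2) - lam * ε ^ 2) * (t * c))|
          ≤ (|ε| * (B + B) + 1 * ε ^ 2) * 1 := by
        rw [abs_neg, abs_mul]; gcongr
      rw [hK]; linarith
    have hu := (norm_log_one_add_sub_le n1 n2 n3 hlam1 hlamK).1
    have hact := act_pairStep (v := v) (ε := ε) (lam := lam) s z
    rw [← hθ, ← hc, ← ht, ← hz₁, ← hz₂, ← hz₃] at hact
    set u : ℂ := lam * z₁ + lam ^ 2 * z₂ + lam ^ 3 * z₃ with hu_def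
    have hu1 : 1 + u ≠ 0 := by
      intro h0
      have : u = -1 := by linear_combination h0
      rw [this] at hu
      norm_num at hu
    have h := hC lam z₁ z₂ z₃ hlam1 hlamK n1 n2 n3 G θ g₁ g₂ (hG'.abs_le₁ θ) (hG'.abs_le₂ θ)
      (hG'.taylor θ) (Complex.log (1 + u)) rfl
    rw [hact, periodic_arg_mul hG.periodic hz hu1, norm_mul,
      Real.log_mul (norm_ne_zero_iff.2 hz) (norm_ne_zero_iff.2 hu1)]
    rw [Complex.log_re, Complex.log_im] at h
    have e : Real.log ‖z‖ + Real.log ‖1 + u‖ + G (z.arg + (1 + u).arg) - (Real.log ‖z‖ + G θ) - Bk s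
        = Real.log ‖1 + u‖ + (G (θ + (1 + u).arg) - G θ) - Bk s := by rw [← hθ]; ring
    rw [e]
    exact h
  -- As a quadratic polynomial in two independent letters, the main term has a mean that involves
  -- the first two moments only.
  have hquad (s : S × S) : Bk s =
      g₁ * lam ^ 2 * ε
      + (lam * (t * c) - g₁ * lam * t ^ 2) * v s.1
      + (-(lam * (t * c)) - g₁ * lam * c ^ 2) * v s.2
      + (lam ^ 2 * (-c ^ 2 + (t * c) ^ 2 + (t * c) ^ 2)
          + g₁ * lam ^ 2 * (t * c + t * c * (c ^ 2 - t ^ 2)) + g₂ * lam ^ 2 * (t * c) ^ 2)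
          * (v s.1 * v s.2)
      + (lam ^ 2 * (-(t * c) ^ 2 + t ^ 4) / 2 + g₁ * lam ^ 2 * (t * c * t ^ 2)
          + g₂ / 2 * lam ^ 2 * t ^ 4) * v s.1 ^ 2
      + (lam ^ 2 * (-(t * c) ^ 2 + c ^ 4) / 2 - g₁ * lam ^ 2 * (t * c * c ^ 2)
          + g₂ / 2 * lam ^ 2 * c ^ 4) * v s.2 ^ 2 := by
    rw [hBk]
    ring
  obtain ⟨hqi, hqe⟩ := integrable_and_integral_quadratic μ h1i h2i
    (g₁ * lam ^ 2 * ε) (lam * (t * c) - g₁ * lam * t ^ 2) (-(lam * (t * c)) - g₁ * lam * c ^ 2)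
    (lam ^ 2 * (-c ^ 2 + (t * c) ^ 2 + (t * c) ^ 2)
          + g₁ * lam ^ 2 * (t * c + t * c * (c ^ 2 - t ^ 2)) + g₂ * lam ^ 2 * (t * c) ^ 2)
    (lam ^ 2 * (-(t * c) ^ 2 + t ^ 4) / 2 + g₁ * lam ^ 2 * (t * c * t ^ 2)
          + g₂ / 2 * lam ^ 2 * t ^ 4)
    (lam ^ 2 * (-(t * c) ^ 2 + c ^ 4) / 2 - g₁ * lam ^ 2 * (t * c * c ^ 2)
          + g₂ / 2 * lam ^ 2 * c ^ 4)
  simp only [← hquad] at hqi hqe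
  have hBint : ∫ s, Bk s ∂(μ.prod μ)
      = driftExpansion (∫ s, v s ∂μ) (∫ s, v s ^ 2 ∂μ) ε lam g₁ g₂ θ := by
    rw [hqe, driftExpansion, ← hc, ← ht]
    ring
  have hUm : Measurable fun z : ℂ => Real.log ‖z‖ + G z.arg :=
    (Real.measurable_log.comp measurable_norm).add (hG.measurable.comp Complex.measurable_arg)
  have hUi := hstep.integrable_comp (μ.prod μ) hUm (C := K₀)
    (fun w _ => by simpa using hG.abs_le w.arg) hz
  have hfin := abs_integral_le_of_abs_le (μ.prod μ) hpt
  have hUi' : Integrable (fun s => (Real.log ‖act (pairStep v ε lam s) z‖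
      + G (act (pairStep v ε lam s) z).arg) - (Real.log ‖z‖ + G θ)) (μ.prod μ) :=
    hUi.sub (integrable_const _)
  rw [integral_sub hUi' hqi, integral_sub hUi (integrable_const _),
    hBint] at hfin
  simpa using hfin

end Expansion

theorem isPhaseFunction_of_hasDerivAt {G G₁ G₂ G₃ : ℝ → ℝ} {K : ℝ}
    (hper : Function.Periodic G (2 * Real.pi)) (h1 : ∀ t, HasDerivAt G (G₁ t) t)
    (h2 : ∀ t, HasDerivAt G₁ (G₂ t) t) (h3 : ∀ t, HasDerivAt G₂ (G₃ t) t)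
    (b0 : ∀ t, |G t| ≤ K) (b1 : ∀ t, |G₁ t| ≤ K) (b2 : ∀ t, |G₂ t| ≤ K) (b3 : ∀ t, |G₃ t| ≤ K) :
    IsPhaseFunction G G₁ G₂ K where
  periodic := hper
  measurable := (continuous_iff_continuousAt.2 fun t => (h1 t).continuousAt).measurable
  abs_le := b0
  abs_le₁ := b1
  abs_le₂ := b2
  taylor := abs_taylor_two_le h1 h2 h3 b3

theorem hasDerivAt_sin_mul (k t : ℝ) :
    HasDerivAt (fun t => Real.sin (k * t)) (k * Real.cos (k * t)) t := by
  have := ((hasDerivAt_id' t).const_mul k).sin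
  simpa [mul_comm] using this

theorem hasDerivAt_cos_mul (k t : ℝ) :
    HasDerivAt (fun t => Real.cos (k * t)) (-(k * Real.sin (k * t))) t := by
  have := ((hasDerivAt_id' t).const_mul k).cos
  simpa [mul_comm] using this

/-- Bounds the coefficient of λ³ that remains in the drift when the corrector is of size λ. -/
theorem abs_drift_remainder_le {s c g₁ g₂ m m₂ ε V K : ℝ} (hcs : s ^ 2 + c ^ 2 = 1) (hV : 0 ≤ V)
    (hm₂ : 0 ≤ m₂) (hg₁ : |g₁| ≤ K) (hg₂ : |g₂| ≤ K) :
    |g₁ * (m ^ 2 * (s * c) + ε + s * c * V * (s ^ 2 - c ^ 2))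
      + g₂ / 2 * (m₂ * (s ^ 4 + c ^ 4) + 2 * m ^ 2 * (s * c) ^ 2)|
      ≤ K * (m ^ 2 + |ε| + V) + K * (2 * m₂ + 2 * m ^ 2) := by
  have hs0 := sq_nonneg s
  have hc0 := sq_nonneg c
  have hs1 : s ^ 2 ≤ 1 := by linarith
  have hc1 : c ^ 2 ≤ 1 := by linarith
  have hsc1 : |s * c| ≤ 1 := by
    rw [abs_le]
    constructor <;> linarith [sq_nonneg (s + c), sq_nonneg (s - c), add_sq s c, sub_sq s c]
  have hsc2 : (s * c) ^ 2 ≤ 1 := by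
    rw [mul_pow]; exact mul_le_one₀ hs1 hc0 hc1
  have h44 : s ^ 4 + c ^ 4 ≤ 2 := by
    have h1 : s ^ 4 = s ^ 2 * s ^ 2 := by ring
    have h2 : c ^ 4 = c ^ 2 * c ^ 2 := by ring
    have h3 := mul_le_one₀ hs1 hs0 hs1
    have h4 := mul_le_one₀ hc1 hc0 hc1
    linarith
  have q1 : |m ^ 2 * (s * c) + ε + s * c * V * (s ^ 2 - c ^ 2)| ≤ m ^ 2 + |ε| + V := by
    have h4 : |s ^ 2 - c ^ 2| ≤ 1 := by rw [abs_le]; constructor <;> linarith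
    have h5 : |s * c * V * (s ^ 2 - c ^ 2)| ≤ 1 * V * 1 := by
      rw [abs_mul, abs_mul (s * c) V, abs_of_nonneg hV]; gcongr
    have h6 : |m ^ 2 * (s * c)| ≤ m ^ 2 * 1 := by
      rw [abs_mul, abs_of_nonneg (sq_nonneg m)]; gcongr
    refine (abs_add_three _ _ _).trans ?_
    linarith
  have q2 : |m₂ * (s ^ 4 + c ^ 4) + 2 * m ^ 2 * (s * c) ^ 2| ≤ 2 * m₂ + 2 * m ^ 2 := by
    rw [abs_of_nonneg (by positivity)]
    have h5 := mul_le_mul_of_nonneg_left h44 hm₂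
    have h6 := mul_le_mul_of_nonneg_left hsc2 (sq_nonneg m)
    linarith
  have q3 : |g₂ / 2| ≤ K := by
    rw [abs_div, abs_two]; linarith [abs_nonneg g₂]
  have hK0 : 0 ≤ K := (abs_nonneg _).trans hg₁
  refine (abs_add_le _ _).trans ?_
  rw [abs_mul, abs_mul]
  exact add_le_add (mul_le_mul hg₁ q1 (abs_nonneg _) hK0) (mul_le_mul q3 q2 (abs_nonneg _) hK0)

/-! ### Criterion for the asymptotics, and potentials of nonzero mean -/

section Asymptotic

variable {S : Type*} [MeasurableSpace S] (μ : Measure S) [IsProbabilityMeasure μ]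

/-- For small `lam` the Lyapunov exponent exists and equals `a * lam ^ 2` up to `O(lam ^ 3)`. -/
def LyapunovAsymptotic (v : S → ℝ) (ε a : ℝ) : Prop :=
  ∃ C l₀ : ℝ, 0 < l₀ ∧ ∀ lam : ℝ, |lam| ≤ l₀ →
    ∃ g, IsLyapunovExponent μ v ε lam g ∧ |g - a * lam ^ 2| ≤ C * |lam| ^ 3

theorem LyapunovAsymptotic.congr {v v' : S → ℝ} {ε a : ℝ} (h : LyapunovAsymptotic μ v ε a)
    (hv : v =ᵐ[μ] v') : LyapunovAsymptotic μ v' ε a := by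
  obtain ⟨C, l₀, hl₀, h⟩ := h
  refine ⟨C, l₀, hl₀, fun lam hlam => ?_⟩
  obtain ⟨g, hg, hle⟩ := h lam hlam
  refine ⟨g, fun θ => ?_, hle⟩
  simpa only [meanLogGrowth_congr μ hv] using hg θ

/-- For small λ the trace λx - ελ² is below 2 in absolute value, so the matrix is elliptic. -/
theorem lyapunovAsymptotic_of_const (x ε : ℝ) :
    LyapunovAsymptotic μ (fun _ : S => x) ε 0 := by
  refine ⟨0, min 1 (1 / (|x| + |ε| + 1)), by positivity, fun lam hlam => ⟨0, ?_, by simp⟩⟩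
  have h1 : |lam| ≤ 1 := hlam.trans (min_le_left _ _)
  have h2 : |lam| ≤ 1 / (|x| + |ε| + 1) := hlam.trans (min_le_right _ _)
  rw [le_div_iff₀ (by positivity)] at h2
  refine isLyapunovExponent_zero_of_const μ (t := lam * x - ε * lam ^ 2) ?_ fun _ => rfl
  refine lt_of_le_of_lt (abs_sub _ _) ?_
  rw [abs_mul, abs_mul, abs_pow]
  have h3 : |ε| * |lam| ^ 2 ≤ |ε| * |lam| := by
    gcongr
    nlinarith [abs_nonneg lam]
  nlinarith [abs_nonneg lam]

variable {v : S → ℝ}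

/-- A family of phase functions solving the averaged equation up to `O(lam ^ 3)` determines the
Lyapunov exponent up to `O(lam ^ 3)`. -/
theorem lyapunovAsymptotic_of_phaseFunction (hv : Measurable v) {B : ℝ} (hB0 : 0 ≤ B)
    (hB : ∀ s, |v s| ≤ B) (ε : ℝ) {a K C₁ : ℝ} (ha : 0 < a) (hK : 0 ≤ K) (G G₁ G₂ : ℝ → ℝ → ℝ)
    (hG : ∀ lam, |lam| ≤ 1 → IsPhaseFunction (G lam) (G₁ lam) (G₂ lam) K)
    (hdrift : ∀ lam, |lam| ≤ 1 → ∀ θ, |driftExpansion (∫ s, v s ∂μ) (∫ s, v s ^ 2 ∂μ) ε lam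
      (G₁ lam θ) (G₂ lam θ) θ - 2 * a * lam ^ 2| ≤ C₁ * |lam| ^ 3) :
    LyapunovAsymptotic μ v ε a := by
  obtain ⟨C₂, l₀, hl₀, hC₂⟩ := exists_drift_expansion μ hv hB0 hB ε K hK
  set C : ℝ := |C₁| + |C₂| with hC
  have hC0 : 0 ≤ C := by positivity
  -- The last threshold gives C|λ|³ < 2aλ² for λ ≠ 0: the error stays below the drift, which is thus
  -- positive.
  refine ⟨C, min (min 1 l₀) (a / (C + 1)), by positivity, fun lam hlam => ?_⟩
  have hlam1 : |lam| ≤ 1 := hlam.trans ((min_le_left _ _).trans (min_le_left _ _))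
  have hlam2 : |lam| ≤ l₀ := hlam.trans ((min_le_left _ _).trans (min_le_right _ _))
  have hlam3 : |lam| ≤ a / (C + 1) := hlam.trans (min_le_right _ _)
  rw [le_div_iff₀ (by positivity)] at hlam3
  -- At λ = 0 there is no positive drift; the transfer matrix is then a rotation by a right angle.
  by_cases h0 : lam = 0
  · subst h0
    refine ⟨0, ?_, by simp⟩
    exact isLyapunovExponent_zero_of_const μ (t := 0) (by simp) (by simp)
  have hpos : 0 < |lam| := abs_pos.2 h0
  have hsq : |lam| ^ 2 = lam ^ 2 := sq_abs lam
  have hP := hG lam hlam1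
  have hUm : Measurable fun z : ℂ => Real.log ‖z‖ + G lam z.arg :=
    (Real.measurable_log.comp measurable_norm).add (hP.measurable.comp Complex.measurable_arg)
  have hstep := isSLStep_transfer (ε := ε) (lam := lam) hv hB0 hB
  have he (z : ℂ) (hz : z ≠ 0) := hC₂ lam hlam2 _ _ _ hP z hz
  obtain ⟨g, hg, hgle⟩ := exists_isLyapunovExponent μ hstep hUm (C₀ := K)
    (c := 2 * a * lam ^ 2) (e := C * |lam| ^ 3) (fun z _ => by simpa using hP.abs_le z.arg)
    (fun z hz => by
      have h1 := he z hz
      have h2 := hdrift lam hlam1 z.arg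
      have h3 := (abs_le.1 (le_refl |C₁|)).2
      have h4 := (abs_le.1 (le_refl |C₂|)).2
      have h5 : C₁ * |lam| ^ 3 ≤ |C₁| * |lam| ^ 3 := by gcongr
      have h6 : C₂ * |lam| ^ 3 ≤ |C₂| * |lam| ^ 3 := by gcongr
      rw [hC, add_mul]
      rw [abs_le] at *
      constructor <;> linarith)
    (by
      rw [← hsq, pow_succ]
      have : 0 < |lam| ^ 2 := by positivity
      nlinarith)
  refine ⟨g, hg, ?_⟩
  have e : 2 * g - 2 * a * lam ^ 2 = 2 * (g - a * lam ^ 2) := by ring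
  rw [e, abs_mul, abs_two] at hgle
  have : 0 ≤ |g - a * lam ^ 2| := abs_nonneg _
  linarith

/-- The uncorrected drift is λ²(V/4 + (V/4) cos 4θ - (m²/2) cos 2θ). A corrector λΓ adds -λ²mΓ' at
this order, so Γ is a primitive of the oscillating part divided by m, and V/4 per pair remains. -/
theorem lyapunovAsymptotic_of_integral_ne_zero (hv : Measurable v) {B : ℝ} (hB0 : 0 ≤ B)
    (hB : ∀ s, |v s| ≤ B) (ε : ℝ) (hm : ∫ s, v s ∂μ ≠ 0)
    (hvar : 0 < (∫ s, v s ^ 2 ∂μ) - (∫ s, v s ∂μ) ^ 2) :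
    LyapunovAsymptotic μ v ε (1 / 8 * ((∫ s, v s ^ 2 ∂μ) - (∫ s, v s ∂μ) ^ 2)) := by
  set m := ∫ s, v s ∂μ with hmdef
  set m₂ := ∫ s, v s ^ 2 ∂μ with hm₂def
  set V := m₂ - m ^ 2 with hV
  have hm' : 0 < |m| := abs_pos.2 hm
  set K : ℝ := (2 * m ^ 2 + 4 * V) / |m| with hK
  have hK0 : 0 ≤ K := by positivity
  set Γ : ℝ → ℝ := fun t => (-(m ^ 2 / 4) * Real.sin (2 * t) + V / 16 * Real.sin (4 * t)) / m
  set Γ₁ : ℝ → ℝ := fun t => (-(m ^ 2 / 2) * Real.cos (2 * t) + V / 4 * Real.cos (4 * t)) / m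
    with hΓ₁
  set Γ₂ : ℝ → ℝ := fun t => (m ^ 2 * Real.sin (2 * t) - V * Real.sin (4 * t)) / m
  set Γ₃ : ℝ → ℝ := fun t => (2 * m ^ 2 * Real.cos (2 * t) - 4 * V * Real.cos (4 * t)) / m
  have d1 (t : ℝ) : HasDerivAt Γ (Γ₁ t) t := by
    refine ((((hasDerivAt_sin_mul 2 t).const_mul (-(m ^ 2 / 4))).fun_add
      ((hasDerivAt_sin_mul 4 t).const_mul (V / 16))).div_const m).congr_deriv ?_
    simp only [Γ₁]; ring
  have d2 (t : ℝ) : HasDerivAt Γ₁ (Γ₂ t) t := by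
    refine ((((hasDerivAt_cos_mul 2 t).const_mul (-(m ^ 2 / 2))).fun_add
      ((hasDerivAt_cos_mul 4 t).const_mul (V / 4))).div_const m).congr_deriv ?_
    simp only [Γ₂]; ring
  have d3 (t : ℝ) : HasDerivAt Γ₂ (Γ₃ t) t := by
    refine ((((hasDerivAt_sin_mul 2 t).const_mul (m ^ 2)).fun_sub
      ((hasDerivAt_sin_mul 4 t).const_mul V)).div_const m).congr_deriv ?_
    simp only [Γ₃]; ring
  have bd {p q x y : ℝ} (hp : |p| ≤ 2 * m ^ 2) (hq : |q| ≤ 4 * V) (hx : |x| ≤ 1) (hy : |y| ≤ 1) :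
      |(p * x + q * y) / m| ≤ K := by
    rw [abs_div, hK]
    gcongr
    refine (abs_add_le _ _).trans ?_
    rw [abs_mul, abs_mul]
    have h1 := mul_le_mul hp hx (abs_nonneg _) (by positivity)
    have h2 := mul_le_mul hq hy (abs_nonneg _) (by positivity)
    linarith
  have hm2 := sq_nonneg m
  have b0 (t : ℝ) : |Γ t| ≤ K :=
    bd (by rw [abs_le]; constructor <;> linarith) (by rw [abs_le]; constructor <;> linarith)
      (Real.abs_sin_le_one _) (Real.abs_sin_le_one _)
  have b1 (t : ℝ) : |Γ₁ t| ≤ K :=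
    bd (by rw [abs_le]; constructor <;> linarith) (by rw [abs_le]; constructor <;> linarith)
      (Real.abs_cos_le_one _) (Real.abs_cos_le_one _)
  have b2 (t : ℝ) : |Γ₂ t| ≤ K := by
    have := bd (p := m ^ 2) (q := -V) (by rw [abs_le]; constructor <;> linarith)
      (by rw [abs_le]; constructor <;> linarith)
      (Real.abs_sin_le_one (2 * t)) (Real.abs_sin_le_one (4 * t))
    rwa [neg_mul, ← sub_eq_add_neg] at this
  have b3 (t : ℝ) : |Γ₃ t| ≤ K := by
    have := bd (p := 2 * m ^ 2) (q := -(4 * V)) (by rw [abs_le]; constructor <;> linarith)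
      (by rw [abs_le]; constructor <;> linarith)
      (Real.abs_cos_le_one (2 * t)) (Real.abs_cos_le_one (4 * t))
    rwa [neg_mul, ← sub_eq_add_neg] at this
  have hper : Function.Periodic Γ (2 * Real.pi) := by
    intro t
    have e1 : Real.sin (2 * (t + 2 * Real.pi)) = Real.sin (2 * t) := by
      have := Real.sin_add_nat_mul_two_pi (2 * t) 2
      rw [← this]; congr 1; push_cast; ring
    have e2 : Real.sin (4 * (t + 2 * Real.pi)) = Real.sin (4 * t) := by
      have := Real.sin_add_nat_mul_two_pi (4 * t) 4
      rw [← this]; congr 1; push_cast; ring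
    simp only [Γ, e1, e2]
  have scale {lam x : ℝ} (hl : |lam| ≤ 1) (hx : |x| ≤ K) : |lam * x| ≤ K := by
    rw [abs_mul]
    calc |lam| * |x| ≤ 1 * K := by gcongr
      _ = K := one_mul K
  apply lyapunovAsymptotic_of_phaseFunction μ hv hB0 hB ε (K := K)
    (C₁ := K * (m ^ 2 + |ε| + V) + K * (2 * m₂ + 2 * m ^ 2)) (by positivity) hK0
    (fun lam t => lam * Γ t) (fun lam t => lam * Γ₁ t) (fun lam t => lam * Γ₂ t)
  · intro lam hl
    exact isPhaseFunction_of_hasDerivAt (fun t => by simp only [hper t])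
      (fun t => (d1 t).const_mul lam) (fun t => (d2 t).const_mul lam)
      (fun t => (d3 t).const_mul lam) (fun t => scale hl (b0 t)) (fun t => scale hl (b1 t))
      (fun t => scale hl (b2 t)) (fun t => scale hl (b3 t))
  · intro lam hl θ
    have hcs := Real.sin_sq_add_cos_sq θ
    have hc2 : Real.cos (2 * θ) = 2 * Real.cos θ ^ 2 - 1 := Real.cos_two_mul θ
    have hc4 : Real.cos (4 * θ) = 2 * (2 * Real.cos θ ^ 2 - 1) ^ 2 - 1 := by
      rw [show 4 * θ = 2 * (2 * θ) by ring, Real.cos_two_mul, hc2]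
    have hmΓ : m * Γ₁ θ = -(m ^ 2 / 2) * Real.cos (2 * θ) + V / 4 * Real.cos (4 * θ) := by
      simp only [hΓ₁]; field_simp
    rw [hc2, hc4] at hmΓ
    set c := Real.cos θ with hc
    set s := Real.sin θ with hs
    have hs2 : s ^ 2 = 1 - c ^ 2 := by linarith
    have hs4 : s ^ 4 = (1 - c ^ 2) ^ 2 := by rw [← hs2]; ring
    have hsc : (s * c) ^ 2 = (1 - c ^ 2) * c ^ 2 := by rw [mul_pow, hs2]
    have key : driftExpansion m m₂ ε lam (lam * Γ₁ θ) (lam * Γ₂ θ) θ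
        - 2 * (1 / 8 * V) * lam ^ 2
        = lam ^ 3 * (Γ₁ θ * (m ^ 2 * (s * c) + ε + s * c * V * (s ^ 2 - c ^ 2))
          + Γ₂ θ / 2 * (m₂ * (s ^ 4 + c ^ 4) + 2 * m ^ 2 * (s * c) ^ 2)) := by
      rw [driftExpansion, ← hc, ← hs, hs4, hsc, hs2]
      have hm₂V : m₂ = V + m ^ 2 := by rw [hV]; ring
      rw [hm₂V]
      linear_combination (-lam ^ 2) * hmΓ
    rw [key, abs_mul, abs_pow, mul_comm]
    gcongr
    exact abs_drift_remainder_le hcs hvar.le (by linarith [sq_nonneg m]) (b1 θ) (b2 θ)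

end Asymptotic

/-! ### Phase polynomials and their moments -/

/-- Pairing with w sends (x, y) to (x + iy)/√2, so the quotient is the image of e_θ divided by e_θ
in ℂ, and dividing means multiplying by the conjugate of e_θ. -/
theorem phasePoly_eq (A : Matrix (Fin 2) (Fin 2) ℝ) (θ : ℝ) :
    phasePoly A θ = (A 1 0 * Real.cos θ + A 1 1 * Real.sin θ) * Real.cos θ
      - (A 0 0 * Real.cos θ + A 0 1 * Real.sin θ) * Real.sin θ := by
  have h2 : (Real.sqrt 2 : ℂ) ≠ 0 := by
    exact_mod_cast (Real.sqrt_pos.2 two_pos).ne'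
  set x := A 0 0 * Real.cos θ + A 0 1 * Real.sin θ with hx
  set y := A 1 0 * Real.cos θ + A 1 1 * Real.sin θ with hy
  have hne : (Real.cos θ + Real.sin θ * Complex.I : ℂ) ≠ 0 := by
    have := Complex.exp_ne_zero (θ * Complex.I)
    rwa [Complex.exp_mul_I, ← Complex.ofReal_cos, ← Complex.ofReal_sin] at this
  have hden : dotProduct (star circVec) (fun i => (unitVec θ i : ℂ))
      = (Real.cos θ + Real.sin θ * Complex.I : ℂ) / (Real.sqrt 2 : ℂ) := by
    simp [dotProduct, Fin.sum_univ_two, circVec, unitVec]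
    ring
  have hnum : dotProduct (star circVec) ((A.map Complex.ofReal).mulVec
      fun i => (unitVec θ i : ℂ)) = ((x : ℂ) + y * Complex.I) / (Real.sqrt 2 : ℂ) := by
    simp [dotProduct, Matrix.mulVec, Fin.sum_univ_two, circVec, unitVec, hx, hy]
    ring
  rw [phasePoly, hden, hnum, div_div_div_cancel_right₀ h2]
  have hcs : Real.cos θ ^ 2 + Real.sin θ ^ 2 = 1 := Real.cos_sq_add_sin_sq θ
  have hinv : ((x : ℂ) + y * Complex.I) / (Real.cos θ + Real.sin θ * Complex.I)
      = ((x : ℂ) + y * Complex.I) * (Real.cos θ - Real.sin θ * Complex.I) := by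
    rw [div_eq_iff hne]
    have hcs' : (Real.cos θ : ℂ) ^ 2 + (Real.sin θ : ℂ) ^ 2 = 1 := by exact_mod_cast hcs
    linear_combination (-((x : ℂ) + y * Complex.I)) * hcs'
      + ((x : ℂ) + y * Complex.I) * (Real.sin θ : ℂ) ^ 2 * Complex.I_sq
  rw [hinv]
  simp only [Complex.mul_im, Complex.add_re, Complex.add_im, Complex.sub_re, Complex.sub_im,
    Complex.mul_re, Complex.ofReal_re, Complex.ofReal_im, Complex.I_re, Complex.I_im]
  ring

section Moments

variable {S : Type*} [MeasurableSpace S] (μ : Measure S) [IsProbabilityMeasure μ] {v : S → ℝ}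

theorem meanPSq_eq (h1 : Integrable v μ) (h2 : Integrable (fun s => v s ^ 2) μ) (θ : ℝ) :
    meanPSq μ v θ = (∫ s, v s ^ 2 ∂μ) * (Real.sin θ ^ 4 + Real.cos θ ^ 4)
      + 2 * (∫ s, v s ∂μ) ^ 2 * (Real.sin θ * Real.cos θ) ^ 2 := by
  have h := (integrable_and_integral_quadratic μ h1 h2 0 0 0
    (2 * (Real.sin θ * Real.cos θ) ^ 2) (Real.sin θ ^ 4) (Real.cos θ ^ 4)).2
  rw [meanPSq]
  convert h using 1
  · congr 1
    funext s
    rw [phasePoly_eq]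
    simp [pairP]
    ring
  · ring

theorem meanQ_eq (h1 : Integrable v μ) (h2 : Integrable (fun s => v s ^ 2) μ) (ε θ : ℝ) :
    meanQ μ v ε θ = ε + (∫ s, v s ∂μ) ^ 2 * (Real.sin θ * Real.cos θ) := by
  have h := (integrable_and_integral_quadratic μ h1 h2 ε 0 0
    (Real.sin θ * Real.cos θ) 0 0).2
  rw [meanQ]
  convert h using 1
  · congr 1
    funext s
    rw [phasePoly_eq]
    simp [pairQ]
    linear_combination ε * Real.cos_sq_add_sin_sq θ
  · ring

end Moments

/-- The mean squared phase velocity of a centered potential of variance `V`. -/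
def phaseVar (V θ : ℝ) : ℝ := V * (Real.sin θ ^ 4 + Real.cos θ ^ 4)

/-- The second order coefficient of the mean logarithmic growth of the modulus in two steps, for a
centered potential of variance `V`. -/
def modulusGrowth (V θ : ℝ) : ℝ :=
  V / 2 * (Real.sin θ ^ 4 + Real.cos θ ^ 4) - V * (Real.sin θ * Real.cos θ) ^ 2

theorem phaseVar_eq (V θ : ℝ) : phaseVar V θ = V / 2 * (1 + Real.cos (2 * θ) ^ 2) := by
  have h := Real.sin_sq_add_cos_sq θ
  have hs : Real.sin θ ^ 4 = (1 - Real.cos θ ^ 2) ^ 2 := by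
    rw [← Real.sin_sq]; ring
  rw [phaseVar, Real.cos_two_mul, hs]
  ring

theorem modulusGrowth_eq (V θ : ℝ) : modulusGrowth V θ = V / 4 * (1 + Real.cos (4 * θ)) := by
  have hs : Real.sin θ ^ 4 = (1 - Real.cos θ ^ 2) ^ 2 := by
    rw [← Real.sin_sq]; ring
  rw [modulusGrowth, show 4 * θ = 2 * (2 * θ) by ring, Real.cos_two_mul, Real.cos_two_mul, hs,
    mul_pow, Real.sin_sq]
  ring

theorem phaseVar_pos {V : ℝ} (hV : 0 < V) (θ : ℝ) : 0 < phaseVar V θ := by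
  rw [phaseVar_eq]; positivity

theorem continuous_phaseVar (V : ℝ) : Continuous (phaseVar V) := by
  unfold phaseVar; fun_prop

theorem continuous_modulusGrowth (V : ℝ) : Continuous (modulusGrowth V) := by
  unfold modulusGrowth; fun_prop

theorem periodic_phaseVar (V : ℝ) : Function.Periodic (phaseVar V) (2 * Real.pi) := by
  intro θ; simp [phaseVar]

theorem periodic_modulusGrowth (V : ℝ) : Function.Periodic (modulusGrowth V) (2 * Real.pi) := by
  intro θ; simp [modulusGrowth]

theorem hasDerivAt_phaseVar (V θ : ℝ) : HasDerivAt (phaseVar V)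
    (4 * V * (Real.sin θ * Real.cos θ * (Real.sin θ ^ 2 - Real.cos θ ^ 2))) θ := by
  refine ((((Real.hasDerivAt_sin θ).fun_pow 4).fun_add
    ((Real.hasDerivAt_cos θ).fun_pow 4)).const_mul V).congr_deriv ?_
  push_cast; ring

theorem hasDerivAt_deriv_phaseVar (V θ : ℝ) : HasDerivAt
    (fun θ => 4 * V * (Real.sin θ * Real.cos θ * (Real.sin θ ^ 2 - Real.cos θ ^ 2)))
    (4 * V * (6 * (Real.sin θ * Real.cos θ) ^ 2 - Real.sin θ ^ 4 - Real.cos θ ^ 4)) θ := by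
  refine ((((Real.hasDerivAt_sin θ).fun_mul (Real.hasDerivAt_cos θ)).fun_mul
    (((Real.hasDerivAt_sin θ).fun_pow 2).fun_sub
      ((Real.hasDerivAt_cos θ).fun_pow 2))).const_mul (4 * V)).congr_deriv ?_
  push_cast; ring

theorem hasDerivAt_modulusGrowth (V θ : ℝ) : HasDerivAt (modulusGrowth V)
    (4 * V * (Real.sin θ * Real.cos θ * (Real.sin θ ^ 2 - Real.cos θ ^ 2))) θ := by
  refine (((((Real.hasDerivAt_sin θ).fun_pow 4).fun_add
    ((Real.hasDerivAt_cos θ).fun_pow 4)).const_mul (V / 2)).fun_sub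
    ((((Real.hasDerivAt_sin θ).fun_mul (Real.hasDerivAt_cos θ)).fun_pow 2).const_mul V)).congr_deriv
    ?_
  push_cast; ring

/-! ### The density for centered potentials -/

section Density

variable {S : Type*} [MeasurableSpace S] (μ : Measure S) (v : S → ℝ) (ε V : ℝ)

/-- The first two moments of the pair coefficients for a centered potential of variance `V > 0`. -/
structure IsCenteredPair : Prop where
  pos : 0 < V
  meanPSq_eq : ∀ θ, meanPSq μ v θ = phaseVar V θ
  meanQ_eq : ∀ θ, meanQ μ v ε θ = ε

variable {μ v ε V}

/-- The inverse square root of the mean squared phase velocity. -/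
def invSqrtVar (V θ : ℝ) : ℝ := (Real.sqrt (phaseVar V θ))⁻¹

theorem invSqrtVar_pos (hV : 0 < V) (θ : ℝ) : 0 < invSqrtVar V θ :=
  inv_pos.2 (Real.sqrt_pos.2 (phaseVar_pos hV θ))

theorem continuous_invSqrtVar (hV : 0 < V) : Continuous (invSqrtVar V) :=
  (continuous_phaseVar V).sqrt.inv₀ fun θ => (Real.sqrt_pos.2 (phaseVar_pos hV θ)).ne'

theorem invSqrtVar_sq (hV : 0 < V) (θ : ℝ) : invSqrtVar V θ ^ 2 = (phaseVar V θ)⁻¹ := by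
  rw [invSqrtVar, inv_pow, Real.sq_sqrt (phaseVar_pos hV θ).le]

theorem periodic_invSqrtVar (V : ℝ) : Function.Periodic (invSqrtVar V) (2 * Real.pi) := by
  intro θ; simp only [invSqrtVar, periodic_phaseVar V θ]

theorem hasDerivAt_invSqrtVar (hV : 0 < V) (θ : ℝ) : HasDerivAt (invSqrtVar V)
    (-(4 * V * (Real.sin θ * Real.cos θ * (Real.sin θ ^ 2 - Real.cos θ ^ 2))
      / (2 * phaseVar V θ)) * invSqrtVar V θ) θ := by
  have hp := phaseVar_pos hV θ
  have hs := Real.sqrt_pos.2 hp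
  refine (((hasDerivAt_phaseVar V θ).sqrt hp.ne').fun_inv hs.ne').congr_deriv ?_
  rw [invSqrtVar, Real.sq_sqrt hp.le]
  field_simp

theorem hasDerivAt_integral_of_continuous {f : ℝ → ℝ} (hf : Continuous f) (θ : ℝ) :
    HasDerivAt (fun θ => ∫ t in (0 : ℝ)..θ, f t) (f θ) θ :=
  (hf.integral_hasStrictDerivAt 0 θ).hasDerivAt

namespace IsCenteredPair

variable (h : IsCenteredPair μ v ε V)
include h

theorem hasDerivAt_kappa (θ : ℝ) : HasDerivAt (kappa μ v ε) (2 * ε / phaseVar V θ) θ := by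
  have e : kappa μ v ε = fun θ => ∫ t in (0 : ℝ)..θ, 2 * ε / phaseVar V t := by
    funext θ; simp only [kappa, h.meanPSq_eq, h.meanQ_eq]
  rw [e]
  exact hasDerivAt_integral_of_continuous
    (continuous_const.div (continuous_phaseVar V) fun t => (phaseVar_pos h.pos t).ne') θ

theorem continuous_kappa : Continuous (kappa μ v ε) :=
  continuous_iff_continuousAt.2 fun θ => (h.hasDerivAt_kappa θ).continuousAt

theorem hasDerivAt_bigK (θ : ℝ) : HasDerivAt (bigK μ v ε)
    (2 * invSqrtVar V θ * Real.exp (-kappa μ v ε θ)) θ := by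
  have e : bigK μ v ε = fun θ => ∫ t in (0 : ℝ)..θ,
      2 * invSqrtVar V t * Real.exp (-kappa μ v ε t) := by
    funext θ
    simp only [bigK, h.meanPSq_eq]
    congr 1
    funext t
    rw [Real.rpow_neg (phaseVar_pos h.pos t).le, ← Real.sqrt_eq_rpow, invSqrtVar]
  rw [e]
  have hκ := h.continuous_kappa
  have hr := continuous_invSqrtVar h.pos
  exact hasDerivAt_integral_of_continuous (by fun_prop) θ

theorem continuous_bigK : Continuous (bigK μ v ε) :=
  continuous_iff_continuousAt.2 fun θ => (h.hasDerivAt_bigK θ).continuousAt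

theorem strictMono_bigK : StrictMono (bigK μ v ε) := by
  apply strictMono_of_deriv_pos
  intro θ
  rw [(h.hasDerivAt_bigK θ).deriv]
  have := invSqrtVar_pos h.pos θ
  positivity

omit h in
theorem bigK_zero : bigK μ v ε 0 = 0 := by simp [bigK]

theorem bigK_two_pi_pos : 0 < bigK μ v ε (2 * Real.pi) := by
  have := h.strictMono_bigK (show (0 : ℝ) < 2 * Real.pi by positivity)
  rwa [bigK_zero] at this

theorem preDensity_eq (θ : ℝ) : preDensity μ v ε θ
    = invSqrtVar V θ * Real.exp (kappa μ v ε θ)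
      * (constC μ v ε * bigK μ v ε θ + 1) := by
  rw [preDensity, h.meanPSq_eq, invSqrtVar]
  ring

theorem continuous_preDensity : Continuous (preDensity μ v ε) := by
  have e : preDensity μ v ε = _ := funext h.preDensity_eq
  rw [e]
  have h1 := h.continuous_kappa
  have h2 := continuous_invSqrtVar h.pos
  have h3 := h.continuous_bigK
  fun_prop

theorem constC_mul_bigK : constC μ v ε * bigK μ v ε (2 * Real.pi)
    = Real.exp (-kappa μ v ε (2 * Real.pi)) - 1 := by
  rw [constC, div_mul_cancel₀ _ h.bigK_two_pi_pos.ne']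

/-- On [0, 2π] the increasing function `bigK` runs from 0 to K(2π), so C·K + 1 lies between 1 and
exp(-κ(2π)), both positive. -/
theorem preDensity_pos {θ : ℝ} (hθ : θ ∈ Set.Icc 0 (2 * Real.pi)) : 0 < preDensity μ v ε θ := by
  have hK := h.bigK_two_pi_pos
  have h0 : 0 ≤ bigK μ v ε θ := by
    rw [← bigK_zero (μ := μ) (v := v) (ε := ε)]; exact h.strictMono_bigK.monotone hθ.1
  have h1 : bigK μ v ε θ ≤ bigK μ v ε (2 * Real.pi) := h.strictMono_bigK.monotone hθ.2
  have hC := h.constC_mul_bigK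
  have hexp := Real.exp_pos (-kappa μ v ε (2 * Real.pi))
  have hpos : 0 < constC μ v ε * bigK μ v ε θ + 1 := by
    rcases le_or_gt 0 (constC μ v ε) with hc | hc
    · positivity
    · have := mul_le_mul_of_nonpos_left h1 hc.le
      linarith
  rw [h.preDensity_eq]
  have := invSqrtVar_pos h.pos θ
  positivity

theorem integral_preDensity_pos : 0 < ∫ θ in (0 : ℝ)..(2 * Real.pi), preDensity μ v ε θ := by
  have hpi : (0 : ℝ) < 2 * Real.pi := by positivity
  exact intervalIntegral.integral_pos hpi h.continuous_preDensity.continuousOn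
    (fun θ hθ => (h.preDensity_pos ⟨hθ.1.le, hθ.2⟩).le)
    ⟨0, ⟨le_rfl, hpi.le⟩, h.preDensity_pos ⟨le_rfl, hpi.le⟩⟩

end IsCenteredPair

end Density

/-! ### Periodic solution of the averaged equation -/

theorem periodic_of_hasDerivAt {f f' : ℝ → ℝ} {T : ℝ} (hf : Function.Periodic f T)
    (hd : ∀ t, HasDerivAt f (f' t) t) : Function.Periodic f' T := by
  intro t
  have h1 := (hd (t + T)).comp_add_const t T
  rw [show (fun x => f (x + T)) = f from funext hf] at h1
  exact h1.unique (hd t)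

theorem exists_abs_le_of_periodic {f : ℝ → ℝ} {T : ℝ} (hf : Function.Periodic f T) (hT : T ≠ 0)
    (hc : Continuous f) : ∃ K, ∀ t, |f t| ≤ K := by
  obtain ⟨K, hK⟩ := (isBounded_iff_forall_norm_le).1 (hf.isBounded_of_continuous hT hc)
  exact ⟨K, fun t => hK _ ⟨t, rfl⟩⟩

section Density

variable {S : Type*} [MeasurableSpace S] {μ : Measure S} {v : S → ℝ} {ε V : ℝ}

namespace IsCenteredPair

variable (h : IsCenteredPair μ v ε V)
include h

/-- The averaged equation `a G'' / 2 + (ε + a' / 4) G' = -(Φ - c₀)`, where `Φ` is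
`modulusGrowth V` and `c₀` its mean in the density `preDensity`, has a `2π`-periodic
solution `G`. -/
theorem exists_phaseFunction : ∃ (G G₁ G₂ : ℝ → ℝ) (K : ℝ), IsPhaseFunction G G₁ G₂ K ∧ ∀ θ,
    modulusGrowth V θ
      + G₁ θ * (ε + Real.sin θ * Real.cos θ * V * (Real.sin θ ^ 2 - Real.cos θ ^ 2))
      + G₂ θ / 2 * phaseVar V θ
    = (∫ t in (0 : ℝ)..(2 * Real.pi), preDensity μ v ε t * modulusGrowth V t)
      / ∫ t in (0 : ℝ)..(2 * Real.pi), preDensity μ v ε t := by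
  have hpi : (2 * Real.pi : ℝ) ≠ 0 := by positivity
  set c₀ := (∫ t in (0 : ℝ)..(2 * Real.pi), preDensity μ v ε t * modulusGrowth V t)
      / ∫ t in (0 : ℝ)..(2 * Real.pi), preDensity μ v ε t with hc₀
  set κ := kappa μ v ε with hκ
  set K := bigK μ v ε with hK
  set C := constC μ v ε with hC
  set r := invSqrtVar V with hr
  set Φ : ℝ → ℝ := fun t => modulusGrowth V t - c₀ with hΦ
  have κc : Continuous κ := h.continuous_kappa
  have Kc : Continuous K := h.continuous_bigK
  have rc : Continuous r := continuous_invSqrtVar h.pos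
  have ac : Continuous (phaseVar V) := continuous_phaseVar V
  have mc : Continuous (modulusGrowth V) := continuous_modulusGrowth V
  have Φc : Continuous Φ := mc.sub continuous_const
  have ρc : Continuous (preDensity μ v ε) := h.continuous_preDensity
  have apos := phaseVar_pos h.pos
  have K0 : K 0 = 0 := bigK_zero
  have Kpos : 0 < K (2 * Real.pi) := h.bigK_two_pi_pos
  set F : ℝ → ℝ := fun t => r t * Real.exp (κ t) * Φ t with hF
  have Fc : Continuous F := by fun_prop
  set I : ℝ → ℝ := fun θ => ∫ t in (0 : ℝ)..θ, F t with hI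
  have dI (θ : ℝ) : HasDerivAt I (F θ) θ := hasDerivAt_integral_of_continuous Fc θ
  have Ic : Continuous I := continuous_iff_continuousAt.2 fun θ => (dI θ).continuousAt
  have I0 : I 0 = 0 := by simp [hI]
  set J : ℝ := ∫ t in (0 : ℝ)..(2 * Real.pi), K t * F t with hJ
  -- Solvability condition: c₀ makes Φ have mean zero in the density, and the density splits as the
  -- C·K part plus the constant 1.
  have hCJ : C * J + I (2 * Real.pi) = 0 := by
    have h1 : ∫ t in (0 : ℝ)..(2 * Real.pi), preDensity μ v ε t * Φ t = 0 := by
      have e : ∀ t, preDensity μ v ε t * Φ t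
          = preDensity μ v ε t * modulusGrowth V t - c₀ * preDensity μ v ε t := by
        intro t; simp only [hΦ]; ring
      simp only [e]
      rw [intervalIntegral.integral_sub
        ((by fun_prop : Continuous fun t => preDensity μ v ε t * modulusGrowth V t).intervalIntegrable
          _ _)
        ((by fun_prop : Continuous fun t => c₀ * preDensity μ v ε t).intervalIntegrable _ _),
        intervalIntegral.integral_const_mul, hc₀, div_mul_cancel₀ _ h.integral_preDensity_pos.ne', sub_self]
    have e : ∀ t, preDensity μ v ε t * Φ t = C * (K t * F t) + F t := by
      intro t; rw [h.preDensity_eq]; simp only [hF]; ring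
    simp only [e] at h1
    rw [intervalIntegral.integral_add
      ((by fun_prop : Continuous fun t => C * (K t * F t)).intervalIntegrable _ _)
      (Fc.intervalIntegrable _ _), intervalIntegral.integral_const_mul] at h1
    exact h1
  -- The one free constant is spent on making G₁ have integral zero over a period, so that its
  -- primitive G is periodic. Periodicity of w is then not a further choice: it follows from the
  -- solvability condition.
  set w₀ : ℝ := 2 / K (2 * Real.pi) * (K (2 * Real.pi) * I (2 * Real.pi) - J) with hw₀
  -- Variation of constants: the factor r = a^(-1/2) in G₁ = r·w absorbs the a' term, and exp(-κ)
  -- solves the remaining homogeneous equation.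
  set w : ℝ → ℝ := fun t => Real.exp (-κ t) * (w₀ - 2 * I t) with hw
  have dw (θ : ℝ) : HasDerivAt w (-(2 * ε / phaseVar V θ) * w θ - 2 * r θ * Φ θ) θ := by
    refine (((h.hasDerivAt_kappa θ).fun_neg.exp).fun_mul
      (((dI θ).const_mul 2).const_sub w₀)).congr_deriv ?_
    have e : Real.exp (-κ θ) * Real.exp (κ θ) = 1 := by rw [← Real.exp_add]; simp
    simp only [hw, hF]
    linear_combination (-(2 * r θ * Φ θ)) * e
  have w2pi : w (2 * Real.pi) = w 0 := by
    have κ0 : κ 0 = 0 := by simp [hκ, kappa]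
    have hCK : C * K (2 * Real.pi) = Real.exp (-κ (2 * Real.pi)) - 1 := h.constC_mul_bigK
    simp only [hw, I0, κ0, neg_zero, Real.exp_zero]
    have hE : Real.exp (-κ (2 * Real.pi)) = C * K (2 * Real.pi) + 1 := by linarith
    rw [hE, hw₀]
    field_simp
    linear_combination (-K (2 * Real.pi)) * hCJ
  have wper : Function.Periodic w (2 * Real.pi) := by
    -- κ need not be periodic, so the formula does not show periodicity. The difference of w and its
    -- translate solves the homogeneous equation, hence is a multiple of exp(-κ), and it vanishes at
    -- 0.
    set T : ℝ := 2 * Real.pi with hT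
    set E : ℝ → ℝ := fun t => Real.exp (κ t) * (w (t + T) - w t) with hE
    have dE (θ : ℝ) : HasDerivAt E 0 θ := by
      have d1 := (dw (θ + T)).comp_add_const θ T
      refine ((h.hasDerivAt_kappa θ).exp.fun_mul (d1.fun_sub (dw θ))).congr_deriv ?_
      have hrT : r (θ + T) = r θ := periodic_invSqrtVar V θ
      rw [periodic_phaseVar V θ, hrT]
      have : Φ (θ + T) = Φ θ := by simp only [hΦ, hT, periodic_modulusGrowth V θ]
      rw [this]
      ring
    intro t
    have h1 := is_const_of_deriv_eq_zero (fun θ => (dE θ).differentiableAt)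
      (fun θ => (dE θ).deriv) t 0
    simp only [hE, zero_add, w2pi, sub_self, mul_zero] at h1
    rcases mul_eq_zero.1 h1 with h2 | h2
    · exact absurd h2 (Real.exp_pos _).ne'
    · linarith
  have wc : Continuous w := continuous_iff_continuousAt.2 fun θ => (dw θ).continuousAt
  set G₁ : ℝ → ℝ := fun t => r t * w t with hG₁
  set a₁ : ℝ → ℝ := fun θ =>
    4 * V * (Real.sin θ * Real.cos θ * (Real.sin θ ^ 2 - Real.cos θ ^ 2)) with ha₁
  set a₂ : ℝ → ℝ := fun θ =>
    4 * V * (6 * (Real.sin θ * Real.cos θ) ^ 2 - Real.sin θ ^ 4 - Real.cos θ ^ 4) with ha₂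
  set G₂ : ℝ → ℝ := fun t => -((a₁ t / 2 + 2 * ε) * G₁ t + 2 * Φ t) / phaseVar V t with hG₂
  -- A third derivative, bounded by periodicity and continuity, is needed for the uniform Taylor
  -- remainder of G.
  set G₃ : ℝ → ℝ := fun t => (-(a₂ t / 2 * G₁ t + (a₁ t / 2 + 2 * ε) * G₂ t + 2 * a₁ t)
      * phaseVar V t - -((a₁ t / 2 + 2 * ε) * G₁ t + 2 * Φ t) * a₁ t) / phaseVar V t ^ 2 with hG₃
  set G : ℝ → ℝ := fun θ => ∫ t in (0 : ℝ)..θ, G₁ t with hG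
  have G₁c : Continuous G₁ := rc.mul wc
  have a₁c : Continuous a₁ := by fun_prop
  have a₂c : Continuous a₂ := by fun_prop
  have G₂c : Continuous G₂ := Continuous.div (by fun_prop) ac fun t => (apos t).ne'
  have G₃c : Continuous G₃ := Continuous.div (by fun_prop) (by fun_prop)
    fun t => pow_ne_zero 2 (apos t).ne'
  have d0 (θ : ℝ) : HasDerivAt G (G₁ θ) θ := hasDerivAt_integral_of_continuous G₁c θ
  have d1 (θ : ℝ) : HasDerivAt G₁ (G₂ θ) θ := by
    refine ((hasDerivAt_invSqrtVar h.pos θ).fun_mul (dw θ)).congr_deriv ?_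
    have e : r θ ^ 2 = (phaseVar V θ)⁻¹ := invSqrtVar_sq h.pos θ
    have e' : r θ * (2 * r θ * Φ θ) = 2 * Φ θ / phaseVar V θ := by
      rw [div_eq_mul_inv, ← e]; ring
    simp only [hG₂, hG₁, ha₁, ← hr]
    linear_combination -e'
  have d2 (θ : ℝ) : HasDerivAt G₂ (G₃ θ) θ := by
    exact ((((((hasDerivAt_deriv_phaseVar V θ).div_const 2).add_const (2 * ε)).fun_mul
      (d1 θ)).fun_add (((hasDerivAt_modulusGrowth V θ).sub_const c₀).const_mul 2)).fun_neg).fun_div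
      (hasDerivAt_phaseVar V θ) (apos θ).ne'
  have p1 : Function.Periodic G₁ (2 * Real.pi) := by
    intro t; simp only [hG₁, wper t, hr, periodic_invSqrtVar V t]
  have hG2pi : ∫ t in (0 : ℝ)..(2 * Real.pi), G₁ t = 0 := by
    have dK (t : ℝ) : HasDerivAt K (2 * r t * Real.exp (-κ t)) t := h.hasDerivAt_bigK t
    -- Integrating K'·I by parts produces K(2π)I(2π) - J, the quantity built into w₀.
    have parts := intervalIntegral.integral_mul_deriv_eq_deriv_mul (a := 0) (b := 2 * Real.pi)
      (fun t _ => dK t) (fun t _ => dI t)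
      ((by fun_prop : Continuous fun t => 2 * r t * Real.exp (-κ t)).intervalIntegrable _ _)
      (Fc.intervalIntegrable _ _)
    rw [K0, zero_mul, sub_zero] at parts
    have ftc := intervalIntegral.integral_eq_sub_of_hasDerivAt (a := 0) (b := 2 * Real.pi)
      (fun t _ => dK t)
      ((by fun_prop : Continuous fun t => 2 * r t * Real.exp (-κ t)).intervalIntegrable _ _)
    rw [K0, sub_zero] at ftc
    have e (t : ℝ) : G₁ t = w₀ / 2 * (2 * r t * Real.exp (-κ t))
        - 2 * r t * Real.exp (-κ t) * I t := by
      simp only [hG₁, hw]; ring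
    simp only [e]
    rw [intervalIntegral.integral_sub
      ((by fun_prop : Continuous fun t => w₀ / 2 * (2 * r t * Real.exp (-κ t))).intervalIntegrable
        _ _)
      ((by fun_prop : Continuous fun t => 2 * r t * Real.exp (-κ t) * I t).intervalIntegrable _ _),
      intervalIntegral.integral_const_mul, ftc]
    have : w₀ / 2 * K (2 * Real.pi) = K (2 * Real.pi) * I (2 * Real.pi) - J := by
      rw [hw₀]; field_simp
    rw [this, hJ, parts]
    ring
  have p0 : Function.Periodic G (2 * Real.pi) := by
    intro t
    have h1 := p1.intervalIntegral_add_eq t 0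
    rw [zero_add, hG2pi] at h1
    have h2 := intervalIntegral.integral_add_adjacent_intervals (a := 0) (b := t)
      (c := t + 2 * Real.pi) (G₁c.intervalIntegrable _ _) (G₁c.intervalIntegrable (μ := volume) _ _)
    rw [h1, add_zero] at h2
    exact h2.symm
  have p2 := periodic_of_hasDerivAt p1 d1
  have p3 := periodic_of_hasDerivAt p2 d2
  have Gc : Continuous G := continuous_iff_continuousAt.2 fun θ => (d0 θ).continuousAt
  obtain ⟨k0, b0⟩ := exists_abs_le_of_periodic p0 hpi Gc
  obtain ⟨k1, b1⟩ := exists_abs_le_of_periodic p1 hpi G₁c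
  obtain ⟨k2, b2⟩ := exists_abs_le_of_periodic p2 hpi G₂c
  obtain ⟨k3, b3⟩ := exists_abs_le_of_periodic p3 hpi G₃c
  refine ⟨G, G₁, G₂, max (max k0 k1) (max k2 k3),
    isPhaseFunction_of_hasDerivAt p0 d0 d1 d2
      (fun t => (b0 t).trans ((le_max_left _ _).trans (le_max_left _ _)))
      (fun t => (b1 t).trans ((le_max_right _ _).trans (le_max_left _ _)))
      (fun t => (b2 t).trans ((le_max_left _ _).trans (le_max_right _ _)))
      (fun t => (b3 t).trans ((le_max_right _ _).trans (le_max_right _ _))), fun θ => ?_⟩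
  have hne := (apos θ).ne'
  simp only [hG₂, ha₁, hΦ]
  field_simp
  ring

end IsCenteredPair

end Density

/-! ### Asymptotics for centered potentials -/

/-- The mean of `1 + cos 4θ` in the density `rhoZero`. -/
def meanCosFour {S : Type*} [MeasurableSpace S] (μ : Measure S) (v : S → ℝ) (ε : ℝ) : ℝ :=
  (∫ θ in (0 : ℝ)..(2 * Real.pi), rhoZero μ v ε θ * (1 + Real.cos (4 * θ))) / (2 * Real.pi)

theorem meanCosFour_eq {S : Type*} [MeasurableSpace S] (μ : Measure S) (v : S → ℝ) (ε : ℝ) : meanCosFour μ v ε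
    = (∫ θ in (0 : ℝ)..(2 * Real.pi), preDensity μ v ε θ * (1 + Real.cos (4 * θ)))
      / ∫ θ in (0 : ℝ)..(2 * Real.pi), preDensity μ v ε θ := by
  have hpi : (2 * Real.pi : ℝ) ≠ 0 := by positivity
  simp only [meanCosFour, rhoZero, mul_assoc]
  rw [intervalIntegral.integral_const_mul]
  field_simp

theorem IsCenteredPair.meanCosFour_pos {S : Type*} [MeasurableSpace S] {μ : Measure S}
    {v : S → ℝ} {ε V : ℝ} (h : IsCenteredPair μ v ε V) :
    0 < meanCosFour μ v ε := by
  rw [meanCosFour_eq]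
  have hpi : (0 : ℝ) < 2 * Real.pi := by positivity
  have hc := h.continuous_preDensity
  refine div_pos ?_ h.integral_preDensity_pos
  refine intervalIntegral.integral_pos hpi (by fun_prop) (fun θ hθ => ?_)
    ⟨0, ⟨le_rfl, hpi.le⟩, ?_⟩
  · exact mul_nonneg (h.preDensity_pos ⟨hθ.1.le, hθ.2⟩).le (by linarith [Real.neg_one_le_cos (4 * θ)])
  · have := h.preDensity_pos ⟨le_rfl, hpi.le⟩
    rw [mul_zero, Real.cos_zero]
    linarith

section Asymptotic

variable {S : Type*} [MeasurableSpace S] (μ : Measure S) [IsProbabilityMeasure μ] {v : S → ℝ}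

theorem isCenteredPair_of_integral_eq_zero (ε : ℝ) (h1 : Integrable v μ)
    (h2 : Integrable (fun s => v s ^ 2) μ) (hm : ∫ s, v s ∂μ = 0) (hV : 0 < ∫ s, v s ^ 2 ∂μ) :
    IsCenteredPair μ v ε (∫ s, v s ^ 2 ∂μ) where
  pos := hV
  meanPSq_eq θ := by rw [meanPSq_eq μ h1 h2, hm, phaseVar]; ring
  meanQ_eq θ := by rw [meanQ_eq μ h1 h2, hm]; ring

/-- With mean zero the order λ drift vanishes and the corrector can be independent of λ: the
averaged equation makes the expanded drift exactly 2aλ², hence `C₁ := 0`. -/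
theorem lyapunovAsymptotic_of_integral_eq_zero (hv : Measurable v) {B : ℝ} (hB0 : 0 ≤ B)
    (hB : ∀ s, |v s| ≤ B) (ε : ℝ) (hm : ∫ s, v s ∂μ = 0) (hV : 0 < ∫ s, v s ^ 2 ∂μ) :
    LyapunovAsymptotic μ v ε (1 / 8 * (∫ s, v s ^ 2 ∂μ) * meanCosFour μ v ε) := by
  have h1 : Integrable v μ := integrable_of_measurable_of_abs_le μ hv hB
  have h2 : Integrable (fun s => v s ^ 2) μ :=
    integrable_of_measurable_of_abs_le μ (hv.pow_const 2) (C := B ^ 2) (fun s => by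
      rw [abs_pow]; exact pow_le_pow_left₀ (abs_nonneg _) (hB s) 2)
  have h := isCenteredPair_of_integral_eq_zero μ ε h1 h2 hm hV
  obtain ⟨G, G₁, G₂, K, hG, hsol⟩ := h.exists_phaseFunction
  set V := ∫ s, v s ^ 2 ∂μ with hVdef
  have hcoef : (∫ t in (0 : ℝ)..(2 * Real.pi), preDensity μ v ε t * modulusGrowth V t)
      / ∫ t in (0 : ℝ)..(2 * Real.pi), preDensity μ v ε t
      = 2 * (1 / 8 * V * meanCosFour μ v ε) := by
    have e (t : ℝ) : preDensity μ v ε t * modulusGrowth V t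
        = V / 4 * (preDensity μ v ε t * (1 + Real.cos (4 * t))) := by
      rw [modulusGrowth_eq]; ring
    simp only [e]
    rw [intervalIntegral.integral_const_mul, meanCosFour_eq]
    ring
  have hpos := h.meanCosFour_pos
  refine lyapunovAsymptotic_of_phaseFunction μ hv hB0 hB ε (K := K) (C₁ := 0) (by positivity)
    ((abs_nonneg _).trans (hG.abs_le 0)) (fun _ => G) (fun _ => G₁) (fun _ => G₂)
    (fun _ _ => hG) (fun lam _ θ => ?_)
  have hs := hsol θ
  rw [hcoef] at hs
  rw [hm, ← hVdef, ← hs, driftExpansion, phaseVar, modulusGrowth, zero_mul]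
  refine le_of_eq ?_
  rw [abs_eq_zero]
  ring

end Asymptotic

/-! ### Beta integrals and the Gamma quotient -/

/-- After doubling the angle, cos² has period π and is symmetric about π/2, so the integral reduces
to quarter periods. -/
theorem integral_comp_cos_two_mul_sq {φ : ℝ → ℝ} (hφ : Continuous fun u => φ (Real.cos u ^ 2)) :
    ∫ θ in (0 : ℝ)..(2 * Real.pi), φ (Real.cos (2 * θ) ^ 2)
      = 4 * ∫ u in (0 : ℝ)..(Real.pi / 2), φ (Real.cos u ^ 2) := by
  set F : ℝ → ℝ := fun u => φ (Real.cos u ^ 2) with hF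
  have hper : Function.Periodic F Real.pi := by
    intro u; simp only [hF, Real.cos_add_pi, neg_sq]
  have hi (a b : ℝ) : IntervalIntegrable F volume a b := hφ.intervalIntegrable a b
  have h1 : ∫ θ in (0 : ℝ)..(2 * Real.pi), F (2 * θ)
      = 2⁻¹ * ∫ u in (0 : ℝ)..(4 * Real.pi), F u := by
    rw [intervalIntegral.integral_comp_mul_left _ two_ne_zero, mul_zero, smul_eq_mul]
    congr 2; ring
  have h2 : ∫ u in (0 : ℝ)..(4 * Real.pi), F u = 4 * ∫ u in (0 : ℝ)..Real.pi, F u := by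
    have := hper.intervalIntegral_add_zsmul_eq 4 0 (fun a b => hi a b)
    simpa using this
  have h3 : ∫ u in (0 : ℝ)..Real.pi, F u = 2 * ∫ u in (0 : ℝ)..(Real.pi / 2), F u := by
    have h4 := intervalIntegral.integral_comp_sub_left F Real.pi (a := 0) (b := Real.pi / 2)
    have h5 (u : ℝ) : F (Real.pi - u) = F u := by simp only [hF, Real.cos_pi_sub, neg_sq]
    simp only [h5] at h4
    rw [sub_zero, show Real.pi - Real.pi / 2 = Real.pi / 2 by ring] at h4
    rw [← intervalIntegral.integral_add_adjacent_intervals (hi 0 (Real.pi / 2))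
      (hi (Real.pi / 2) Real.pi), ← h4]
    ring
  calc ∫ θ in (0 : ℝ)..(2 * Real.pi), φ (Real.cos (2 * θ) ^ 2)
      = ∫ θ in (0 : ℝ)..(2 * Real.pi), F (2 * θ) := rfl
    _ = _ := by rw [h1, h2, h3]; ring

theorem integral_rpow_mul_one_sub_rpow {a b : ℝ} (ha : 0 < a) (hb : 0 < b) :
    ∫ x in Set.Ioo (0 : ℝ) 1, x ^ (a - 1) * (1 - x) ^ (b - 1)
      = Real.Gamma a * Real.Gamma b / Real.Gamma (a + b) := by
  have h := ProbabilityTheory.beta_eq_betaIntegralReal a b ha hb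
  rw [ProbabilityTheory.beta] at h
  rw [h, Complex.betaIntegral]
  have e : ∫ x in (0 : ℝ)..1, (x : ℂ) ^ ((a : ℂ) - 1) * (1 - (x : ℂ)) ^ ((b : ℂ) - 1)
      = ∫ x in (0 : ℝ)..1, ((x ^ (a - 1) * (1 - x) ^ (b - 1) : ℝ) : ℂ) := by
    apply intervalIntegral.integral_congr
    intro x hx
    rw [Set.uIcc_of_le zero_le_one] at hx
    have h1 : (0 : ℝ) ≤ 1 - x := by linarith [hx.2]
    push_cast [Complex.ofReal_cpow hx.1, Complex.ofReal_cpow h1]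
    rfl
  rw [e, intervalIntegral.integral_ofReal, Complex.ofReal_re,
    intervalIntegral.integral_of_le zero_le_one, integral_Ioc_eq_integral_Ioo]

theorem image_cos_pow_four : (fun u => Real.cos u ^ 4) '' Set.Ioo 0 (Real.pi / 2)
    = Set.Ioo (0 : ℝ) 1 := by
  ext x
  constructor
  · rintro ⟨u, hu, rfl⟩
    have h0 : 0 < Real.cos u := Real.cos_pos_of_mem_Ioo ⟨by linarith [hu.1, Real.pi_pos], hu.2⟩
    have h1 : Real.cos u < 1 := by
      have := Real.cos_lt_cos_of_nonneg_of_le_pi_div_two le_rfl hu.2.le hu.1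
      rwa [Real.cos_zero] at this
    exact ⟨by positivity, pow_lt_one₀ h0.le h1 (by norm_num)⟩
  · rintro ⟨h0, h1⟩
    set y := x ^ (1 / 4 : ℝ) with hy
    have hy0 : 0 < y := Real.rpow_pos_of_pos h0 _
    have hy1 : y < 1 := Real.rpow_lt_one h0.le h1 (by norm_num)
    refine ⟨Real.arccos y, ⟨Real.arccos_pos.2 hy1, Real.arccos_lt_pi_div_two.2 hy0⟩, ?_⟩
    simp only
    rw [Real.cos_arccos (by linarith) hy1.le, hy, ← Real.rpow_natCast, ← Real.rpow_mul h0.le]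
    norm_num

theorem injOn_cos_pow_four : Set.InjOn (fun u => Real.cos u ^ 4) (Set.Ioo 0 (Real.pi / 2)) := by
  intro u hu w hw h
  have hpos {t : ℝ} (ht : t ∈ Set.Ioo 0 (Real.pi / 2)) : 0 ≤ Real.cos t :=
    (Real.cos_pos_of_mem_Ioo ⟨by linarith [ht.1, Real.pi_pos], ht.2⟩).le
  have h1 : Real.cos u = Real.cos w :=
    (pow_left_inj₀ (hpos hu) (hpos hw) (by norm_num : (4 : ℕ) ≠ 0)).1 h
  have hmem {t : ℝ} (ht : t ∈ Set.Ioo 0 (Real.pi / 2)) : t ∈ Set.Icc 0 Real.pi :=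
    ⟨ht.1.le, by linarith [ht.2, Real.pi_pos]⟩
  exact Real.injOn_cos (hmem hu) (hmem hw) h1

/-- The substitution `x = cos⁴ u` in the Beta integral `B(a, 1/2)`. -/
theorem integral_cos_rpow_div_sqrt {a : ℝ} (ha : 0 < a) :
    ∫ u in Set.Ioo (0 : ℝ) (Real.pi / 2),
      Real.cos u ^ (4 * a - 1) * (1 + Real.cos u ^ 2) ^ (-(1 / 2) : ℝ)
      = Real.Gamma a * Real.Gamma (1 / 2) / Real.Gamma (a + 1 / 2) / 4 := by
  have hder (u : ℝ) (_ : u ∈ Set.Ioo 0 (Real.pi / 2)) : HasDerivWithinAt (fun u => Real.cos u ^ 4)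
      (-(4 * Real.cos u ^ 3 * Real.sin u)) (Set.Ioo 0 (Real.pi / 2)) u := by
    refine (((Real.hasDerivAt_cos u).fun_pow 4).congr_deriv ?_).hasDerivWithinAt
    push_cast; ring
  have h := integral_image_eq_integral_abs_deriv_smul measurableSet_Ioo hder injOn_cos_pow_four
    (fun x => x ^ (a - 1) * (1 - x) ^ ((1 / 2 : ℝ) - 1))
  rw [image_cos_pow_four, integral_rpow_mul_one_sub_rpow ha one_half_pos] at h
  rw [h, eq_div_iff four_ne_zero, mul_comm, ← integral_const_mul]
  apply setIntegral_congr_fun measurableSet_Ioo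
  intro u hu
  have hc : 0 < Real.cos u := Real.cos_pos_of_mem_Ioo ⟨by linarith [hu.1, Real.pi_pos], hu.2⟩
  have hs : 0 < Real.sin u := Real.sin_pos_of_pos_of_lt_pi hu.1 (by linarith [hu.2, Real.pi_pos])
  have hcs := Real.sin_sq_add_cos_sq u
  -- With exponent -1/2 the factor sin²u gives 1/sin u, which cancels the sine of the Jacobian.
  have e1 : 1 - Real.cos u ^ 4 = Real.sin u ^ 2 * (1 + Real.cos u ^ 2) := by
    linear_combination (-(1 + Real.cos u ^ 2)) * hcs
  have e2 : (Real.sin u ^ 2) ^ ((1 / 2 : ℝ) - 1) = (Real.sin u)⁻¹ := by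
    rw [← Real.rpow_natCast, ← Real.rpow_mul hs.le, ← Real.rpow_neg_one]
    norm_num
  have e3 : (Real.cos u ^ 4) ^ (a - 1) = Real.cos u ^ (4 * a - 1) * (Real.cos u ^ 3)⁻¹ := by
    rw [← Real.rpow_natCast, ← Real.rpow_mul hc.le, ← Real.rpow_natCast, ← Real.rpow_neg hc.le,
      ← Real.rpow_add hc]
    congr 1
    push_cast
    ring
  have e4 : ((1 / 2 : ℝ) - 1) = -(1 / 2) := by norm_num
  simp only [smul_eq_mul]
  rw [e1, Real.mul_rpow (sq_nonneg _) (by positivity), e2, e3, e4, abs_neg,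
    abs_of_pos (by positivity)]
  field_simp

theorem continuous_one_add_rpow {f : ℝ → ℝ} (hf : Continuous f) :
    Continuous fun t => (1 + f t ^ 2) ^ (-(1 / 2) : ℝ) := by
  refine Continuous.rpow_const (by fun_prop) fun t => Or.inl ?_
  positivity

/-- Since 1 + cos 4θ = 2cos²2θ, the denominator is the Beta integral with a = 1/4 and the numerator
twice the one with a = 3/4; Γ(5/4) = Γ(1/4)/4 gives the constant 8. -/
theorem integral_ratio_eq_Gamma :
    (∫ θ in (0 : ℝ)..(2 * Real.pi), (1 + Real.cos (2 * θ) ^ 2) ^ (-(1 / 2) : ℝ)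
        * (1 + Real.cos (4 * θ)))
      / (∫ θ in (0 : ℝ)..(2 * Real.pi), (1 + Real.cos (2 * θ) ^ 2) ^ (-(1 / 2) : ℝ))
      = 8 * (Real.Gamma (3 / 4) / Real.Gamma (1 / 4)) ^ 2 := by
  have hw := continuous_one_add_rpow Real.continuous_cos
  have h1 := integral_comp_cos_two_mul_sq (φ := fun x => (1 + x) ^ (-(1 / 2) : ℝ)) hw
  have h2 := integral_comp_cos_two_mul_sq (φ := fun x => (1 + x) ^ (-(1 / 2) : ℝ) * (2 * x))
    (hw.mul (by fun_prop))
  have e (θ : ℝ) : 1 + Real.cos (4 * θ) = 2 * Real.cos (2 * θ) ^ 2 := by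
    rw [show 4 * θ = 2 * (2 * θ) by ring, Real.cos_two_mul (2 * θ)]; ring
  have hIoo (f : ℝ → ℝ) : ∫ u in (0 : ℝ)..(Real.pi / 2), f u
      = ∫ u in Set.Ioo (0 : ℝ) (Real.pi / 2), f u := by
    rw [intervalIntegral.integral_of_le (by positivity), integral_Ioc_eq_integral_Ioo]
  have k1 := integral_cos_rpow_div_sqrt (a := 1 / 4) (by norm_num)
  have k2 := integral_cos_rpow_div_sqrt (a := 3 / 4) (by norm_num)
  rw [show (4 * (1 / 4) - 1 : ℝ) = 0 by norm_num, show (1 / 4 + 1 / 2 : ℝ) = 3 / 4 by norm_num] at k1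
  rw [show (4 * (3 / 4) - 1 : ℝ) = ((2 : ℕ) : ℝ) by norm_num,
    show (3 / 4 + 1 / 2 : ℝ) = 1 / 4 + 1 by norm_num,
    Real.Gamma_add_one (by norm_num)] at k2
  simp only [Real.rpow_zero, one_mul, Real.rpow_natCast] at k1 k2
  have e2 (u : ℝ) : (1 + Real.cos u ^ 2) ^ (-(1 / 2) : ℝ) * (2 * Real.cos u ^ 2)
      = 2 * (Real.cos u ^ 2 * (1 + Real.cos u ^ 2) ^ (-(1 / 2) : ℝ)) := by ring
  simp only [e]
  rw [h1, h2]
  simp only [e2]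
  rw [intervalIntegral.integral_const_mul, hIoo, hIoo, k1, k2]
  have g1 : 0 < Real.Gamma (1 / 4) := Real.Gamma_pos_of_pos (by norm_num)
  have g2 : 0 < Real.Gamma (3 / 4) := Real.Gamma_pos_of_pos (by norm_num)
  have g3 : 0 < Real.Gamma (1 / 2) := Real.Gamma_pos_of_pos (by norm_num)
  field_simp
  norm_num

section Density

variable {S : Type*} [MeasurableSpace S] {μ : Measure S} {v : S → ℝ} {V : ℝ}

namespace IsCenteredPair

variable (h : IsCenteredPair μ v 0 V)
include h

/-- For ε = 0 the mean of q vanishes, so κ = 0 and C = 0, and only the square root factor survives.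
-/
theorem preDensity_of_eps_eq_zero (θ : ℝ) : preDensity μ v 0 θ
    = (Real.sqrt (V / 2))⁻¹ * (1 + Real.cos (2 * θ) ^ 2) ^ (-(1 / 2) : ℝ) := by
  have hκ (t : ℝ) : kappa μ v 0 t = 0 := by simp [kappa, h.meanQ_eq]
  have hC : constC μ v 0 = 0 := by simp [constC, hκ]
  have hV := h.pos
  rw [h.preDensity_eq, hκ, hC, invSqrtVar, phaseVar_eq, Real.sqrt_mul (by positivity), mul_inv,
    Real.rpow_neg (by positivity), ← Real.sqrt_eq_rpow]
  simp

theorem rhoZero_of_eps_eq_zero (θ : ℝ) : rhoZero μ v 0 θ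
    = ((∫ t in (0 : ℝ)..(2 * Real.pi), (1 + Real.cos (2 * t) ^ 2) ^ (-(1 / 2) : ℝ)) /
        (2 * Real.pi))⁻¹ * (1 + Real.cos (2 * θ) ^ 2) ^ (-(1 / 2) : ℝ) := by
  have hV := h.pos
  have hs : Real.sqrt (V / 2) ≠ 0 := (Real.sqrt_pos.2 (by positivity)).ne'
  simp only [rhoZero, h.preDensity_of_eps_eq_zero]
  rw [intervalIntegral.integral_const_mul]
  simp only [mul_inv, div_eq_mul_inv, inv_inv]
  field_simp

theorem meanCosFour_of_eps_eq_zero :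
    meanCosFour μ v 0 = 8 * (Real.Gamma (3 / 4) / Real.Gamma (1 / 4)) ^ 2 := by
  have hV := h.pos
  have hs : Real.sqrt (V / 2) ≠ 0 := (Real.sqrt_pos.2 (by positivity)).ne'
  rw [meanCosFour_eq, ← integral_ratio_eq_Gamma]
  simp only [h.preDensity_of_eps_eq_zero, mul_assoc]
  rw [intervalIntegral.integral_const_mul, intervalIntegral.integral_const_mul,
    mul_div_mul_left _ _ (inv_ne_zero hs)]

end IsCenteredPair

end Density

theorem rhoZero_congr {S : Type*} [MeasurableSpace S] (μ : Measure S) {v v' : S → ℝ} {ε : ℝ} (hp : ∀ θ, meanPSq μ v θ = meanPSq μ v' θ)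
    (hq : ∀ θ, meanQ μ v ε θ = meanQ μ v' ε θ) (θ : ℝ) :
    rhoZero μ v ε θ = rhoZero μ v' ε θ := by
  simp only [rhoZero, preDensity, constC, bigK, kappa, hp, hq]

/-! ### Reduction to the three cases and conclusion -/

section Main

variable {S : Type*} [MeasurableSpace S] (μ : Measure S) [IsProbabilityMeasure μ] {v : S → ℝ}

theorem integral_sub_mean_sq (h1 : Integrable v μ) (h2 : Integrable (fun s => v s ^ 2) μ) :
    ∫ s, (v s - ∫ s, v s ∂μ) ^ 2 ∂μ = (∫ s, v s ^ 2 ∂μ) - (∫ s, v s ∂μ) ^ 2 := by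
  set m := ∫ s, v s ∂μ with hm
  have e : (fun s => (v s - m) ^ 2) = fun s => v s ^ 2 - 2 * m * v s + m ^ 2 := by
    funext s; ring
  have i1 : Integrable (fun s => v s ^ 2 - 2 * m * v s) μ := h2.sub (h1.const_mul _)
  rw [e, integral_add i1 (integrable_const _), integral_sub h2 (h1.const_mul _),
    integral_const_mul, ← hm]
  simp only [integral_const, probReal_univ, one_smul]
  ring

theorem ae_eq_mean_of_variance_eq_zero (h1 : Integrable v μ)
    (h2 : Integrable (fun s => v s ^ 2) μ)
    (h : (∫ s, v s ^ 2 ∂μ) - (∫ s, v s ∂μ) ^ 2 = 0) : v =ᵐ[μ] fun _ => ∫ s, v s ∂μ := by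
  rw [← integral_sub_mean_sq μ h1 h2] at h
  have hi : Integrable (fun s => (v s - ∫ s, v s ∂μ) ^ 2) μ := by
    have : (fun s => (v s - ∫ s, v s ∂μ) ^ 2)
        = fun s => v s ^ 2 - 2 * (∫ s, v s ∂μ) * v s + (∫ s, v s ∂μ) ^ 2 := by
      funext s; ring
    rw [this]
    exact (h2.sub (h1.const_mul _)).add (integrable_const _)
  have := (integral_eq_zero_iff_of_nonneg (fun s => sq_nonneg _) hi).1 h
  filter_upwards [this] with s hs
  exact sub_eq_zero.1 (pow_eq_zero_iff two_ne_zero |>.1 hs)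

/-- The band center asymptotics of the Lyapunov exponent, with the coefficient in both cases. -/
theorem exists_lyapunovAsymptotic (hv : Measurable v) (hbdd : ∃ B : ℝ, ∀ᵐ s ∂μ, |v s| ≤ B) (ε : ℝ) :
    ∃ a, LyapunovAsymptotic μ v ε a ∧
      ((∫ s, v s ∂μ) ≠ 0 → a = 1 / 8 * ((∫ s, v s ^ 2 ∂μ) - (∫ s, v s ∂μ) ^ 2)) ∧
      ((∫ s, v s ∂μ) = 0 → a = 1 / 8 * (∫ s, v s ^ 2 ∂μ) * meanCosFour μ v ε) := by
  obtain ⟨B, hB⟩ := hbdd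
  -- Truncation turns the almost sure bound into the pointwise bound that `IsSLStep` requires.
  set v' : S → ℝ := fun s => max (-|B|) (min |B| (v s)) with hv'
  have hv'm : Measurable v' := measurable_const.max (measurable_const.min hv)
  have hv'B (s : S) : |v' s| ≤ |B| := by
    rw [abs_le]
    exact ⟨le_max_left _ _, max_le (by linarith [abs_nonneg B]) (min_le_left _ _)⟩
  have hae : v' =ᵐ[μ] v := by
    filter_upwards [hB] with s hs
    have := abs_le.1 (hs.trans (le_abs_self B))
    simp only [hv', min_eq_right this.2, max_eq_right this.1]
  have hae2 : (fun s => v' s ^ 2) =ᵐ[μ] fun s => v s ^ 2 := by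
    filter_upwards [hae] with s hs
    rw [hs]
  have i1' : Integrable v' μ := integrable_of_measurable_of_abs_le μ hv'm hv'B
  have i2' : Integrable (fun s => v' s ^ 2) μ :=
    integrable_of_measurable_of_abs_le μ (hv'm.pow_const 2) (C := |B| ^ 2) (fun s => by
      rw [abs_pow]; exact pow_le_pow_left₀ (abs_nonneg _) (hv'B s) 2)
  have i1 : Integrable v μ := i1'.congr hae
  have i2 : Integrable (fun s => v s ^ 2) μ := i2'.congr hae2
  have e1 : ∫ s, v' s ∂μ = ∫ s, v s ∂μ := integral_congr_ae hae
  have e2 : ∫ s, v' s ^ 2 ∂μ = ∫ s, v s ^ 2 ∂μ := integral_congr_ae hae2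
  have hvar0 : 0 ≤ (∫ s, v s ^ 2 ∂μ) - (∫ s, v s ∂μ) ^ 2 := by
    rw [← integral_sub_mean_sq μ i1 i2]
    exact integral_nonneg fun s => sq_nonneg _
  rcases hvar0.eq_or_lt with hvar | hvar
  -- Zero variance: the value 0 agrees with both formulas, since a zero mean then forces a zero
  -- second moment and the coefficient vanishes whatever the density integral is.
  · refine ⟨0, ?_, fun _ => by rw [← hvar, mul_zero], fun hm => ?_⟩
    · exact (lyapunovAsymptotic_of_const μ _ ε).congr μ
        (ae_eq_mean_of_variance_eq_zero μ i1 i2 hvar.symm).symm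
    · rw [hm] at hvar
      have : ∫ s, v s ^ 2 ∂μ = 0 := by linarith
      rw [this]; ring
  by_cases hm : ∫ s, v s ∂μ = 0
  · rw [hm] at hvar
    refine ⟨_, (lyapunovAsymptotic_of_integral_eq_zero μ hv'm (abs_nonneg B) hv'B ε (by rw [e1, hm])
      (by rw [e2]; linarith)).congr μ hae, fun h => absurd hm h, fun _ => ?_⟩
    rw [e2]
    congr 1
    simp only [meanCosFour]
    congr 2
    funext θ
    rw [rhoZero_congr μ (v := v') (v' := v) (fun t => by rw [meanPSq_eq μ i1' i2', meanPSq_eq μ i1 i2, e1, e2])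
      (fun t => by rw [meanQ_eq μ i1' i2', meanQ_eq μ i1 i2, e1])]
  · refine ⟨_, (lyapunovAsymptotic_of_integral_ne_zero μ hv'm (abs_nonneg B) hv'B ε (by rwa [e1])
      (by rwa [e1, e2])).congr μ hae, fun _ => by rw [e1, e2], fun h => absurd h hm⟩

theorem IsLyapunovExponent.unique {ε lam g g' : ℝ} (h : IsLyapunovExponent μ v ε lam g)
    (h' : IsLyapunovExponent μ v ε lam g') : g = g' :=
  tendsto_nhds_unique (h 0) (h' 0)

theorem LyapunovAsymptotic.exists_isBigO {ε a : ℝ} (h : LyapunovAsymptotic μ v ε a) :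
    ∃ γ : ℝ → ℝ, (∀ᶠ lam in 𝓝 (0 : ℝ), IsLyapunovExponent μ v ε lam (γ lam)) ∧
      (fun lam : ℝ => γ lam - a * lam ^ 2) =O[𝓝 0] fun lam : ℝ => lam ^ 3 := by
  obtain ⟨C, l₀, hl₀, h⟩ := h
  choose! γ hγ using h
  have hev : ∀ᶠ lam in 𝓝 (0 : ℝ), |lam| ≤ l₀ := by
    filter_upwards [Metric.ball_mem_nhds (0 : ℝ) hl₀] with lam hlam
    simpa using (Metric.mem_ball.1 hlam).le
  refine ⟨γ, hev.mono fun lam hlam => (hγ lam hlam).1, IsBigO.of_bound C ?_⟩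
  filter_upwards [hev] with lam hlam
  rw [norm_pow, Real.norm_eq_abs, Real.norm_eq_abs]
  exact (hγ lam hlam).2

end Main

end

end AndersonBandCenter

theorem mainTheorem4 {S : Type*} [MeasurableSpace S] (μ : Measure S) [IsProbabilityMeasure μ]
    (v : S → ℝ) (hv : Measurable v) (hbdd : ∃ B : ℝ, ∀ᵐ s ∂μ, |v s| ≤ B) (ε : ℝ) :
    ∃ γ : ℝ → ℝ,
      (∀ᶠ lam in 𝓝 (0 : ℝ), IsLyapunovExponent μ v ε lam (γ lam)) ∧
      ((∫ s, v s ∂μ) ≠ 0 →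
        (fun lam : ℝ => γ lam -
            1 / 8 * lam ^ 2 * ((∫ s, v s ^ 2 ∂μ) - (∫ s, v s ∂μ) ^ 2))
          =O[𝓝 0] fun lam : ℝ => lam ^ 3) ∧
      ((∫ s, v s ∂μ) = 0 →
        ((fun lam : ℝ => γ lam -
            1 / 8 * lam ^ 2 * (∫ s, v s ^ 2 ∂μ) *
              ((∫ θ in (0 : ℝ)..(2 * Real.pi), rhoZero μ v ε θ * (1 + Real.cos (4 * θ))) /
                (2 * Real.pi)))
          =O[𝓝 0] fun lam : ℝ => lam ^ 3) ∧
        (¬ v =ᵐ[μ] 0 →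
          0 < 1 / 8 * (∫ s, v s ^ 2 ∂μ) *
              ((∫ θ in (0 : ℝ)..(2 * Real.pi), rhoZero μ v ε θ * (1 + Real.cos (4 * θ))) /
                (2 * Real.pi)))) ∧
      ((∫ s, v s ∂μ) = 0 → ε = 0 →
        (¬ v =ᵐ[μ] 0 → ∀ θ : ℝ, rhoZero μ v ε θ =
          ((∫ t in (0 : ℝ)..(2 * Real.pi), (1 + Real.cos (2 * t) ^ 2) ^ (-(1 / 2) : ℝ)) /
              (2 * Real.pi))⁻¹ *
            (1 + Real.cos (2 * θ) ^ 2) ^ (-(1 / 2) : ℝ)) ∧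
        ((fun lam : ℝ => γ lam -
            lam ^ 2 * (∫ s, v s ^ 2 ∂μ) * (Real.Gamma (3 / 4) / Real.Gamma (1 / 4)) ^ 2)
          =O[𝓝 0] fun lam : ℝ => lam ^ 3)) := by
  obtain ⟨a, ha, hane, haz⟩ := exists_lyapunovAsymptotic μ hv hbdd ε
  obtain ⟨γ, hγ, hO⟩ := ha.exists_isBigO μ
  have i1 : Integrable v μ := by
    obtain ⟨B, hB⟩ := hbdd
    exact Integrable.of_bound hv.aestronglyMeasurable B hB
  have i2 : Integrable (fun s => v s ^ 2) μ := by
    obtain ⟨B, hB⟩ := hbdd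
    refine Integrable.of_bound (hv.pow_const 2).aestronglyMeasurable (B ^ 2) ?_
    filter_upwards [hB] with s hs
    rw [norm_pow]
    exact pow_le_pow_left₀ (norm_nonneg _) hs 2
  have hV0 : 0 ≤ ∫ s, v s ^ 2 ∂μ := integral_nonneg fun s => sq_nonneg _
  have hVne (hne : ¬ v =ᵐ[μ] 0) : 0 < ∫ s, v s ^ 2 ∂μ := by
    refine lt_of_le_of_ne hV0 fun h0 => hne ?_
    filter_upwards [(integral_eq_zero_iff_of_nonneg (fun s => sq_nonneg _) i2).1 h0.symm] with s hs
    exact pow_eq_zero_iff two_ne_zero |>.1 hs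
  refine ⟨γ, hγ, fun hm => ?_, fun hm => ⟨?_, fun hne => ?_⟩, fun hm hε => ⟨fun hne θ => ?_, ?_⟩⟩
  · convert hO using 3 with lam
    rw [hane hm]
    ring
  · convert hO using 3 with lam
    rw [haz hm, meanCosFour]
    ring
  · have h := isCenteredPair_of_integral_eq_zero μ ε i1 i2 hm (hVne hne)
    exact mul_pos (by linarith [hVne hne]) (h.meanCosFour_pos)
  · subst hε
    exact (isCenteredPair_of_integral_eq_zero μ 0 i1 i2 hm (hVne hne)).rhoZero_of_eps_eq_zero θ
  · subst hε
    convert hO using 3 with lam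
    rw [haz hm]
    -- If the second moment vanishes there is no centered pair with positive variance, but both
    -- coefficients are 0.
    rcases hV0.eq_or_lt with h0 | h0
    · rw [← h0]; ring
    · rw [(isCenteredPair_of_integral_eq_zero μ 0 i1 i2 hm h0).meanCosFour_of_eps_eq_zero]
      ring
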